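/- Let $\mathbf k$ be an algebraically closed field of characteristic zero, $n>1$, $\mathfrak g=\mathfrak{sl}_n(\mathbf k)$ with its diagonal Cartan subalgebra $\mathfrak h$, roots $\varepsilon_i-\varepsilon_j$ and simple roots $\alpha_i=\varepsilon_i-\varepsilon_{i+1}$. Let $\mathscr J^+,\mathscr J^-$ be two partitions of $[1,n]$ into intervals, and let $\pi^\pm$ be the set of $\alpha_i$ such that $i,i+1$ lie in one interval of $\mathscr J^\pm$; assume that $\pi^+\cup\pi^-$ contains all simple roots. Let $\mathfrak q\subset\mathfrak g$ be the biparabolic subalgebra containing $\mathfrak h$ whose positive (resp. negative) roots are the positive (resp. negative) roots in $\mathbb Z\pi^-$ (resp. $\mathbb Z\pi^+$), and let $\mathfrak q_\Lambda$ be its canonical truncation, i.e. the common kernel in $\mathfrak q$ of the weights of all semi-invariants of the symmetric algebra $S(\mathfrak q)$. Set $\mathfrak h_\Lambda=\mathfrak h\cap\mathfrak q_\Lambda$. For a Lie algebra $\mathfrak a$, a form $f\in\mathfrak a^*$ is regular if its stabilizer for the coadjoint action has the least possible dimension, and an adapted pair is a pair $(h,\eta)\in\mathfrak a\times\mathfrak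 a^*$ with $\eta$ regular and $(\operatorname{ad}h)\eta=-\eta$. Identify $\mathfrak g^*$ with $\mathfrak g$ through the Killing form; $y\in\mathfrak g^*$ is nilpotent if it is ad-nilpotent as an element of $\mathfrak g$. Consider the following sets $S$ of roots. (1) Markings. Let $\iota^\pm$ be the involution of $\pi^\pm$ reversing each connected component. An arc above (resp. below) is an orbit $\{\alpha,\iota^+(\alpha)\}$, $\alpha\in\pi^+$ (resp. $\{\alpha,\iota^-(\alpha)\}$, $\alpha\in\pi^-$). On each connected component of the graph on the simple roots formed by all these arcs, mark exactly one arc; if the component contains arcs consisting of a single simple root (fixed by $\iota^+$ or $\iota^-$), the marked arc has to be one of those. (2) Modified involutions. Let $\kappa^\pm$ be the involution of $[1,n]$ reversing each interval of $\mathscr J^\pm$. A mark on the arc above (below) joining $\alpha_i$ and $\alpha_j$, $i\le j$, marks the point $i$ above (below); then $\kappa^+(i)=j+1$ (resp. $\kappa^-(i)=j+1$). For each maximal run $[p,q]$ of consecutive points marked above, let $A=[p,q]$ if $\kappa^+(q)=q+1$ and $A=[p,q+1]$ otherwise, and let $M=A\cup\kappa^+(A)$. Let $\sigma^+$ be any involution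 of $[1,n]$ that equals $\kappa^+$ outside all the sets $M$, stabilizes each $M$, and is anti-Toeplitz on each $M$: every pair $\{x,\sigma^+(x)\}$ with $x\in M$, $x\neq\sigma^+(x)$ has one member in $A$ and the other in $\kappa^+(A)$; and $M$ is a single orbit of $\langle\kappa^+,\sigma^+\rangle$, which is an edge (that is, also a single orbit of $\langle\kappa^+\sigma^+\rangle$) if $\kappa^+(q)\le q+2$, and a loop (that is, not an edge) otherwise. Let $\sigma^-$ be obtained in the same way from $\kappa^-$ and the points marked below. (3) $S=\{\varepsilon_i-\varepsilon_{\sigma^+(i)}: i<\sigma^+(i)\}\cup\{\varepsilon_i-\varepsilon_{\sigma^-(i)}: i>\sigma^-(i)\}$. For any such $S$ and any choice of root vectors $x_\alpha$ of weight $\alpha\in S$, let $\eta\in\mathfrak q_\Lambda^*$ be the restriction to $\mathfrak q_\Lambda$ of $\sum_{\alpha\in S}x_\alpha$, and let $\Xi$ be the set of all adapted pairs $(h,\eta)$ of $\mathfrak q_\Lambda$ with $h\in\mathfrak h_\Lambda$ and $\eta$ of this form. (The adapted pairs constructed in [A. Joseph, Slices for biparabolic coadjoint actions in type A, J. Algebra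 319 (2008)] belong to $\Xi$: there the anti-Toeplitz involutions are those given by anti-Coxeter and anti-Jordan blocks.) Theorem. Every $\eta$ of this form, in particular the second element of every $(h,\eta)\in\Xi$, is the restriction to $\mathfrak q_\Lambda$ of a regular nilpotent element $y\in\mathfrak g^*$. -/

import Mathlib

open LieAlgebra.SpecialLinear

namespace Biparabolic

/-! ### Coadjoint action, adapted pairs, canonical truncation (arbitrary Lie algebra) -/

section General

attribute [local instance 100] LieRing.ofAssociativeRing

variable (k : Type*) [Field k] {L : Type*} [LieRing L] [LieAlgebra k L]

/-- The stabilizer of a linear form `f` under the coadjoint action. -/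
def coadjointStabilizer (f : Module.Dual k L) : Submodule k L where
  carrier := {a | ⁅a, f⁆ = 0}
  add_mem' {a b} ha hb := by
    change ⁅a + b, f⁆ = 0
    rw [add_lie, show ⁅a, f⁆ = 0 from ha, show ⁅b, f⁆ = 0 from hb, add_zero]
  zero_mem' := zero_lie f
  smul_mem' c a ha := by
    change ⁅c • a, f⁆ = 0
    rw [smul_lie, show ⁅a, f⁆ = 0 from ha, smul_zero]

/-- A linear form is regular if its stabilizer has the minimal possible dimension. -/
def IsRegularForm (f : Module.Dual k L) : Prop :=
  ∀ g : Module.Dual k L,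
    Module.finrank k (coadjointStabilizer k f) ≤ Module.finrank k (coadjointStabilizer k g)

/-- `(h, η)` is an adapted pair: `η` is regular and `(ad h) η = -η`. -/
def IsAdaptedPair (h : L) (η : Module.Dual k L) : Prop :=
  IsRegularForm k η ∧ ⁅h, η⁆ = -η

/-- A linear form is nilpotent if it corresponds to an ad-nilpotent element under the Killing
form. -/
def IsNilpotentForm (y : Module.Dual k L) : Prop :=
  ∃ x : L, killingForm k L x = y ∧ IsNilpotent (LieAlgebra.ad k L x)

/-- `f` is a semi-invariant of weight `χ` in the symmetric algebra of `L`: it is non-zero, and for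
each `x` the (unique) derivation of the symmetric algebra that extends `ad x` multiplies `f`
by `χ x`. -/
def IsSemiInvariant (χ : LieAlgebra.LieCharacter k L) (f : SymmetricAlgebra k L) : Prop :=
  f ≠ 0 ∧ ∀ x : L, ∃ D : Derivation k (SymmetricAlgebra k L) (SymmetricAlgebra k L),
    (∀ z : L, D (SymmetricAlgebra.ι k L z) = SymmetricAlgebra.ι k L ⁅x, z⁆) ∧ D f = χ x • f

variable (L) in
/-- The canonical truncation: the common kernel of the weights of all semi-invariants in the
symmetric algebra. -/
noncomputable def canonicalTruncation : LieIdeal k L :=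
  ⨅ χ : {χ : LieAlgebra.LieCharacter k L // ∃ f, IsSemiInvariant k χ f}, χ.1.ker

end General

/-! ### Partitions of `{0, …, n-1}` into intervals

A partition into consecutive intervals is a `Composition n`; two points lie in the same interval
when `c.index` takes the same value on them. -/

section Partition

variable {n : ℕ}

/-- The involution that reverses each interval of the partition. -/
def kappa (c : Composition n) : Equiv.Perm (Fin n) :=
  c.blocksFinEquiv.permCongr (Equiv.Perm.sigmaCongrRight fun _ => Fin.revPerm)

theorem index_monotone (c : Composition n) : Monotone c.index := by
  intro i j hij
  by_contra! h
  have h1 := c.lt_sizeUpTo_index_succ j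
  have h2 := c.sizeUpTo_index_le i
  have h3 : c.sizeUpTo (c.index j).succ ≤ c.sizeUpTo (c.index i) :=
    c.monotone_sizeUpTo (Nat.succ_le_of_lt h)
  have : (i : ℕ) ≤ j := hij
  omega

/-- `ε_i - ε_j` is zero, or a positive root, or a root of the Levi factor given by `c`. -/
def UpperPattern (c : Composition n) (i j : Fin n) : Prop := i ≤ j ∨ c.index i = c.index j

/-- `ε_i - ε_j` is zero, or a negative root, or a root of the Levi factor given by `c`. -/
def LowerPattern (c : Composition n) (i j : Fin n) : Prop := j ≤ i ∨ c.index i = c.index j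

theorem upperPattern_iff (c : Composition n) (i j : Fin n) :
    UpperPattern c i j ↔ c.index i ≤ c.index j := by
  constructor
  · rintro (h | h)
    · exact index_monotone c h
    · exact h.le
  · intro h
    by_cases hij : i ≤ j
    · exact Or.inl hij
    · exact Or.inr (le_antisymm h (index_monotone c (not_le.mp hij).le))

theorem lowerPattern_iff (c : Composition n) (i j : Fin n) :
    LowerPattern c i j ↔ c.index j ≤ c.index i := by
  rw [← upperPattern_iff, UpperPattern, LowerPattern, eq_comm]

end Partition

/-! ### Biparabolic subalgebras of `sl n` -/

section Subalgebra

variable (k : Type*) [Field k] {n : ℕ}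

/-- The trace zero matrices supported on a transitive relation. -/
def patternSubalgebra (r : Fin n → Fin n → Prop) (hr : ∀ i j l, r i j → r j l → r i l) :
    LieSubalgebra k (sl (Fin n) k) where
  carrier := {A | ∀ i j, ¬ r i j → A.val i j = 0}
  add_mem' {A B} hA hB i j hij := by
    change A.val i j + B.val i j = 0
    rw [hA i j hij, hB i j hij, add_zero]
  zero_mem' _ _ _ := rfl
  smul_mem' c A hA i j hij := by
    change c • A.val i j = 0
    rw [hA i j hij, smul_zero]
  lie_mem' {A B} hA hB i j hij := by
    have key : ∀ X Y : sl (Fin n) k, (∀ i j, ¬ r i j → X.val i j = 0) →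
        (∀ i j, ¬ r i j → Y.val i j = 0) → (X.val * Y.val) i j = 0 := by
      intro X Y hX hY
      rw [Matrix.mul_apply]
      refine Finset.sum_eq_zero fun l _ => ?_
      by_cases h1 : r i l
      · rw [hY l j fun h2 => hij (hr i l j h1 h2), mul_zero]
      · rw [hX i l h1, zero_mul]
    rw [sl_bracket, Matrix.sub_apply, key A B hA hB, key B A hB hA, sub_zero]

/-- The standard parabolic subalgebra that contains the upper triangular matrices and whose Levi
factor is given by `c`. -/
def parabolicUpper (c : Composition n) : LieSubalgebra k (sl (Fin n) k) :=
  patternSubalgebra k (UpperPattern c) fun i j l h1 h2 => by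
    rw [upperPattern_iff] at *; exact h1.trans h2

/-- The standard parabolic subalgebra that contains the lower triangular matrices and whose Levi
factor is given by `c`. -/
def parabolicLower (c : Composition n) : LieSubalgebra k (sl (Fin n) k) :=
  patternSubalgebra k (LowerPattern c) fun i j l h1 h2 => by
    rw [lowerPattern_iff] at *; exact h2.trans h1

end Subalgebra

/-- Above or below the horizontal line. -/
inductive Side
  | above
  | below

/-- A pair of interval partitions `J⁺` (`pos`) and `J⁻` (`neg`) such that every simple root
`α_i = ε_i - ε_{i+1}` belongs to `π⁺` or to `π⁻`, that is, any two neighbouring points share an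
interval of `J⁺` or of `J⁻`. -/
structure DoublePartition (n : ℕ) where
  pos : Composition n
  neg : Composition n
  cover : ∀ i j : Fin n, (j : ℕ) = i + 1 → pos.index i = pos.index j ∨ neg.index i = neg.index j

section Construction

variable {n : ℕ}

/-- `J⁺` is drawn above the line and `J⁻` below it. -/
def DoublePartition.part (D : DoublePartition n) : Side → Composition n
  | .above => D.pos
  | .below => D.neg

/-- The biparabolic subalgebra `𝔮` attached to the double partition: its positive roots are those
of `J⁻`, its negative roots are those of `J⁺`. -/
def biparabolic (k : Type*) [Field k] (D : DoublePartition n) : LieSubalgebra k (sl (Fin n) k) :=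
  parabolicLower k D.neg ⊓ parabolicUpper k D.pos

/-- The canonical truncation `𝔮_Λ` of the biparabolic subalgebra. -/
noncomputable abbrev truncatedBiparabolic (k : Type*) [Field k] (D : DoublePartition n) :
    LieIdeal k (biparabolic k D) :=
  canonicalTruncation k (biparabolic k D)

/-- The restriction map `𝔤* → 𝔮_Λ*`. -/
noncomputable def restrictForm (k : Type*) [Field k] (D : DoublePartition n)
    (y : Module.Dual k (sl (Fin n) k)) : Module.Dual k (truncatedBiparabolic k D) :=
  (y ∘ₗ (biparabolic k D).toSubmodule.subtype) ∘ₗ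
    (truncatedBiparabolic k D).toSubmodule.subtype

/-! ### Half-integer arcs and markings

The simple root `α_i` is the half-integer point between `i` and `i + 1`; it is named by `i`. -/

/-- The Dynkin diagram involution of the intervals of `c` interchanges `α_i` and `α_j`: the points
`i`, `j`, `j + 1` lie in one interval, and reversing that interval takes `i` to `j + 1`. -/
def DynkinSwap (c : Composition n) (i j : Fin n) : Prop :=
  c.index i = c.index j ∧ (kappa c i : ℕ) = j + 1

/-- A (non-fictitious) half-integer arc: it joins `α_left` and `α_right`, above or below the line,
and represents the root `α_left + ⋯ + α_right`. -/
structure HalfArc (D : DoublePartition n) where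
  side : Side
  left : Fin n
  right : Fin n
  le : left ≤ right
  swap : DynkinSwap (D.part side) left right

/-- An arc that joins a fixed point of the involution to itself. -/
def HalfArc.IsEnd {D : DoublePartition n} (a : HalfArc D) : Prop := a.left = a.right

/-- Two simple roots lie on the same half-integer meander. The fictitious arcs only join the two
loose ends of one chain of genuine arcs, or close one loose end on itself, so they do not change
this relation. -/
def SameMeander (D : DoublePartition n) : Fin n → Fin n → Prop :=
  Relation.EqvGen fun i j => ∃ s, DynkinSwap (D.part s) i j

/-- The marking rule: exactly one non-fictitious arc is marked on each half-integer meander, and if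
the meander is an edge, the marked arc is an end. A half-integer meander is an edge exactly when it
has a non-fictitious end: a chain of genuine arcs without fixed point is a cycle, or its two loose
ends are joined by fictitious arcs to a loop. -/
def IsMarking (D : DoublePartition n) (𝓜 : Set (HalfArc D)) : Prop :=
  ∀ i : Fin n, (i : ℕ) + 1 < n →
    ∃ a ∈ 𝓜, SameMeander D i a.left ∧
      (∀ b ∈ 𝓜, SameMeander D i b.left → b = a) ∧
      ((∃ b : HalfArc D, SameMeander D i b.left ∧ b.IsEnd) → a.IsEnd)

/-- The left end-points of the marked integer arcs on one side: a mark on the half-integer arc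
from `α_i` to `α_j`, `i ≤ j`, becomes a mark on the integer arc joining `i` and `j + 1`. -/
def markedPoints {D : DoublePartition n} (𝓜 : Set (HalfArc D)) (s : Side) : Set (Fin n) :=
  {i | ∃ a ∈ 𝓜, a.side = s ∧ a.left = i}

/-! ### Meanders, loops, edges -/

/-- A meander of two involutions is an orbit of the group that they generate. -/
def IsMeander (σ τ : Equiv.Perm (Fin n)) (O : Set (Fin n)) : Prop :=
  ∃ x, O = MulAction.orbit (Subgroup.closure {σ, τ}) x

/-- A meander is an edge if it is also an orbit of the product. -/
def IsEdge (σ τ : Equiv.Perm (Fin n)) (O : Set (Fin n)) : Prop :=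
  IsMeander σ τ O ∧ ∃ x, O = MulAction.orbit (Subgroup.zpowers (σ * τ)) x

/-- A meander that is not an edge is a loop. -/
def IsLoop (σ τ : Equiv.Perm (Fin n)) (O : Set (Fin n)) : Prop :=
  IsMeander σ τ O ∧ ¬ IsEdge σ τ O

/-! ### Modified involutions -/

/-- `[p, q]` is a connected component of the set `m` of marked points. -/
def IsMarkedRun (m : Set (Fin n)) (p q : Fin n) : Prop :=
  p ≤ q ∧ (∀ t, p ≤ t → t ≤ q → t ∈ m) ∧
    (∀ t : Fin n, (t : ℕ) + 1 = p → t ∉ m) ∧ (∀ t : Fin n, (t : ℕ) = q + 1 → t ∉ m)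

/-- The left half of the extended component of the run `[p, q]`: it is `[p, q + 1]`, or `[p, q]`
if `q` and `q + 1` are the two middle points of an interval of even cardinality. -/
def leftHalf (c : Composition n) (p q : Fin n) : Set (Fin n) :=
  {x | p ≤ x ∧ (x ≤ q ∨ ((x : ℕ) = q + 1 ∧ x ≠ kappa c q))}

/-- The right half of the extended component: the mirror image of the left half. -/
def rightHalf (c : Composition n) (p q : Fin n) : Set (Fin n) := kappa c '' leftHalf c p q

/-- The extended component of the run `[p, q]`. -/
def extendedComponent (c : Composition n) (p q : Fin n) : Set (Fin n) :=
  leftHalf c p q ∪ rightHalf c p q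

/-- The run `[p, q]` reaches the centre of its interval: there is at most one point strictly between
`q` and its mirror image. -/
def IsCentralRun (c : Composition n) (q : Fin n) : Prop := (kappa c q : ℕ) ≤ q + 2

/-- `σ` is obtained from the involution `kappa c` by replacing it, on each extended component of the
set `m` of marked points, by an anti-Toeplitz involution. -/
structure IsModifiedInvolution (c : Composition n) (m : Set (Fin n)) (σ : Equiv.Perm (Fin n)) :
    Prop where
  involutive : ∀ x, σ (σ x) = x
  unmarked : ∀ x, (∀ p q, IsMarkedRun m p q → x ∉ extendedComponent c p q) → σ x = kappa c x
  stable : ∀ p q, IsMarkedRun m p q → ∀ x ∈ extendedComponent c p q, σ x ∈ extendedComponent c p q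
  loop : ∀ p q, IsMarkedRun m p q → ¬ IsCentralRun c q →
    IsLoop (kappa c) σ (extendedComponent c p q)
  edge : ∀ p q, IsMarkedRun m p q → IsCentralRun c q →
    IsEdge (kappa c) σ (extendedComponent c p q)
  antidiagonal : ∀ p q, IsMarkedRun m p q → ∀ x ∈ extendedComponent c p q, σ x ≠ x →
    (x ∈ leftHalf c p q ∧ σ x ∈ rightHalf c p q) ∨ (x ∈ rightHalf c p q ∧ σ x ∈ leftHalf c p q)

/-- All the choices made in the construction: a marking and a pair of modified involutions
`σ⁺ = σ above`, `σ⁻ = σ below`. -/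
structure ModifiedPair (D : DoublePartition n) where
  marks : Set (HalfArc D)
  isMarking : IsMarking D marks
  σ : Side → Equiv.Perm (Fin n)
  isModified : ∀ s, IsModifiedInvolution (D.part s) (markedPoints marks s) (σ s)

/-- The root `ε_i - ε_j` of `sl n` is the pair `(i, j)`. -/
abbrev Root (n : ℕ) := {α : Fin n × Fin n // α.1 ≠ α.2}

/-- The set `S = S⁺ ∪ S⁻`: the positive roots given by the arcs of `σ⁺` and the negative roots given
by the arcs of `σ⁻`. -/
def ModifiedPair.roots {D : DoublePartition n} (P : ModifiedPair D) : Finset (Root n) :=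
  {α : Root n | (α.1.1 < α.1.2 ∧ P.σ .above α.1.1 = α.1.2) ∨
    (α.1.2 < α.1.1 ∧ P.σ .below α.1.1 = α.1.2)}

/-- The form `η = ∑_{α ∈ S} x_α` on `𝔮_Λ`, where `x_α` is the root vector `u α • E_{ij}` of weight
`α = ε_i - ε_j` and `𝔤` is identified with `𝔤*` through the Killing form. -/
noncomputable def ModifiedPair.eta {k : Type*} [Field k] {D : DoublePartition n}
    (P : ModifiedPair D) (u : Root n → kˣ) : Module.Dual k (truncatedBiparabolic k D) :=
  restrictForm k D (killingForm k (sl (Fin n) k)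
    (∑ α ∈ P.roots, single α.1.1 α.1.2 α.2 (u α : k)))

/-- The set `Ξ` of the adapted pairs `(h, η)` of `𝔮_Λ` given by the construction; `h` lies in the
Cartan subalgebra `𝔥_Λ` of diagonal matrices in `𝔮_Λ`. -/
def constructedAdaptedPairs (k : Type*) [Field k] (D : DoublePartition n) :
    Set (truncatedBiparabolic k D × Module.Dual k (truncatedBiparabolic k D)) :=
  {a | IsAdaptedPair k a.1 a.2 ∧ (a.1.val.val.val : Matrix (Fin n) (Fin n) k).IsDiag ∧
    ∃ (P : ModifiedPair D) (u : Root n → kˣ), a.2 = P.eta u}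

end Construction

end Biparabolic

/-! Read each root `ε_a - ε_b` of `S` as an arrow `a → b`. Adding to `∑ x_α` any matrix unit
orthogonal to the biparabolic subalgebra (position `DoublePartition.Off`) does not change the
restriction. So it suffices to order the points in such a way that all arrows go forward and any two
neighbours are joined by an arrow or are `Off` (`ModifiedPair.exists_order`). With matrix units
added at the neighbouring positions that carry no arrow, the element is strictly upper triangular in
this order with non-zero superdiagonal, that is, a single nilpotent Jordan block. Its commutant has
dimension `n`, the least possible for a matrix, which makes the form regular
(`isRegularForm_isNilpotentForm_killingForm`).

The order is governed by one integer function. Let `P`, `Q` be the sums of the end-points of the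
intervals of `x` above and below, so that the two reversals are `x ↦ P - x` and `x ↦ Q - x`, and put
`D = Q - P` (`IntervalPair.diff`). It is constant on cells, the classes of points sharing both
intervals. Points `u`, `v` of different cells with `D v ≤ D u` are `Off` in this order
(`off_of_diff_le`), so jumps should lower `D`. Arrows do the opposite: they stay in a cell, or lead
from `D ≤ 0` to `D ≥ 0` and raise `D` (`cell_or`). Hence a list can follow arrows up to a vertex
with `D ≥ 0`, jump down to an available vertex with `D < 0`, and start again. `IsArcSystem` collects
what this greedy procedure needs, and `IsArcSystem.exists_goodList` shows that it succeeds: if no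
extension is possible, some unused vertex with two predecessors can still be reached by listing the
paths to both predecessors and then the vertex itself.

That the arrows form an arc system comes from the marking. Where `σ` differs from the reversal `κ`
at `x`, every half-integer between `x` and `κ σ x` is marked, whereas a half-integer meander carries
one marked arc only, and that arc is an end if the meander has an end. A wrong sign of `D` would
produce two marked arcs on one meander, or a marked arc that is not an end on a meander with an end.
The main tool is `spiral`: the product of two overlapping reflections is a translation by some `δ`,
so `δ` consecutive marked half-integers are too many. On cells with `D = 0` this is not enough;
there the transitivity of the anti-Toeplitz involutions excludes cycles (`no_closed_of_diff_zero`)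
and second sources (`source_unique`). -/

namespace Biparabolic

/-! ### Regular nilpotent elements of `sl n` -/

section LinearAlgebra

open Polynomial Module in
/-- Every endomorphism commutes with a space of endomorphisms that is as large as the module. -/
theorem exists_injective_commute {k V : Type*} [Field k] [AddCommGroup V] [Module k V]
    [FiniteDimensional k V] (T : Module.End k V) :
    ∃ φ : V →ₗ[k] Module.End k V, Function.Injective φ ∧ ∀ v, φ v * T = T * φ v := by
  obtain ⟨ι, _, p, -, e, ⟨E⟩⟩ :=
    Module.equiv_directSum_of_isTorsion (R := k[X]) (M := AEval' T)
      (AEval.isTorsion_of_finiteDimensional k V T)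
  classical
  let A := (i : ι) → k[X] ⧸ Ideal.span {p i ^ e i}
  let E' : AEval' T ≃ₗ[k[X]] A := E.trans (DirectSum.linearEquivFunOnFintype k[X] ι _)
  let o := AEval'.of T
  have hC : ∀ (c : k) (v : V), E' (o (c • v)) = (C c : k[X]) • E' (o v) := by
    intro c v
    rw [← map_smul]; congr 1
    simp [o]
  have hX : ∀ v : V, E' (o (T v)) = (X : k[X]) • E' (o v) := by
    intro v
    rw [← map_smul]; congr 1
    simp [o, AEval'.X_smul_of]
  have hC' : ∀ (c : k) (a : A), o.symm (E'.symm ((C c : k[X]) • a)) = c • o.symm (E'.symm a) := by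
    intro c a
    apply o.injective; apply E'.injective
    rw [hC]; simp only [LinearEquiv.apply_symm_apply]
  have hX' : ∀ (a : A), o.symm (E'.symm ((X : k[X]) • a)) = T (o.symm (E'.symm a)) := by
    intro a
    apply o.injective; apply E'.injective
    rw [hX]; simp only [LinearEquiv.apply_symm_apply]
  -- Transport the multiplication of the commutative ring `A`, a product of quotients of `k[X]`.
  -- Multiplying by a fixed element is `k[X]`-linear, hence commutes with `T`, and evaluation at 1
  -- recovers the element.
  refine ⟨LinearMap.mk₂ k (fun v w => o.symm (E'.symm (E' (o v) * E' (o w)))) ?_ ?_ ?_ ?_, ?_, ?_⟩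
  · intro v v' w; simp [add_mul]
  · intro c v w; rw [hC, smul_mul_assoc, hC']
  · intro v w w'; simp [mul_add]
  · intro c v w; rw [hC, mul_smul_comm, hC']
  · intro v v' h
    have := LinearMap.congr_fun h (o.symm (E'.symm 1))
    simpa using this
  · intro v
    ext w
    simp only [Module.End.mul_apply, LinearMap.mk₂_apply]
    rw [hX, mul_smul_comm, hX']

variable {k : Type*} [Field k] {n : ℕ}

/-- The matrices that commute with a given matrix. -/
def commutant (X : Matrix (Fin n) (Fin n) k) : Submodule k (Matrix (Fin n) (Fin n) k) :=
  LinearMap.ker (LinearMap.mulRight k X - LinearMap.mulLeft k X)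

theorem mem_commutant {X Z : Matrix (Fin n) (Fin n) k} : Z ∈ commutant X ↔ Z * X = X * Z := by
  simp [commutant, sub_eq_zero]

theorem le_finrank_commutant (X : Matrix (Fin n) (Fin n) k) :
    n ≤ Module.finrank k (commutant X) := by
  obtain ⟨φ, hφ, hc⟩ := exists_injective_commute (Matrix.toLin' X)
  have hmem : ∀ v, LinearMap.toMatrix' (φ v) ∈ commutant X := by
    intro v
    rw [mem_commutant]
    have := congrArg LinearMap.toMatrix' (hc v)
    rwa [LinearMap.toMatrix'_mul, LinearMap.toMatrix'_mul, LinearMap.toMatrix'_toLin'] at this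
  let ψ : (Fin n → k) →ₗ[k] commutant X :=
    ((LinearMap.toMatrix' (R := k) (m := Fin n) (n := Fin n)).toLinearMap ∘ₗ φ).codRestrict _ hmem
  have hψ : Function.Injective ψ := by
    intro v w h
    exact hφ (LinearMap.toMatrix'.injective (congrArg Subtype.val h))
  simpa using LinearMap.finrank_le_finrank_of_injective hψ

section Triangular

variable {N : Matrix (Fin n) (Fin n) k} (hN : ∀ i j, j ≤ i → N i j = 0)
include hN

theorem isNilpotent_of_strictly_upper : IsNilpotent N := by
  have key : ∀ m : ℕ, ∀ i j : Fin n, (j : ℕ) < i + m → (N ^ m) i j = 0 := by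
    intro m
    induction m with
    | zero =>
      intro i j h
      rw [pow_zero, Matrix.one_apply_ne]
      rintro rfl
      omega
    | succ m ih =>
      intro i j h
      rw [pow_succ, Matrix.mul_apply]
      refine Finset.sum_eq_zero fun l _ => ?_
      by_cases hl : (l : ℕ) < i + m
      · rw [ih i l hl, zero_mul]
      · rw [hN l j (by rw [Fin.le_def]; omega), mul_zero]
  refine ⟨n, ?_⟩
  ext i j
  exact key n i j (by omega)

/-- A commuting matrix is determined by its first row: the first rows of the powers of `N` form a
triangular invertible matrix `K`, and a commuting `Z` with zero first row satisfies `K * Z = 0`. -/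
theorem finrank_commutant_le_of_superdiagonal (hn : 0 < n)
    (hs : ∀ i j : Fin n, (j : ℕ) = i + 1 → N i j ≠ 0) :
    Module.finrank k (commutant N) ≤ n := by
  let o : Fin n := ⟨0, hn⟩
  let K : Matrix (Fin n) (Fin n) k := fun i j => (N ^ (i : ℕ)) o j
  have hpow : ∀ m : ℕ, ∀ j : Fin n, ((j : ℕ) < m → (N ^ m) o j = 0) ∧
      ((j : ℕ) = m → (N ^ m) o j ≠ 0) := by
    intro m
    induction m with
    | zero =>
      intro j
      refine ⟨fun h => by omega, fun h => ?_⟩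
      have : j = o := Fin.ext h
      simp [this]
    | succ m ih =>
      intro j
      constructor
      · intro h
        rw [pow_succ, Matrix.mul_apply]
        refine Finset.sum_eq_zero fun l _ => ?_
        by_cases hl : (l : ℕ) < m
        · rw [(ih l).1 hl, zero_mul]
        · rw [hN l j (by rw [Fin.le_def]; omega), mul_zero]
      · intro h
        have hm : m < n := by omega
        rw [pow_succ, Matrix.mul_apply, Finset.sum_eq_single (⟨m, hm⟩ : Fin n)]
        · exact mul_ne_zero ((ih _).2 rfl) (hs _ _ h)
        · intro l _ hl
          by_cases hl' : (l : ℕ) < m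
          · rw [(ih l).1 hl', zero_mul]
          · have : (l : ℕ) ≠ m := fun h => hl (Fin.ext h)
            rw [hN l j (by rw [Fin.le_def]; omega), mul_zero]
        · simp
  have hdet : K.det ≠ 0 := by
    rw [Matrix.det_of_isUpperTriangular]
    · exact Finset.prod_ne_zero_iff.2 fun i _ => (hpow i i).2 rfl
    · intro i j h
      exact (hpow i j).1 h
  let ρ : commutant N →ₗ[k] (Fin n → k) :=
    { toFun := fun Z => Z.1 o
      map_add' := fun _ _ => rfl
      map_smul' := fun _ _ => rfl }
  have hρ : Function.Injective ρ := by
    rw [← LinearMap.ker_eq_bot, LinearMap.ker_eq_bot']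
    rintro ⟨Z, hZ⟩ h0
    have hcomm : Commute Z N := mem_commutant.1 hZ
    have hKZ : K * Z = 0 := by
      ext i j
      have h1 : (K * Z) i j = (N ^ (i : ℕ) * Z) o j := rfl
      rw [h1, ← (hcomm.pow_right i).eq, Matrix.mul_apply]
      refine Finset.sum_eq_zero fun l _ => ?_
      rw [show Z o l = 0 from congrFun h0 l, zero_mul]
    have hu : IsUnit K.det := isUnit_iff_ne_zero.2 hdet
    have : Z = 0 := by
      rw [← Matrix.nonsing_inv_mul_cancel_left K Z hu, hKZ, Matrix.mul_zero]
    exact Subtype.ext this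
  simpa using LinearMap.finrank_le_finrank_of_injective hρ

end Triangular

theorem finrank_commutant_reindex (e : Fin n ≃ Fin n) (Y : Matrix (Fin n) (Fin n) k) :
    Module.finrank k (commutant Y) = Module.finrank k (commutant (Matrix.reindexAlgEquiv k k e Y)) := by
  refine LinearEquiv.finrank_eq
    ((Matrix.reindexAlgEquiv k k e).toLinearEquiv.submoduleMap (commutant Y) |>.trans
      (LinearEquiv.ofEq _ _ ?_))
  ext Z
  constructor
  · rintro ⟨W, hW, rfl⟩
    have hW' := mem_commutant.1 hW
    rw [mem_commutant]
    have := congrArg (Matrix.reindexAlgEquiv k k e) hW'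
    rw [map_mul, map_mul] at this
    exact this
  · intro hZ
    refine ⟨(Matrix.reindexAlgEquiv k k e).symm Z, ?_, (Matrix.reindexAlgEquiv k k e).apply_symm_apply Z⟩
    have hZ' := mem_commutant.1 hZ
    refine mem_commutant.2 ((Matrix.reindexAlgEquiv k k e).injective ?_)
    rw [map_mul, map_mul, AlgEquiv.apply_symm_apply]
    exact hZ'

end LinearAlgebra

/-! ### Coadjoint stabilizers in `sl n` and commutants of matrices -/

section Killing

attribute [local instance 100] LieRing.ofAssociativeRing

variable {k : Type*} [Field k] {n : ℕ}

theorem trace_mulLeft_mulRight (A B : Matrix (Fin n) (Fin n) k) :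
    LinearMap.trace k _ (LinearMap.mulLeft k A ∘ₗ LinearMap.mulRight k B) =
      A.trace * B.trace := by
  rw [LinearMap.trace_eq_matrix_trace k (Matrix.stdBasis k (Fin n) (Fin n)), Matrix.trace,
    Fintype.sum_prod_type, Matrix.trace, Matrix.trace, Finset.sum_mul_sum]
  refine Finset.sum_congr rfl fun i _ => Finset.sum_congr rfl fun j _ => ?_
  rw [Matrix.diag_apply, LinearMap.toMatrix_apply, Matrix.stdBasis_eq_single]
  change (A * ((Matrix.single i j 1 : Matrix (Fin n) (Fin n) k) * B)) i j = _
  simp [Matrix.mul_apply, Matrix.single_apply, ite_and]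

/-- The operator `ad A ∘ ad B` on all matrices takes values in `sl n`, so its trace can be computed
on the full matrix space, where it expands into left and right multiplications. The mixed terms
contribute `tr A * tr B = 0`. -/
theorem killingForm_sl (A B : sl (Fin n) k) :
    killingForm k (sl (Fin n) k) A B = 2 * n * (A.val * B.val).trace := by
  have hA : A.val.trace = 0 := A.2
  have hB : B.val.trace = 0 := B.2
  let f : Matrix (Fin n) (Fin n) k →ₗ[k] Matrix (Fin n) (Fin n) k :=
    LieAlgebra.ad k _ A.val ∘ₗ LieAlgebra.ad k _ B.val
  have hf : ∀ X, f X ∈ (sl (Fin n) k).toSubmodule := fun X =>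
    LinearMap.mem_ker.2 (LieAlgebra.matrix_trace_commutator_zero _ _ A.val ⁅B.val, X⁆)
  have h1 : killingForm k (sl (Fin n) k) A B = LinearMap.trace k _ f := by
    rw [killingForm_apply_apply, ← LinearMap.trace_restrict_eq_of_forall_mem _ f hf]
    rfl
  have h2 : f = LinearMap.mulLeft k (A.val * B.val) ∘ₗ LinearMap.mulRight k 1
      - LinearMap.mulLeft k A.val ∘ₗ LinearMap.mulRight k B.val
      - LinearMap.mulLeft k B.val ∘ₗ LinearMap.mulRight k A.val
      + LinearMap.mulLeft k 1 ∘ₗ LinearMap.mulRight k (B.val * A.val) := by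
    ext1 X
    simp only [f, LinearMap.comp_apply, LieAlgebra.ad_apply, LieRing.of_associative_ring_bracket,
      LinearMap.add_apply, LinearMap.sub_apply, LinearMap.mulLeft_apply, LinearMap.mulRight_apply]
    noncomm_ring
  rw [h1, h2, map_add, map_sub, map_sub, trace_mulLeft_mulRight, trace_mulLeft_mulRight,
    trace_mulLeft_mulRight, trace_mulLeft_mulRight, hA, hB, Matrix.trace_one,
    Matrix.trace_mul_comm B.val A.val, Fintype.card_fin]
  ring

theorem exists_trace_form (g : Module.Dual k (sl (Fin n) k)) :
    ∃ X : Matrix (Fin n) (Fin n) k, ∀ b : sl (Fin n) k, g b = (X * b.val).trace := by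
  obtain ⟨G, hG⟩ := LinearMap.exists_extend (p := (sl (Fin n) k).toSubmodule) g
  refine ⟨Matrix.of fun i j => G (Matrix.single j i 1), fun b => ?_⟩
  have h1 : g b = G b.val := by rw [← hG]; rfl
  have h2 : G b.val = ∑ i, ∑ j, b.val i j * G (Matrix.single i j 1) := by
    conv_lhs => rw [Matrix.matrix_eq_sum_single b.val]
    simp only [map_sum]
    refine Finset.sum_congr rfl fun i _ => Finset.sum_congr rfl fun j _ => ?_
    rw [← smul_eq_mul, ← map_smul, Matrix.smul_single, smul_eq_mul, mul_one]
  rw [h1, h2, Matrix.trace, Finset.sum_comm]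
  refine Finset.sum_congr rfl fun i _ => ?_
  rw [Matrix.diag_apply, Matrix.mul_apply]
  exact Finset.sum_congr rfl fun j _ => mul_comm _ _

theorem mem_coadjointStabilizer_of_commute {g : Module.Dual k (sl (Fin n) k)}
    {X : Matrix (Fin n) (Fin n) k} (hX : ∀ b : sl (Fin n) k, g b = (X * b.val).trace)
    {a : sl (Fin n) k} (ha : a.val * X = X * a.val) : a ∈ coadjointStabilizer k g := by
  change ⁅a, g⁆ = 0
  ext b
  rw [Module.Dual.lie_apply, hX, sl_bracket, mul_sub, Matrix.trace_sub, ← mul_assoc, ← ha,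
    ← mul_assoc, Matrix.trace_mul_comm (X * b.val), ← mul_assoc]
  simp

variable [CharZero k]

/-- Off-diagonal matrix units and differences of diagonal ones force `W` to be scalar; trace zero
and characteristic zero do the rest. -/
theorem eq_zero_of_trace_mul (hn : 0 < n) {W : Matrix (Fin n) (Fin n) k} (hW : W.trace = 0)
    (h : ∀ b : sl (Fin n) k, (W * b.val).trace = 0) : W = 0 := by
  have hd : ∀ i j, W i i = W j j := by
    intro i j
    have := h (singleSubSingle i j 1)
    rw [val_singleSubSingle, mul_sub, Matrix.trace_sub, Matrix.trace_mul_single,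
      Matrix.trace_mul_single, sub_eq_zero] at this
    simpa using this
  ext i j
  by_cases hij : i = j
  · subst hij
    have h1 : W.trace = n * W i i := by
      have h2 : ∀ j ∈ Finset.univ, W.diag j = W i i := fun j _ => hd j i
      rw [Matrix.trace, Finset.sum_congr rfl h2]
      simp
    rw [hW] at h1
    have hn' : (n : k) ≠ 0 := by exact_mod_cast hn.ne'
    simpa [hn'] using h1.symm
  · have := h (single j i (Ne.symm hij) 1)
    rw [val_single, Matrix.trace_mul_single] at this
    simpa using this

theorem commute_of_mem_coadjointStabilizer (hn : 0 < n) {Y a : sl (Fin n) k}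
    (ha : a ∈ coadjointStabilizer k (killingForm k (sl (Fin n) k) Y)) :
    a.val * Y.val = Y.val * a.val := by
  have ha' : ⁅a, killingForm k (sl (Fin n) k) Y⁆ = 0 := ha
  have hn' : (2 * n : k) ≠ 0 := mul_ne_zero two_ne_zero (by exact_mod_cast hn.ne')
  have h0 : Y.val * a.val - a.val * Y.val = 0 := by
    refine eq_zero_of_trace_mul hn (LieAlgebra.matrix_trace_commutator_zero _ _ _ _) fun b => ?_
    have h1 := LinearMap.congr_fun ha' b
    rw [Module.Dual.lie_apply, killingForm_sl, sl_bracket] at h1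
    have h2 : (Y.val * (a.val * b.val - b.val * a.val)).trace = 0 := by simpa [hn'] using h1
    rw [mul_sub, Matrix.trace_sub, ← mul_assoc, ← mul_assoc, Matrix.trace_mul_comm (Y.val * b.val),
      ← mul_assoc] at h2
    rw [sub_mul, Matrix.trace_sub, h2]
  exact (sub_eq_zero.1 h0).symm

/-- A matrix commuting with `X` splits into its traceless part, which stabilizes the form, and its
trace. This turns the bound `n` for commutants into the bound `n - 1` for stabilizers. -/
theorem le_finrank_coadjointStabilizer (hn : 0 < n) (g : Module.Dual k (sl (Fin n) k)) :
    n ≤ Module.finrank k (coadjointStabilizer k g) + 1 := by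
  obtain ⟨X, hX⟩ := exists_trace_form g
  have hn' : (n : k) ≠ 0 := by exact_mod_cast hn.ne'
  let p : Matrix (Fin n) (Fin n) k →ₗ[k] Matrix (Fin n) (Fin n) k :=
    LinearMap.id - (Matrix.traceLinearMap (Fin n) k k).smulRight ((n : k)⁻¹ • 1)
  have hp : ∀ Z, p Z = Z - Z.trace • ((n : k)⁻¹ • 1) := fun Z => rfl
  have hps : ∀ Z, p Z ∈ (sl (Fin n) k).toSubmodule := by
    intro Z
    refine LinearMap.mem_ker.2 ?_
    rw [hp, Matrix.traceLinearMap_apply, Matrix.trace_sub, Matrix.trace_smul, Matrix.trace_smul,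
      Matrix.trace_one]
    simp [hn']
  let q : Matrix (Fin n) (Fin n) k →ₗ[k] sl (Fin n) k := p.codRestrict _ hps
  have hq : ∀ Z : commutant X, q Z.1 ∈ coadjointStabilizer k g := by
    rintro ⟨Z, hZ⟩
    refine mem_coadjointStabilizer_of_commute hX ?_
    change p Z * X = X * p Z
    rw [hp, sub_mul, mul_sub, mem_commutant.1 hZ]
    simp
  let ψ : commutant X →ₗ[k] coadjointStabilizer k g × k :=
    ((q ∘ₗ (commutant X).subtype).codRestrict _ hq).prod
      (Matrix.traceLinearMap (Fin n) k k ∘ₗ (commutant X).subtype)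
  have hψ : Function.Injective ψ := by
    rw [← LinearMap.ker_eq_bot, LinearMap.ker_eq_bot']
    rintro ⟨Z, hZ⟩ h0
    have h1 : p Z = 0 := congrArg (fun w => w.1.1.1) h0
    have h2 : Z.trace = 0 := congrArg (fun w => w.2) h0
    rw [hp, h2, zero_smul, sub_zero] at h1
    exact Subtype.ext h1
  have := LinearMap.finrank_le_finrank_of_injective hψ
  rw [Module.finrank_prod, Module.finrank_self] at this
  exact (le_finrank_commutant X).trans this

/-- Stabilizing elements commute with `Y`, and so do the scalar matrices, which meet trace zero only
in 0. -/
theorem finrank_coadjointStabilizer_killingForm_le (hn : 0 < n) (Y : sl (Fin n) k) :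
    Module.finrank k (coadjointStabilizer k (killingForm k (sl (Fin n) k) Y)) + 1 ≤
      Module.finrank k (commutant Y.val) := by
  have hn' : (n : k) ≠ 0 := by exact_mod_cast hn.ne'
  set T := coadjointStabilizer k (killingForm k (sl (Fin n) k) Y)
  let f : T × k →ₗ[k] Matrix (Fin n) (Fin n) k :=
    ((sl (Fin n) k).toSubmodule.subtype ∘ₗ T.subtype).coprod
      ((LinearMap.id : k →ₗ[k] k).smulRight (1 : Matrix (Fin n) (Fin n) k))
  have hf : ∀ w : T × k, f w = w.1.1.1 + w.2 • 1 := fun w => rfl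
  have hfm : ∀ w, f w ∈ commutant Y.val := by
    intro w
    rw [mem_commutant, hf, add_mul, mul_add, commute_of_mem_coadjointStabilizer hn w.1.2]
    simp
  have hinj : Function.Injective (f.codRestrict _ hfm) := by
    rw [← LinearMap.ker_eq_bot, LinearMap.ker_eq_bot']
    intro w h0
    have h1 : w.1.1.1 + w.2 • (1 : Matrix (Fin n) (Fin n) k) = 0 := congrArg Subtype.val h0
    have h2 : w.1.1.1.trace = 0 := w.1.1.2
    have h3 := congrArg Matrix.trace h1
    rw [Matrix.trace_add, h2, Matrix.trace_smul, Matrix.trace_one] at h3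
    have h4 : w.2 = 0 := by simpa [hn'] using h3
    rw [h4, zero_smul, add_zero] at h1
    exact Prod.ext (Subtype.ext (Subtype.ext h1)) h4
  have := LinearMap.finrank_le_finrank_of_injective hinj
  rwa [Module.finrank_prod, Module.finrank_self] at this

/-- An element of `sl n` that becomes strictly upper triangular with non-zero superdiagonal after a
permutation of the basis is regular nilpotent. -/
theorem isRegularForm_isNilpotentForm_killingForm (hn : 0 < n) (Y : sl (Fin n) k)
    (e : Fin n ≃ Fin n) (hY : ∀ i j, j ≤ i → Y.val (e i) (e j) = 0)
    (hs : ∀ i j : Fin n, (j : ℕ) = i + 1 → Y.val (e i) (e j) ≠ 0) :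
    IsRegularForm k (killingForm k (sl (Fin n) k) Y) ∧
      IsNilpotentForm k (killingForm k (sl (Fin n) k) Y) := by
  constructor
  · intro g
    have h1 := finrank_coadjointStabilizer_killingForm_le hn Y
    have h2 := le_finrank_coadjointStabilizer hn g
    have h3 : Module.finrank k (commutant Y.val) ≤ n := by
      rw [finrank_commutant_reindex e.symm]
      exact finrank_commutant_le_of_superdiagonal hY hn hs
    omega
  · refine ⟨Y, rfl, LieSubalgebra.isNilpotent_ad_of_isNilpotent_ad _ ?_⟩
    refine LieAlgebra.ad_nilpotent_of_nilpotent ?_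
    have h1 : IsNilpotent (Matrix.reindexAlgEquiv k k e.symm Y.val) :=
      isNilpotent_of_strictly_upper hY
    exact (IsNilpotent.map_iff (Matrix.reindexAlgEquiv k k e.symm).injective).1 h1

end Killing

/-! ### Hamiltonian linear extensions of an acyclic digraph -/

section GoodList

open Relation

variable {V γ : Type*}

/-- A list without repetitions in which every vertex comes after its predecessors for `S`, and in
which consecutive vertices are related by `S` or by `Ok`. -/
inductive GoodList (S Ok : V → V → Prop) : List V → Prop
  | nil : GoodList S Ok []
  | snoc {l : List V} {v : V} : GoodList S Ok l → v ∉ l → (∀ u, S u v → u ∈ l) →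
      (∀ e ∈ l.getLast?, S e v ∨ Ok e v) → GoodList S Ok (l ++ [v])

variable {S Ok : V → V → Prop}

theorem getLast?_append_snoc (l r : List V) (e : V) : (l ++ (r ++ [e])).getLast? = some e := by
  rw [← List.append_assoc, List.getLast?_concat]

theorem GoodList.snoc_inv {l : List V} {v : V} (h : GoodList S Ok (l ++ [v])) :
    GoodList S Ok l ∧ v ∉ l ∧ (∀ u, S u v → u ∈ l) ∧ (∀ e ∈ l.getLast?, S e v ∨ Ok e v) := by
  generalize hm : l ++ [v] = m at h
  cases h with
  | nil => simp at hm
  | snoc h1 h2 h3 h4 =>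
    obtain ⟨rfl, h⟩ := List.append_inj' hm rfl
    obtain rfl : v = _ := by simpa using h
    exact ⟨h1, h2, h3, h4⟩

theorem GoodList.nodup {l : List V} (h : GoodList S Ok l) : l.Nodup := by
  induction h with
  | nil => simp
  | snoc _ h2 _ _ ih =>
    refine List.nodup_append.2 ⟨ih, by simp, fun a ha b hb hab => h2 ?_⟩
    obtain rfl : b = _ := by simpa using hb
    exact hab ▸ ha

theorem GoodList.mem_of_pred {l : List V} (h : GoodList S Ok l) {u v : V} (hv : v ∈ l)
    (huv : S u v) : u ∈ l := by
  induction h with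
  | nil => simp at hv
  | snoc _ _ h3 _ ih =>
    rcases List.mem_append.1 hv with hv | hv
    · exact List.mem_append_left _ (ih hv)
    · obtain rfl : v = _ := by simpa using hv
      exact List.mem_append_left _ (h3 u huv)

/-- Inserting `m` only adds vertices before `r`, so no predecessor condition is lost, and the only
new junction to inspect is the one after `m`. This lets two paths built separately from `l` be put
one behind the other. -/
theorem GoodList.insert_middle {l m r : List V} (hr : GoodList S Ok (l ++ r))
    (hm : GoodList S Ok (l ++ m)) (hne : m ≠ []) (hdis : ∀ v ∈ r, v ∉ m)
    (hok : ∀ e ∈ m.getLast?, ∀ s ∈ r, Ok e s) : GoodList S Ok (l ++ m ++ r) := by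
  induction r using List.reverseRecOn with
  | nil => simpa using hm
  | append_singleton r v ih =>
    rw [← List.append_assoc] at hr ⊢
    obtain ⟨h1, h2, h3, h4⟩ := hr.snoc_inv
    refine (ih h1 (fun w hw => hdis w (by simp [hw])) (fun e he s hs => hok e he s (by simp [hs]))).snoc
      ?_ ?_ ?_
    · have := hdis v (by simp)
      simp only [List.mem_append] at h2 ⊢
      tauto
    · intro u hu
      have := h3 u hu
      simp only [List.mem_append] at this ⊢
      tauto
    · intro e he
      by_cases hr0 : r = []
      · subst hr0
        rw [List.append_nil, List.getLast?_append_of_ne_nil _ hne] at he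
        exact Or.inr (hok e he v (by simp))
      · rw [List.getLast?_append_of_ne_nil _ hr0] at he
        exact h4 e (by rwa [List.getLast?_append_of_ne_nil _ hr0])

theorem GoodList.append_isolated {l m : List V} (hl : GoodList S Ok l) (hm : m.Pairwise Ok)
    (hnd : m.Nodup) (hdis : ∀ v ∈ m, v ∉ l) (hiso : ∀ v ∈ m, ∀ u, ¬ S u v)
    (hok : ∀ e ∈ l.getLast?, ∀ s ∈ m, Ok e s) : GoodList S Ok (l ++ m) := by
  induction m generalizing l with
  | nil => simpa using hl
  | cons a m ih =>
    rw [List.append_cons]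
    rw [List.pairwise_cons] at hm
    rw [List.nodup_cons] at hnd
    refine ih (hl.snoc (hdis a (by simp)) (fun u hu => absurd hu (hiso a (by simp) u))
      fun e he => Or.inr (hok e he a (by simp))) hm.2 hnd.2 ?_ (fun v hv => hiso v (by simp [hv])) ?_
    · intro v hv hv'
      rcases List.mem_append.1 hv' with h | h
      · exact hdis v (by simp [hv]) h
      · obtain rfl : v = a := by simpa using h
        exact hnd.1 hv
    · intro e he s hs
      obtain rfl : a = e := by simpa using he
      exact hm.1 s hs

variable (S Ok) in
/-- The combinatorial properties of the arcs of a pair of modified involutions from which a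
Hamiltonian linear extension can be built. The vertices are sorted into cells; `D` is constant on
cells and grows along the arcs. -/
structure IsArcSystem (D : V → ℤ) (cell : V → γ) : Prop where
  acyclic : ∀ v, ¬ TransGen S v v
  cell_or : ∀ u v, S u v → cell u = cell v ∨ (D u ≤ 0 ∧ 0 ≤ D v ∧ D u < D v)
  D_cell : ∀ u v, cell u = cell v → D u = D v
  succ_two : ∀ u v w, S u v → S u w → v ≠ w → (∀ x, ¬ S x u) ∧ D u < 0
  succ_le : ∀ u v w x, S u v → S u w → v ≠ w → S u x → x = v ∨ x = w
  pred_two : ∀ u v w, S u w → S v w → u ≠ v → (∀ x, ¬ S w x) ∧ 0 < D w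
  pred_le : ∀ u v w x, S u w → S v w → u ≠ v → S x w → x = u ∨ x = v
  source_D : ∀ u v, S u v → (∀ x, ¬ S x u) → D u ≤ 0
  sink_D : ∀ u v, S u v → (∀ x, ¬ S v x) → 0 ≤ D v
  ok_D : ∀ u v, D v ≤ D u → cell u ≠ cell v → Ok u v
  ok_succ : ∀ x s t u v, S x s → S x t → s ≠ t → cell s ≠ cell x → cell t ≠ cell x →
    cell u = cell s → cell v = cell t → Ok u v
  ok_pred : ∀ z s t u v, S s z → S t z → s ≠ t → cell s ≠ cell z → cell t ≠ cell z →
    cell u = cell s → cell v = cell t → Ok u v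
  cell_pred : ∀ z s t, S s z → S t z → s ≠ t → cell s ≠ cell z → cell t ≠ cell z →
    cell s ≠ cell t
  no_square : ∀ u v w x, S u w → S v w → S u x → S v x → u ≠ v → w = x
  zero_unique : ∀ u v, D u = 0 → cell u = cell v → (∀ x, ¬ S x u) → (∀ x, ¬ S x v) → u = v
  isolated_unique : ∀ u v, cell u = cell v → (∀ x, ¬ S x u) → (∀ x, ¬ S u x) → (∀ x, ¬ S x v) →
    (∀ x, ¬ S v x) → u = v

variable {D : V → ℤ} {cell : V → γ}

namespace IsArcSystem

variable (H : IsArcSystem S Ok D cell)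
include H

theorem cell_or_of_reflTransGen {u v : V} (h : ReflTransGen S u v) :
    cell u = cell v ∨ (D u ≤ 0 ∧ 0 ≤ D v ∧ D u < D v) := by
  induction h with
  | refl => exact Or.inl rfl
  | tail _ h2 ih =>
    rcases ih with ih | ih <;> rcases H.cell_or _ _ h2 with h | h
    · exact Or.inl (ih.trans h)
    · rw [H.D_cell _ _ ih]; exact Or.inr h
    · rw [← H.D_cell _ _ h]; exact Or.inr ih
    · exact Or.inr ⟨ih.1, h.2.1, ih.2.2.trans h.2.2⟩

theorem D_le_of_reflTransGen {u v : V} (h : ReflTransGen S u v) : D u ≤ D v := by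
  rcases H.cell_or_of_reflTransGen h with h | h
  · exact (H.D_cell _ _ h).le
  · exact h.2.2.le

theorem cell_eq_of_reflTransGen {u v : V} (h : ReflTransGen S u v) (hv : D v < 0) :
    cell u = cell v := by
  rcases H.cell_or_of_reflTransGen h with h | h
  · exact h
  · omega

theorem succ_unique_of_pred {p u v w : V} (hp : S p u) (hv : S u v) (hw : S u w) : v = w := by
  by_contra hne
  exact (H.succ_two u v w hv hw hne).1 p hp

theorem pred_unique_of_succ {u v w x : V} (hu : S u w) (hv : S v w) (hx : S w x) : u = v := by
  by_contra hne
  exact (H.pred_two u v w hu hv hne).1 x hx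

/-- Starting from an available vertex, follow the arcs as long as the next vertex is available. -/
theorem exists_run [Fintype V] {l : List V} (hl : GoodList S Ok l) {s : V} (hs : s ∉ l)
    (hp : ∀ u, S u s → u ∈ l) (hu : ∀ t t', S s t → S s t' → t = t')
    (hok : ∀ e ∈ l.getLast?, S e s ∨ Ok e s) :
    ∃ r e, GoodList S Ok (l ++ (r ++ [e])) ∧ s ∈ r ++ [e] ∧
      (∀ u ∈ r ++ [e], ReflTransGen S s u ∧ ReflTransGen S u e) ∧
      (∀ u ∈ r ++ [e], ∀ t, S u t → t ∈ l ++ (r ++ [e]) ∨ ∃ v, v ∉ l ++ (r ++ [e]) ∧ S v t) ∧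
      (∀ t, S e t → ∃ v, v ∉ l ++ (r ++ [e]) ∧ S v t) := by
  classical
  induction hk : Fintype.card V - l.length using Nat.strong_induction_on generalizing l s with
  | _ k ih =>
  subst hk
  have hl1 : GoodList S Ok (l ++ [s]) := hl.snoc hs hp hok
  by_cases hav : ∃ t, S s t ∧ ∀ u, S u t → u ∈ l ++ [s]
  · obtain ⟨t, hst, htp⟩ := hav
    have ht : t ∉ l ++ [s] := by
      intro h
      rcases List.mem_append.1 h with h | h
      · exact hs (hl.mem_of_pred h hst)
      · obtain rfl : t = s := by simpa using h
        exact H.acyclic t (.single hst)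
    have hcard : (l ++ [s]).length ≤ Fintype.card V := hl1.nodup.length_le_card
    have hlt : Fintype.card V - (l ++ [s]).length < Fintype.card V - l.length := by
      simp only [List.length_append, List.length_singleton] at hcard ⊢
      omega
    -- From here on the successor is unique: `t` has a predecessor, and a vertex with a predecessor
    -- never has two successors.
    obtain ⟨r, e, h1, h2, h3, h4, h5⟩ := ih _ hlt hl1 ht htp
      (fun a b ha hb => H.succ_unique_of_pred hst ha hb)
      (fun e he => by
        obtain rfl : s = e := by simpa using he
        exact Or.inl hst) rfl
    have hass : l ++ [s] ++ (r ++ [e]) = l ++ (s :: r ++ [e]) := by simp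
    rw [hass] at h1 h4 h5
    refine ⟨s :: r, e, h1, by simp, ?_, ?_, h5⟩
    · intro u hu
      rcases List.mem_cons.1 hu with rfl | hu
      · exact ⟨.refl, (ReflTransGen.single hst).trans (h3 t h2).2⟩
      · exact ⟨(ReflTransGen.single hst).trans (h3 u hu).1, (h3 u hu).2⟩
    · intro u hu' a ha
      rcases List.mem_cons.1 hu' with rfl | hu'
      · rw [hu a t ha hst]
        exact Or.inl (List.mem_append_right _ (List.mem_cons_of_mem _ h2))
      · exact h4 u hu' a ha
  · push Not at hav
    refine ⟨[], s, hl1, by simp, ?_, ?_, ?_⟩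
    · intro u hu
      obtain rfl : u = s := by simpa using hu
      exact ⟨.refl, .refl⟩
    · intro u hu t ht
      obtain rfl : u = s := by simpa using hu
      obtain ⟨v, hv, hv'⟩ := hav t ht
      exact Or.inr ⟨v, hv', hv⟩
    · intro t ht
      obtain ⟨v, hv, hv'⟩ := hav t ht
      exact ⟨v, hv', hv⟩

end IsArcSystem

/-- Every arc that leaves the list and does not end in an exceptional vertex ends in a vertex with
another predecessor outside the list, or in a vertex with `D < 0`. -/
def Pending (S : V → V → Prop) (D : V → ℤ) (E : V → Prop) (l : List V) : Prop :=
  ∀ u ∈ l, ∀ t, S u t → t ∈ l ∨ (∃ v, v ∉ l ∧ S v t) ∨ D t < 0 ∨ E t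

theorem Pending.append {E : V → Prop} {l m : List V} (hl : Pending S D E l)
    (hm : ∀ u ∈ m, ∀ t, S u t → t ∈ l ++ m ∨ (∃ v, v ∉ l ++ m ∧ S v t) ∨ D t < 0 ∨ E t) :
    Pending S D E (l ++ m) := by
  intro u hu t hut
  rcases List.mem_append.1 hu with hu | hu
  · rcases hl u hu t hut with h | ⟨v, hv, hvt⟩ | h | h
    · exact Or.inl (List.mem_append_left _ h)
    · by_cases hvm : v ∈ m
      · exact hm v hvm t hvt
      · exact Or.inr (Or.inl ⟨v, by simp [hv, hvm], hvt⟩)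
    · exact Or.inr (Or.inr (Or.inl h))
    · exact Or.inr (Or.inr (Or.inr h))
  · exact hm u hu t hut

theorem Pending.discharge {E F : V → Prop} {l : List V} (hl : Pending S D E l)
    (hE : ∀ t, E t → t ∈ l ∨ (∃ v, v ∉ l ∧ S v t) ∨ D t < 0 ∨ F t) : Pending S D F l := by
  intro u hu t hut
  rcases hl u hu t hut with h | h | h | h
  · exact Or.inl h
  · exact Or.inr (Or.inl h)
  · exact Or.inr (Or.inr (Or.inl h))
  · exact hE t h

variable (S Ok D) in
/-- The invariant of the greedy construction. -/
structure GreedyInv (l : List V) : Prop where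
  good : GoodList S Ok l
  last : ∀ e ∈ l.getLast?, 0 ≤ D e
  pending : Pending S D (fun _ => False) l
  source : ∀ v, v ∉ l → (∀ u, ¬ S u v) → D v < 0

variable (S) in
/-- A vertex with two successors. -/
def TwoSucc (x : V) : Prop := ∃ s t, S x s ∧ S x t ∧ s ≠ t

variable (S) in
/-- A vertex with two predecessors. -/
def TwoPred (x : V) : Prop := ∃ s t, S s x ∧ S t x ∧ s ≠ t

theorem succ_unique_of_not_twoSucc {x s t : V} (h : ¬ TwoSucc S x) (hs : S x s) (ht : S x t) :
    s = t := by
  by_contra hne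
  exact h ⟨s, t, hs, ht, hne⟩

theorem pred_unique_of_not_twoPred {x s t : V} (h : ¬ TwoPred S x) (hs : S s x) (ht : S t x) :
    s = t := by
  by_contra hne
  exact h ⟨s, t, hs, ht, hne⟩

variable (S Ok D) in
/-- No extension of the list satisfies the invariant. -/
structure IsStuck (l : List V) : Prop extends GreedyInv S Ok D l where
  maximal : ∀ m, m ≠ [] → ¬ GreedyInv S Ok D (l ++ m)

/-- This is what the invariant is made for: all predecessors of an available vertex are used, so
among the alternatives in `Pending` only `D < 0` survives. Since the list ends with `D ≥ 0`, every
available vertex may be appended. -/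
theorem GreedyInv.neg_of_available {l : List V} (hl : GreedyInv S Ok D l) {s : V} (hs : s ∉ l) (hp : ∀ u, S u s → u ∈ l) :
    D s < 0 := by
  by_cases h : ∃ u, S u s
  · obtain ⟨u, hu⟩ := h
    rcases hl.pending u (hp u hu) s hu with h | ⟨v, hv, hvs⟩ | h | h
    · exact absurd h hs
    · exact absurd (hp v hvs) hv
    · exact h
    · exact h.elim
  · push Not at h
    exact hl.source s hs h

theorem GreedyInv.extend {l : List V} (hl : GreedyInv S Ok D l) {m : List V} {e : V} (hg : GoodList S Ok (l ++ (m ++ [e])))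
    (he : 0 ≤ D e) (hp : Pending S D (fun _ => False) (l ++ (m ++ [e]))) :
    GreedyInv S Ok D (l ++ (m ++ [e])) where
  good := hg
  last := by
    intro a ha
    obtain rfl : e = a := by simpa using ha
    exact he
  pending := hp
  source v hv h := hl.source v (fun h => hv (List.mem_append_left _ h)) h

/-- The successors of `x` are exempted for the moment; the exemption is lifted with
`Pending.discharge` once they have been dealt with. -/
theorem GreedyInv.pending_snoc_twoSucc {l : List V} (hl : GreedyInv S Ok D l) {x : V} :
    Pending S D (S x) (l ++ [x]) := by
  refine Pending.append (hl.pending.discharge fun t h => h.elim) ?_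
  intro u hu t ht
  obtain rfl : u = x := by simpa using hu
  exact Or.inr (Or.inr (Or.inr ht))

theorem GreedyInv.exists_isStuck [Fintype V] {l : List V} (hl : GreedyInv S Ok D l) :
    ∃ m, IsStuck S Ok D m := by
  induction hk : Fintype.card V - l.length using Nat.strong_induction_on generalizing l with
  | _ k ih =>
  subst hk
  by_cases h : ∃ m, m ≠ [] ∧ GreedyInv S Ok D (l ++ m)
  · obtain ⟨m, hm, h⟩ := h
    refine ih _ ?_ h rfl
    have h1 : (l ++ m).length ≤ Fintype.card V := h.good.nodup.length_le_card
    have h2 := List.length_pos_of_ne_nil hm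
    simp only [List.length_append] at h1 ⊢
    omega
  · push Not at h
    exact ⟨l, hl, h⟩

namespace IsArcSystem

variable (H : IsArcSystem S Ok D cell) {l : List V}
include H

theorem ok_of_neg {e s : V} (he : 0 ≤ D e) (hs : D s < 0) : Ok e s :=
  H.ok_D e s (by omega) fun h => by have := H.D_cell _ _ h; omega

theorem ok_last_of_available (hl : GreedyInv S Ok D l) {s : V} (hs : s ∉ l)
    (hp : ∀ u, S u s → u ∈ l) : ∀ e ∈ l.getLast?, S e s ∨ Ok e s := fun e he =>
  Or.inr (H.ok_of_neg (hl.last e he) (hl.neg_of_available hs hp))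

theorem not_twoPred_of_succ {u p : V} (hp : S u p) : ¬ TwoPred S u := by
  rintro ⟨s, t, hs, ht, hne⟩
  exact hne (H.pred_unique_of_succ hs ht hp)

/-- A run that ended with `D ≥ 0` would extend the invariant, which a stuck position forbids. -/
theorem exists_run_of_available [Fintype V] (hl : IsStuck S Ok D l) {s : V} (hs : s ∉ l)
    (hp : ∀ u, S u s → u ∈ l) (hu : ¬ TwoSucc S s) :
    ∃ r e, GoodList S Ok (l ++ (r ++ [e])) ∧ s ∈ r ++ [e] ∧ D e < 0 ∧
      (∀ u ∈ r ++ [e], ReflTransGen S u e) ∧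
      (∀ u ∈ r ++ [e], ∀ t, S u t → t ∈ l ++ (r ++ [e]) ∨ ∃ v, v ∉ l ++ (r ++ [e]) ∧ S v t) := by
  obtain ⟨r, e, h1, h2, h3, h4, h5⟩ := H.exists_run hl.good hs hp
    (fun t t' ht ht' => succ_unique_of_not_twoSucc hu ht ht')
    (H.ok_last_of_available hl.toGreedyInv hs hp)
  refine ⟨r, e, h1, h2, ?_, fun u hu => (h3 u hu).2, h4⟩
  by_contra! he
  refine hl.maximal (r ++ [e]) (by simp) (hl.extend h1 he (hl.pending.append ?_))
  intro u hu t ht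
  rcases h4 u hu t ht with h | h
  · exact Or.inl h
  · exact Or.inr (Or.inl h)

/-- A vertex with two successors has no predecessor. -/
theorem twoSucc_not_pred {x : V} (hx : TwoSucc S x) (u : V) : ¬ S u x := by
  obtain ⟨s, t, hs, ht, hne⟩ := hx
  exact (H.succ_two x s t hs ht hne).1 u

theorem twoSucc_neg {x : V} (hx : TwoSucc S x) : D x < 0 := by
  obtain ⟨s, t, hs, ht, hne⟩ := hx
  exact (H.succ_two x s t hs ht hne).2

theorem twoPred_not_succ {x : V} (hx : TwoPred S x) (u : V) : ¬ S x u := by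
  obtain ⟨s, t, hs, ht, hne⟩ := hx
  exact (H.pred_two s t x hs ht hne).1 u

theorem twoPred_pos {x : V} (hx : TwoPred S x) : 0 < D x := by
  obtain ⟨s, t, hs, ht, hne⟩ := hx
  exact (H.pred_two s t x hs ht hne).2

theorem good_snoc_twoSucc (hl : GreedyInv S Ok D l) {x : V} (hx : TwoSucc S x) (hxl : x ∉ l) :
    GoodList S Ok (l ++ [x]) :=
  have hp : ∀ u, S u x → u ∈ l := fun u hu => absurd hu (H.twoSucc_not_pred hx u)
  hl.good.snoc hxl hp (H.ok_last_of_available hl hxl hp)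

theorem exists_run_of_twoSucc [Fintype V] (hl : GreedyInv S Ok D l) {x t : V} (hx : TwoSucc S x)
    (hxl : x ∉ l) (hxt : S x t) (hp : ∀ u, S u t → u ∈ l ++ [x]) :
    ∃ r e, GoodList S Ok (l ++ [x] ++ (r ++ [e])) ∧ t ∈ r ++ [e] ∧ ReflTransGen S t e ∧
      (∀ u ∈ r ++ [e], ReflTransGen S u e) ∧
      (∀ u ∈ r ++ [e], ∀ t, S u t → t ∈ l ++ [x] ++ (r ++ [e]) ∨
        ∃ v, v ∉ l ++ [x] ++ (r ++ [e]) ∧ S v t) := by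
  have htl : t ∉ l ++ [x] := by
    intro h
    rcases List.mem_append.1 h with h | h
    · exact hxl (hl.good.mem_of_pred h hxt)
    · obtain rfl : t = x := by simpa using h
      exact H.acyclic t (.single hxt)
  obtain ⟨r, e, h1, h2, h3, h4, h5⟩ := H.exists_run (H.good_snoc_twoSucc hl hx hxl) htl hp
    (fun a b ha hb => H.succ_unique_of_pred hxt ha hb) (fun e he => by
      obtain rfl : x = e := by simpa using he
      exact Or.inl hxt)
  exact ⟨r, e, h1, h2, (h3 t h2).2, fun u hu => (h3 u hu).2, h4⟩

/-- Otherwise list `x`, a run from an available successor with `D ≥ 0`, and, if it has become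
available, a run from the other successor. The end has `D ≥ 0` and nothing is left pending, so the
position was not stuck. -/
theorem neg_of_twoSucc [Fintype V] (hl : IsStuck S Ok D l) {x t : V} (hx : TwoSucc S x)
    (hxl : x ∉ l) (hxt : S x t) (hp : ∀ u, S u t → u ∈ l ++ [x]) : D t < 0 := by
  by_contra! hpos
  obtain ⟨t, ⟨hxt, hp, hpos⟩, hmax⟩ : ∃ t, (S x t ∧ (∀ u, S u t → u ∈ l ++ [x]) ∧ 0 ≤ D t) ∧
      ∀ s, (S x s ∧ (∀ u, S u s → u ∈ l ++ [x]) ∧ 0 ≤ D s) → D s ≤ D t :=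
    Set.exists_max_image {t | S x t ∧ (∀ u, S u t → u ∈ l ++ [x]) ∧ 0 ≤ D t} D (Set.toFinite _)
      ⟨t, hxt, hp, hpos⟩
  obtain ⟨r, e, h1, h2, h3, h4, h5⟩ := H.exists_run_of_twoSucc hl.toGreedyInv hx hxl hxt hp
  have hDe := H.D_le_of_reflTransGen h3
  have hDx := H.twoSucc_neg hx
  have hpend : Pending S D (S x) (l ++ [x] ++ (r ++ [e])) :=
    (hl.pending_snoc_twoSucc).append fun u hu a ha =>
      (h5 u hu a ha).imp_right Or.inl
  by_cases hall : ∀ a, S x a → a ∈ l ++ [x] ++ (r ++ [e]) ∨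
      (∃ v, v ∉ l ++ [x] ++ (r ++ [e]) ∧ S v a) ∨ D a < 0
  · have hpend' := hpend.discharge (F := fun _ => False) fun a ha =>
      (hall a ha).imp_right (Or.imp_right Or.inl)
    refine hl.maximal ((x :: r) ++ [e]) (by simp) (hl.extend ?_ (by omega) ?_)
    · simpa using h1
    · simpa using hpend'
  · push Not at hall
    obtain ⟨a, hxa, hal, hap, hDa⟩ := hall
    have hat : a ≠ t := by
      rintro rfl
      exact hal (List.mem_append_right _ h2)
    have hap1 : ∀ u, S u a → u ∈ l ++ [x] ++ (r ++ [e]) := fun u hu => by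
      by_contra h
      exact hap u h hu
    have hap2 : ∀ u, S u a → u ∈ l ++ [x] := fun u hu => by
      rcases List.mem_append.1 (hap1 u hu) with h | h
      · exact h
      · rcases h5 u h a hu with h | ⟨v, hv, hva⟩
        · exact absurd h hal
        · exact absurd hva (hap v hv)
    have hDat := hmax a ⟨hxa, hap2, hDa⟩
    -- Here the maximal choice of `D t` matters. If the first run stays in the cell of `t`, the two
    -- successors of `x` are compatible by `ok_succ`; if it leaves the cell, then `D a ≤ D t < D e`.
    have hok : Ok e a := by
      rcases H.cell_or_of_reflTransGen h3 with h | h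
      · exact H.ok_succ x t a e a hxt hxa hat.symm (fun h => by have := H.D_cell _ _ h; omega)
          (fun h => by have := H.D_cell _ _ h; omega) h.symm rfl
      · exact H.ok_D e a (by omega) fun h => by have := H.D_cell _ _ h; omega
    obtain ⟨r', e', g1, g2, g3, g4, -⟩ := H.exists_run h1 hal hap1
      (fun b c hb hc => H.succ_unique_of_pred hxa hb hc) (fun b hb => by
        rw [getLast?_append_snoc] at hb
        obtain rfl : e = b := by simpa using hb
        exact Or.inr hok)
    have hDe' := H.D_le_of_reflTransGen (g3 a g2).2
    have hpend' : Pending S D (S x) (l ++ [x] ++ (r ++ [e]) ++ (r' ++ [e'])) :=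
      hpend.append fun u hu b hb => (g4 u hu b hb).imp_right Or.inl
    have hpendF := hpend'.discharge (F := fun _ => False) fun b hb => by
      rcases H.succ_le x t a b hxt hxa hat.symm hb with rfl | rfl
      · exact Or.inl (List.mem_append_left _ (List.mem_append_right _ h2))
      · exact Or.inl (List.mem_append_right _ g2)
    refine hl.maximal ((x :: r ++ [e] ++ r') ++ [e']) (by simp)
      (hl.extend ?_ (by omega) ?_)
    · simpa using g1
    · simpa using hpendF

/-- A vertex with two predecessors has `D > 0`, so `x` is the only predecessor of `t` and `x, t` can
be listed in succession. By `neg_of_twoSucc` the other successor of `x` is not left available with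
`D ≥ 0`, so stuckness forces the run to end with `D < 0`. -/
theorem exists_continuation_of_twoSucc [Fintype V] (hl : IsStuck S Ok D l) {x t : V}
    (hx : TwoSucc S x) (hxl : x ∉ l) (hxt : S x t) (ht : D t < 0) :
    ∃ r e, GoodList S Ok (l ++ (r ++ [e])) ∧ t ∈ r ++ [e] ∧ D e < 0 ∧
      (∀ u ∈ r ++ [e], ReflTransGen S u e) ∧
      (∀ u ∈ r ++ [e], ∀ t, S u t → t ∈ l ++ (r ++ [e]) ∨ (∃ v, v ∉ l ++ (r ++ [e]) ∧ S v t) ∨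
        (D t < 0 ∧ TwoSucc S u)) := by
  have hp : ∀ u, S u t → u ∈ l ++ [x] := fun u hu => by
    obtain rfl : u = x := by
      by_contra hne
      have := (H.pred_two u x t hu hxt hne).2
      omega
    simp
  obtain ⟨r, e, h1, h2, h3, h4, h5⟩ := H.exists_run_of_twoSucc hl.toGreedyInv hx hxl hxt hp
  have hother : ∀ a, S x a → a ∈ l ++ [x] ++ (r ++ [e]) ∨
      (∃ v, v ∉ l ++ [x] ++ (r ++ [e]) ∧ S v a) ∨ D a < 0 := by
    intro a hxa
    by_contra! hcon
    obtain ⟨hal, hap, hDa⟩ := hcon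
    have hap2 : ∀ u, S u a → u ∈ l ++ [x] := fun u hu => by
      by_contra hul
      by_cases hur : u ∈ r ++ [e]
      · rcases h5 u hur a hu with h | ⟨v, hv, hva⟩
        · exact absurd h hal
        · exact absurd hva (hap v hv)
      · exact hap u (fun h => (List.mem_append.1 h).elim hul hur) hu
    have := H.neg_of_twoSucc hl hx hxl hxa hap2
    omega
  have hass : l ++ [x] ++ (r ++ [e]) = l ++ (x :: r ++ [e]) := by simp
  rw [hass] at h1 h5 hother
  have hDe : D e < 0 := by
    by_contra! hDe
    refine hl.maximal (x :: r ++ [e]) (by simp) (hl.extend h1 hDe ?_)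
    refine hl.pending.append fun u hu a ha => ?_
    rcases List.mem_cons.1 hu with rfl | hu
    · exact (hother a ha).imp_right (Or.imp_right Or.inl)
    · exact (h5 u hu a ha).imp_right Or.inl
  refine ⟨x :: r, e, h1, List.mem_cons_of_mem _ h2, hDe, ?_, ?_⟩
  · intro u hu
    rcases List.mem_cons.1 hu with rfl | hu
    · exact (ReflTransGen.single hxt).trans h3
    · exact h4 u hu
  · intro u hu a ha
    rcases List.mem_cons.1 hu with rfl | hu
    · exact (hother a ha).imp_right (Or.imp_right fun h => ⟨h, hx⟩)
    · exact (h5 u hu a ha).imp_right Or.inl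

theorem wellFounded [Finite V] : WellFounded S := by
  have : Std.Irrefl (TransGen S) := ⟨H.acyclic⟩
  have : IsStrictOrder V (TransGen S) := {}
  exact (Finite.wellFounded_of_trans_of_irrefl (TransGen S)).mono fun _ _ h => .single h

theorem wellFounded_flip [Finite V] : WellFounded (flip S) := by
  have : Std.Irrefl (flip (TransGen S)) := ⟨H.acyclic⟩
  have : IsTrans V (flip (TransGen S)) := ⟨fun _ _ _ h1 h2 => h2.trans h1⟩
  have : IsStrictOrder V (flip (TransGen S)) := {}
  exact (Finite.wellFounded_of_trans_of_irrefl (flip (TransGen S))).mono fun _ _ h => .single h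

theorem continuation_twoSucc_singleton [Fintype V] (hl : IsStuck S Ok D l) {v : V}
    (hv : TwoSucc S v) (hvl : v ∉ l) :
    GoodList S Ok (l ++ ([] ++ [v])) ∧ ∀ u ∈ ([] : List V) ++ [v], ∀ t, S u t →
      t ∈ l ++ ([] ++ [v]) ∨ (∃ w, w ∉ l ++ ([] ++ [v]) ∧ S w t) ∨ (D t < 0 ∧ TwoSucc S u) := by
  refine ⟨H.good_snoc_twoSucc hl.toGreedyInv hv hvl, fun u hu t ht => ?_⟩
  obtain rfl : u = v := by simpa using hu
  by_cases hp : ∀ w, S w t → w ∈ l ++ [u]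
  · exact Or.inr (Or.inr ⟨H.neg_of_twoSucc hl hv hvl ht hp, hv⟩)
  · push Not at hp
    obtain ⟨w, hw, hwl⟩ := hp
    exact Or.inr (Or.inl ⟨w, hwl, hw⟩)

/-- In a stuck position every unused vertex with at most one predecessor lies on a continuation of
the list by vertices with `D < 0`. -/
theorem exists_continuation [Fintype V] (hl : IsStuck S Ok D l) {v : V} (hvl : v ∉ l)
    (hv : ¬ TwoPred S v) :
    ∃ r e, GoodList S Ok (l ++ (r ++ [e])) ∧ v ∈ r ++ [e] ∧ D e < 0 ∧
      (∀ u ∈ r ++ [e], ReflTransGen S u e) ∧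
      (∀ u ∈ r ++ [e], ∀ t, S u t → t ∈ l ++ (r ++ [e]) ∨ (∃ v, v ∉ l ++ (r ++ [e]) ∧ S v t) ∨
        (D t < 0 ∧ TwoSucc S u)) := by
  -- Induction along predecessors. If a predecessor `u` of `v` is unused, take its continuation:
  -- either `v` lies on it, or `u` has two successors and `D v < 0`. A second unused predecessor of
  -- `v` is excluded.
  induction v using H.wellFounded.induction with
  | _ v ih =>
  by_cases hav : ∀ u, S u v → u ∈ l
  · by_cases hts : TwoSucc S v
    · obtain ⟨h1, h2⟩ := H.continuation_twoSucc_singleton hl hts hvl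
      refine ⟨[], v, h1, by simp, H.twoSucc_neg hts, fun u hu => ?_, h2⟩
      obtain rfl : u = v := by simpa using hu
      exact .refl
    · obtain ⟨r, e, h1, h2, h3, h4, h5⟩ := H.exists_run_of_available hl hvl hav hts
      exact ⟨r, e, h1, h2, h3, h4, fun u hu t ht => (h5 u hu t ht).imp_right Or.inl⟩
  · push Not at hav
    obtain ⟨u, huv, hul⟩ := hav
    obtain ⟨r, e, h1, h2, h3, h4, h5⟩ := ih u huv hul (H.not_twoPred_of_succ huv)
    rcases h5 u h2 v huv with h | ⟨w, hw, hwv⟩ | ⟨h, hu⟩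
    · exact ⟨r, e, h1, (List.mem_append.1 h).resolve_left hvl, h3, h4, h5⟩
    · obtain rfl := pred_unique_of_not_twoPred hv hwv huv
      exact absurd (List.mem_append_right _ h2) hw
    · exact H.exists_continuation_of_twoSucc hl hu hul huv h

theorem neg_of_stuck [Fintype V] (hl : IsStuck S Ok D l) {v : V} (hvl : v ∉ l)
    (hv : ¬ TwoPred S v) : D v < 0 := by
  obtain ⟨r, e, h1, h2, h3, h4, h5⟩ := H.exists_continuation hl hvl hv
  exact (H.D_le_of_reflTransGen (h4 v h2)).trans_lt h3

/-- Follow arcs to a sink. It has `D ≥ 0`, while in a stuck position an unused vertex with at most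
one predecessor has `D < 0`. -/
theorem exists_unused_twoPred [Fintype V] (hl : IsStuck S Ok D l) {v : V} (hvl : v ∉ l)
    (hv : (∃ u, S u v) ∨ ∃ u, S v u) : ∃ z, z ∉ l ∧ TwoPred S z := by
  induction v using H.wellFounded_flip.induction with
  | _ v ih =>
  by_cases hs : ∃ t, S v t
  · obtain ⟨t, ht⟩ := hs
    exact ih t ht (fun h => hvl (hl.good.mem_of_pred h ht)) (Or.inl ⟨v, ht⟩)
  · obtain ⟨u, hu⟩ := hv.resolve_right hs
    refine ⟨v, hvl, ?_⟩
    by_contra htp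
    have h1 := H.neg_of_stuck hl hvl htp
    have h2 := H.sink_D u v hu (not_exists.1 hs)
    omega

/-- If one predecessor were used, `Pending` would give a second, unused one `w`. The continuation
through `w` stays in `D < 0` and so misses `z`; leaving `z` pending would then require a third
predecessor or `D z < 0`. -/
theorem pred_unused_of_twoPred [Fintype V] (hl : IsStuck S Ok D l) {z v : V} (hz : TwoPred S z)
    (hzl : z ∉ l) (hvz : S v z) : v ∉ l := by
  intro hv
  have hpos := H.twoPred_pos hz
  rcases hl.pending v hv z hvz with h | ⟨w, hw, hwz⟩ | h | h
  · exact hzl h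
  · obtain ⟨r, e, h1, h2, h3, h4, h5⟩ := H.exists_continuation hl hw (H.not_twoPred_of_succ hwz)
    rcases h5 w h2 z hwz with h | ⟨y, hy, hyz⟩ | h
    · have := H.D_le_of_reflTransGen (h4 z ((List.mem_append.1 h).resolve_left hzl))
      omega
    · have hne : v ≠ w := fun h => hw (h ▸ hv)
      rcases H.pred_le v w z y hvz hwz hne hyz with rfl | rfl
      · exact hy (List.mem_append_left _ hv)
      · exact hy (List.mem_append_right _ h2)
    · omega
  · omega
  · exact h

/-- If `v` has one successor, that is `z` with `D z > 0`, so a continuation through `v` with end in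
`D < 0` must stop at `v`. If `v` has two successors, it has no predecessor and the path is `v`
alone. -/
theorem exists_path_to_pred [Fintype V] (hl : IsStuck S Ok D l) {z v : V} (hz : TwoPred S z)
    (hvl : v ∉ l) (hvz : S v z) :
    ∃ r, GoodList S Ok (l ++ (r ++ [v])) ∧ (TwoSucc S v → r = []) ∧
      (∀ u ∈ r ++ [v], ReflTransGen S u v) ∧
      (∀ u ∈ r ++ [v], ∀ t, S u t → t ∈ l ++ (r ++ [v]) ∨ (∃ w, w ∉ l ++ (r ++ [v]) ∧ S w t) ∨
        (D t < 0 ∧ TwoSucc S u)) := by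
  by_cases hv : TwoSucc S v
  · obtain ⟨h1, h2⟩ := H.continuation_twoSucc_singleton hl hv hvl
    refine ⟨[], h1, fun _ => rfl, fun u hu => ?_, h2⟩
    obtain rfl : u = v := by simpa using hu
    exact .refl
  · obtain ⟨r, e, h1, h2, h3, h4, h5⟩ := H.exists_continuation hl hvl (H.not_twoPred_of_succ hvz)
    obtain rfl : v = e := by
      rcases ReflTransGen.cases_head (h4 v h2) with h | ⟨y, hy, hye⟩
      · exact h
      · obtain rfl := succ_unique_of_not_twoSucc hv hy hvz
        have h6 := H.D_le_of_reflTransGen hye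
        have h7 := H.twoPred_pos hz
        omega
    exact ⟨r, h1, fun h => absurd h hv, h4, h5⟩

/-- A vertex on a path that has an arc to a full sink off the path has two successors. -/
theorem twoSucc_of_conflict {u v z t : V} (huv : ReflTransGen S u v) (hvz : S v z) (hut : S u t)
    (ht : TwoPred S t) (hv : D v < 0) (htz : t ≠ z) : TwoSucc S u := by
  rcases ReflTransGen.cases_head huv with rfl | ⟨y, hy, hyv⟩
  · exact ⟨t, z, hut, hvz, htz⟩
  · refine ⟨t, y, hut, hy, ?_⟩
    rintro rfl
    have h6 := H.D_le_of_reflTransGen hyv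
    have h7 := H.twoPred_pos ht
    omega

/-- The list can be extended by the path to one predecessor `a` of a full sink `z`, the path to the
other predecessor `b`, and `z`. The paths remain in the cells of `a` and `b`, which differ, so they
are disjoint and compatible. The one danger is another sink that loses both of its predecessors to
the two paths. -/
theorem not_isStuck [Fintype V] (hl : IsStuck S Ok D l) {v : V} (hvl : v ∉ l)
    (hv : (∃ u, S u v) ∨ ∃ u, S v u) : False := by
  -- Give priority to sinks all of whose predecessors have two successors.
  obtain ⟨z, hzl, hz, hprio⟩ : ∃ z, z ∉ l ∧ TwoPred S z ∧ ((∃ t, t ∉ l ∧ TwoPred S t ∧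
      ∀ u, S u t → TwoSucc S u) → ∀ u, S u z → TwoSucc S u) := by
    by_cases h : ∃ t, t ∉ l ∧ TwoPred S t ∧ ∀ u, S u t → TwoSucc S u
    · obtain ⟨t, h1, h2, h3⟩ := h
      exact ⟨t, h1, h2, fun _ => h3⟩
    · obtain ⟨z, h1, h2⟩ := H.exists_unused_twoPred hl hvl hv
      exact ⟨z, h1, h2, fun h' => absurd h' h⟩
  obtain ⟨a, b, haz, hbz, hab⟩ := id hz
  have hal := H.pred_unused_of_twoPred hl hz hzl haz
  have hbl := H.pred_unused_of_twoPred hl hz hzl hbz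
  have hDz := H.twoPred_pos hz
  have hDa := H.neg_of_stuck hl hal (H.not_twoPred_of_succ haz)
  have hDb := H.neg_of_stuck hl hbl (H.not_twoPred_of_succ hbz)
  obtain ⟨r, r1, r2, r3, r4⟩ := H.exists_path_to_pred hl hz hal haz
  obtain ⟨q, q1, q2, q3, q4⟩ := H.exists_path_to_pred hl hz hbl hbz
  have hcaz : cell a ≠ cell z := fun h => by have := H.D_cell _ _ h; omega
  have hcbz : cell b ≠ cell z := fun h => by have := H.D_cell _ _ h; omega
  have hcr : ∀ u ∈ r ++ [a], cell u = cell a := fun u hu => H.cell_eq_of_reflTransGen (r3 u hu) hDa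
  have hcq : ∀ u ∈ q ++ [b], cell u = cell b := fun u hu => H.cell_eq_of_reflTransGen (q3 u hu) hDb
  have hcab := H.cell_pred z a b haz hbz hab hcaz hcbz
  have hgood : GoodList S Ok (l ++ (r ++ [a]) ++ (q ++ [b])) := by
    refine GoodList.insert_middle q1 r1 (by simp) ?_ ?_
    · intro u hu hu'
      exact hcab ((hcr u hu').symm.trans (hcq u hu))
    · intro e he s hs
      obtain rfl : a = e := by simpa using he
      exact H.ok_pred z a b a s haz hbz hab hcaz hcbz rfl (hcq s hs)
  have hzr : z ∉ r ++ [a] := fun h => hcaz (hcr z h).symm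
  have hzq : z ∉ q ++ [b] := fun h => hcbz (hcq z h).symm
  have hgood' : GoodList S Ok (l ++ (r ++ [a]) ++ (q ++ [b]) ++ [z]) := by
    refine hgood.snoc ?_ ?_ ?_
    · simp only [List.mem_append] at hzr hzq ⊢
      tauto
    · intro u hu
      rcases H.pred_le a b z u haz hbz hab hu with rfl | rfl <;> simp
    · intro e he
      rw [getLast?_append_snoc] at he
      obtain rfl : b = e := by simpa using he
      exact Or.inl hbz
  -- A common successor `t ≠ z` of the two paths is a full sink whose predecessors both have two
  -- successors. By priority so have `a` and `b`, both paths shrink to single vertices, and `a`,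
  -- `b`, `z`, `t` form a forbidden square.
  have hconf : ∀ u ∈ r ++ [a], ∀ w ∈ q ++ [b], ∀ t, S u t → S w t → t ∉ l → t = z := by
    intro u hu w hw t hut hwt htl
    by_contra htz
    have huw : u ≠ w := by
      rintro rfl
      exact hcab ((hcr u hu).symm.trans (hcq u hw))
    have ht : TwoPred S t := ⟨u, w, hut, hwt, huw⟩
    have hu2 := H.twoSucc_of_conflict (r3 u hu) haz hut ht hDa htz
    have hw2 := H.twoSucc_of_conflict (q3 w hw) hbz hwt ht hDb htz
    have hall := hprio ⟨t, htl, ht, fun y hy => by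
      rcases H.pred_le u w t y hut hwt huw hy with rfl | rfl
      · exact hu2
      · exact hw2⟩
    obtain rfl := r2 (hall a haz)
    obtain rfl := q2 (hall b hbz)
    obtain rfl : u = a := by simpa using hu
    obtain rfl : w = b := by simpa using hw
    exact htz (H.no_square u w t z hut hwt haz hbz huw)
  have hass : l ++ (r ++ [a]) ++ (q ++ [b]) ++ [z] = l ++ ((r ++ [a] ++ (q ++ [b])) ++ [z]) := by
    simp
  rw [hass] at hgood'
  refine hl.maximal _ (by simp) (hl.extend hgood' hDz.le ?_)
  refine hl.pending.append ?_
  rw [← hass]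
  intro u hu t hut
  rcases List.mem_append.1 hu with hu | hu
  · by_cases htz : t = z
    · exact Or.inl (htz ▸ by simp)
    by_cases htl : t ∈ l
    · exact Or.inl (by simp [htl])
    have hw : ∀ w, S w t → w ∉ l ++ (r ++ [a]) → w ∉ q ++ [b] →
        w ∉ l ++ (r ++ [a]) ++ (q ++ [b]) ++ [z] := by
      intro w hwt h1 h2 h
      rcases List.mem_append.1 h with h | h
      · exact (List.mem_append.1 h).elim h1 h2
      · obtain rfl : w = z := by simpa using h
        exact H.twoPred_not_succ hz t hwt
    rcases List.mem_append.1 hu with hu | hu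
    · rcases r4 u hu t hut with h | ⟨w, hwl, hwt⟩ | h
      · exact Or.inl (List.mem_append_left _ (List.mem_append_left _ h))
      · exact Or.inr (Or.inl ⟨w, hw w hwt hwl fun h => htz (hconf u hu w h t hut hwt htl), hwt⟩)
      · exact Or.inr (Or.inr (Or.inl h.1))
    · rcases q4 u hu t hut with h | ⟨w, hwl, hwt⟩ | h
      · refine Or.inl (List.mem_append_left _ ?_)
        rcases List.mem_append.1 h with h | h
        · exact absurd h htl
        · exact List.mem_append_right _ h
      · refine Or.inr (Or.inl ⟨w, hw w hwt (fun h => ?_)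
          (fun h => hwl (List.mem_append_right _ h)), hwt⟩)
        rcases List.mem_append.1 h with h | h
        · exact hwl (List.mem_append_left _ h)
        · exact htz (hconf w h u hu t hwt hut htl)
      · exact Or.inr (Or.inr (Or.inl h.1))
  · obtain rfl : u = z := by simpa using hu
    exact absurd hut (H.twoPred_not_succ hz t)

/-- A list of all isolated vertices that satisfy a condition, with decreasing `D`. -/
theorem exists_isolated_list [Fintype V] (C : V → Prop) :
    ∃ m : List V, (∀ v, v ∈ m ↔ C v ∧ (∀ u, ¬ S u v) ∧ ∀ u, ¬ S v u) ∧ m.Nodup ∧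
      m.Pairwise Ok := by
  classical
  let m0 : List V := (Finset.univ.filter fun v => C v ∧ (∀ u, ¬ S u v) ∧ ∀ u, ¬ S v u).toList
  have hmem : ∀ v, v ∈ m0.mergeSort (fun u v => decide (D v ≤ D u)) ↔
      C v ∧ (∀ u, ¬ S u v) ∧ ∀ u, ¬ S v u := fun v => by simp [m0]
  have hnd : (m0.mergeSort (fun u v => decide (D v ≤ D u))).Nodup :=
    ((List.mergeSort_perm _ _).nodup_iff).2 (Finset.nodup_toList _)
  refine ⟨_, hmem, hnd, ?_⟩
  have hs := List.pairwise_mergeSort (le := fun u v => decide (D v ≤ D u))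
    (fun a b c h1 h2 => by simp only [decide_eq_true_eq] at *; omega)
    (fun a b => by simp only [Bool.or_eq_true, decide_eq_true_eq]; omega) m0
  refine (hs.and hnd).imp_of_mem ?_
  rintro a b ha hb ⟨h1, h2⟩
  refine H.ok_D a b (by simpa using h1) fun h => h2 ?_
  rw [hmem] at ha hb
  exact H.isolated_unique a b h ha.2.1 ha.2.2 hb.2.1 hb.2.2

/-- The list begins with the isolated vertices having `D > 0`, in decreasing order of `D`, followed
by runs from the sources with `D = 0`. The last clause of the induction says that the list ends with
`D > 0`, or with `D = 0` in the cell of a source already listed; since a cell with `D = 0` has only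
one source, the next one lies in another cell and may follow. -/
theorem exists_greedyInv [Fintype V] : ∃ l, GreedyInv S Ok D l := by
  obtain ⟨m, hm, hnd, hok⟩ := H.exists_isolated_list fun v => 0 < D v
  suffices h : ∀ k l, Fintype.card V - l.length = k → GoodList S Ok l →
      Pending S D (fun _ => False) l → (∀ v ∈ m, v ∈ l) →
      (∀ e ∈ l.getLast?, 0 < D e ∨ D e = 0 ∧ ∃ s ∈ l, (∀ u, ¬ S u s) ∧ cell s = cell e) →
      ∃ l, GreedyInv S Ok D l by
    refine h _ m rfl ?_ ?_ (fun _ h => h) ?_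
    · simpa using GoodList.nil.append_isolated hok hnd (by simp) (fun v hv => ((hm v).1 hv).2.1)
        (by simp)
    · intro u hu t ht
      exact absurd ht (((hm u).1 hu).2.2 t)
    · intro e he
      exact Or.inl ((hm e).1 (List.mem_of_getLast? he)).1
  intro k
  induction k using Nat.strong_induction_on with
  | _ k ih =>
  rintro l rfl hl hp hml hlast
  by_cases hex : ∃ v, v ∉ l ∧ (∀ u, ¬ S u v) ∧ D v = 0
  · obtain ⟨v, hvl, hvp, hvD⟩ := hex
    have hts : ¬ TwoSucc S v := fun h => by have := H.twoSucc_neg h; omega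
    obtain ⟨r, e, h1, h2, h3, h4, -⟩ := H.exists_run hl hvl (fun u hu => absurd hu (hvp u))
      (fun t t' ht ht' => succ_unique_of_not_twoSucc hts ht ht') (fun e he => by
        right
        rcases hlast e he with h | ⟨h, s, hs, hsp, hse⟩
        · exact H.ok_D e v (by omega) fun h => by have := H.D_cell _ _ h; omega
        · refine H.ok_D e v (by omega) fun hev => hvl ?_
          have hDs := H.D_cell _ _ hse
          rwa [← H.zero_unique s v (by omega) (hse.trans hev) hsp hvp])
    refine ih _ ?_ (l ++ (r ++ [e])) rfl h1
      (hp.append fun u hu t ht => (h4 u hu t ht).imp_right Or.inl)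
      (fun w hw => List.mem_append_left _ (hml w hw)) ?_
    · have := h1.nodup.length_le_card
      simp only [List.length_append, List.length_singleton] at this ⊢
      omega
    · intro a ha
      obtain rfl : e = a := by simpa using ha
      rcases H.cell_or_of_reflTransGen (h3 v h2).2 with h | h
      · exact Or.inr ⟨by rw [← H.D_cell _ _ h, hvD], v, List.mem_append_right _ h2, hvp, h⟩
      · left; omega
  · push Not at hex
    refine ⟨l, hl, fun e he => ?_, hp, fun v hv hvp => ?_⟩
    · rcases hlast e he with h | h
      · exact h.le
      · exact h.1.ge
    · have h0 := hex v hv hvp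
      by_cases hs : ∃ t, S v t
      · obtain ⟨t, ht⟩ := hs
        exact lt_of_le_of_ne (H.source_D v t ht hvp) h0
      · by_contra! hneg
        exact hv (hml v ((hm v).2 ⟨lt_of_le_of_ne hneg (Ne.symm h0), hvp, not_exists.1 hs⟩))

/-- Every arc system has a Hamiltonian linear extension. -/
theorem exists_goodList [Fintype V] : ∃ l, GoodList S Ok l ∧ ∀ v, v ∈ l := by
  obtain ⟨l0, hl0⟩ := H.exists_greedyInv
  obtain ⟨l, hl⟩ := hl0.exists_isStuck
  obtain ⟨m, hm, hnd, hok⟩ := H.exists_isolated_list fun v => v ∉ l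
  -- Only isolated vertices remain; by the clause `source` they have `D < 0`, so they fit behind an
  -- end with `D ≥ 0`.
  refine ⟨l ++ m, hl.good.append_isolated hok hnd (fun v hv => ((hm v).1 hv).1)
    (fun v hv => ((hm v).1 hv).2.1) ?_, fun v => ?_⟩
  · intro e he s hs
    obtain ⟨h1, h2, -⟩ := (hm s).1 hs
    exact H.ok_of_neg (hl.last e he) (hl.source s h1 h2)
  · by_cases hvl : v ∈ l
    · exact List.mem_append_left _ hvl
    · refine List.mem_append_right _ ((hm v).2 ⟨hvl, ?_, ?_⟩)
      · intro u hu
        exact H.not_isStuck hl hvl (Or.inl ⟨u, hu⟩)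
      · intro u hu
        exact H.not_isStuck hl hvl (Or.inr ⟨u, hu⟩)

end IsArcSystem

end GoodList

/-! ### Marked double partitions of the integers into intervals -/

section Meander

open Relation

/-- The opposite side. -/
def Side.swap : Side → Side
  | .above => .below
  | .below => .above

/-- Two partitions of the integers into bounded intervals; `[lo s x, hi s x]` is the interval that
contains `x`. -/
structure IntervalPair where
  lo : Side → ℤ → ℤ
  hi : Side → ℤ → ℤ
  lo_le : ∀ s x, lo s x ≤ x
  le_hi : ∀ s x, x ≤ hi s x
  lo_eq : ∀ s x y, lo s x ≤ y → y ≤ hi s x → lo s y = lo s x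
  hi_eq : ∀ s x y, lo s x ≤ y → y ≤ hi s x → hi s y = hi s x

namespace IntervalPair

variable (B : IntervalPair)

/-- The reflection of the interval of `x` is `y ↦ B.sum s x - y`. -/
def sum (s : Side) (x : ℤ) : ℤ := B.lo s x + B.hi s x

/-- The difference of the two reflections. -/
def diff (x : ℤ) : ℤ := B.sum .below x - B.sum .above x

/-- The pair of intervals that contain `x`. -/
def cell (x : ℤ) : ℤ × ℤ := (B.lo .above x, B.lo .below x)

theorem lo_eq_of_le {s : Side} {x y : ℤ} (h1 : x ≤ y) (h2 : y ≤ B.hi s x) : B.lo s y = B.lo s x :=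
  B.lo_eq s x y ((B.lo_le s x).trans h1) h2

theorem lo_eq_of_ge {s : Side} {x y : ℤ} (h1 : B.lo s x ≤ y) (h2 : y ≤ x) : B.lo s y = B.lo s x :=
  B.lo_eq s x y h1 (h2.trans (B.le_hi s x))

theorem hi_eq_of_lo_eq {s : Side} {x y : ℤ} (h : B.lo s x = B.lo s y) : B.hi s x = B.hi s y := by
  rcases le_total x y with hxy | hxy
  · exact B.hi_eq s y x (by rw [← h]; exact B.lo_le s x) (hxy.trans (B.le_hi s y))
  · exact (B.hi_eq s x y (by rw [h]; exact B.lo_le s y) (hxy.trans (B.le_hi s x))).symm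

theorem sum_eq_of_lo_eq {s : Side} {x y : ℤ} (h : B.lo s x = B.lo s y) : B.sum s x = B.sum s y := by
  rw [sum, sum, h, B.hi_eq_of_lo_eq h]

theorem sum_eq {s : Side} {x y : ℤ} (h1 : B.lo s x ≤ y) (h2 : y ≤ B.hi s x) :
    B.sum s y = B.sum s x :=
  B.sum_eq_of_lo_eq (B.lo_eq s x y h1 h2)

theorem hi_lt_lo {s : Side} {x y : ℤ} (hxy : x < y) (h : B.lo s x ≠ B.lo s y) :
    B.hi s x < B.lo s y := by
  have h1 : B.hi s x < y := by
    by_contra! h1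
    exact h (B.lo_eq_of_le hxy.le h1).symm
  by_contra! h2
  have h3 := B.lo_eq_of_ge h2 h1.le
  have h4 := B.lo_eq_of_le (B.le_hi s x) le_rfl
  exact h (h4.symm.trans h3)

theorem sum_lt {s : Side} {x y : ℤ} (hxy : x < y) (h : B.lo s x ≠ B.lo s y) :
    B.sum s x < B.sum s y := by
  have h1 := B.hi_lt_lo hxy h
  have h2 := B.lo_le s x
  have h3 := B.le_hi s x
  have h4 := B.lo_le s y
  have h5 := B.le_hi s y
  simp only [sum]
  omega

theorem cell_eq_iff {x y : ℤ} : B.cell x = B.cell y ↔ ∀ s, B.lo s x = B.lo s y := by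
  rw [cell, cell, Prod.mk.injEq]
  exact ⟨fun h s => by cases s; exacts [h.1, h.2], fun h => ⟨h _, h _⟩⟩

/-- The positions outside the support of the biparabolic subalgebra. -/
def Off (x y : ℤ) : Prop :=
  (x < y ∧ B.lo .above x ≠ B.lo .above y) ∨ (y < x ∧ B.lo .below x ≠ B.lo .below y)

theorem off_of_diff_le {x y : ℤ} (h : B.diff y ≤ B.diff x) (hc : B.cell x ≠ B.cell y) :
    B.Off x y := by
  simp only [diff] at h
  rcases lt_trichotomy x y with hxy | rfl | hxy
  · refine Or.inl ⟨hxy, fun he => ?_⟩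
    have h1 := B.sum_eq_of_lo_eq he
    have h2 := B.sum_lt (s := .below) hxy fun h => hc (B.cell_eq_iff.2 fun s => by
      cases s; exacts [he, h])
    omega
  · exact absurd rfl hc
  · refine Or.inr ⟨hxy, fun he => ?_⟩
    have h1 := B.sum_eq_of_lo_eq he
    have h2 := B.sum_lt (s := .above) hxy fun h => hc (B.cell_eq_iff.2 fun s => by
      cases s; exacts [h.symm, he])
    omega

end IntervalPair

/-- The union of the interval `[p, q + 1]` and its mirror image under `x ↦ P - x`. -/
def runSet (P p q : ℤ) : Set ℤ := {x | p ≤ x ∧ x ≤ P - p ∧ (x ≤ q + 1 ∨ P - (q + 1) ≤ x)}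

/-- The involution `σ` permutes the run set transitively together with the reflection, and its
product with the reflection is transitive if the run reaches the centre. -/
structure IsAntiToeplitz (σ : ℤ → ℤ) (P p q : ℤ) : Prop where
  stable : ∀ x ∈ runSet P p q, σ x ∈ runSet P p q
  transitive : ∀ T ⊆ runSet P p q, T.Nonempty → (∀ x ∈ T, σ x ∈ T) → (∀ x ∈ T, P - x ∈ T) →
    runSet P p q ⊆ T
  cyclic : P ≤ 2 * q + 2 → ∀ T ⊆ runSet P p q, T.Nonempty → (∀ x ∈ T, P - σ x ∈ T) →
    runSet P p q ⊆ T

/-- A pair of interval partitions with marked half-integers and modified involutions. The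
half-integer between `i` and `i + 1` is named by `i`; `M s i` says that the arc through `i` on the
side `s` is marked, and `rel` is the relation of lying on one half-integer meander. -/
structure MarkedPair extends IntervalPair where
  σ : Side → ℤ → ℤ
  M : Side → ℤ → Prop
  rel : ℤ → ℤ → Prop
  rel_equiv : Equivalence rel
  rel_swap : ∀ s i, i < hi s i → rel i (toIntervalPair.sum s i - 1 - i)
  σ_σ : ∀ s x, σ s (σ s x) = x
  lo_σ : ∀ s x, lo s (σ s x) = lo s x
  σ_antidiag : ∀ s x, x < σ s x → 2 * x ≤ toIntervalPair.sum s x ∧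
    toIntervalPair.sum s x ≤ 2 * σ s x
  mark_of_lt : ∀ s x i, x ≤ i → i < toIntervalPair.sum s x - σ s x → M s i
  mark_of_gt : ∀ s x i, toIntervalPair.sum s x - σ s x ≤ i → i < x → M s i
  lt_of_mark : ∀ s i, M s i → i < hi s i
  mark_symm : ∀ s i, M s i → M s (toIntervalPair.sum s i - 1 - i)
  mark_unique : ∀ s t i j, M s i → M t j → rel i j →
    s = t ∧ (j = i ∨ j = toIntervalPair.sum s i - 1 - i)
  mark_end : ∀ s t i e, M s i → rel i e → 2 * e = toIntervalPair.sum t e - 1 →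
    2 * i = toIntervalPair.sum s i - 1
  exists_mark : ∀ i, (∀ s, i < hi s i) →
    toIntervalPair.sum .above i = toIntervalPair.sum .below i → ∃ s, M s i
  exists_run : ∀ s i, M s i → 2 * i + 1 ≤ toIntervalPair.sum s i →
    ∃ p q, lo s i ≤ p ∧ p ≤ i ∧ i ≤ q ∧ 2 * q + 1 ≤ toIntervalPair.sum s i ∧ (∀ j, p ≤ j → j ≤ q → M s j) ∧
      ¬ M s (p - 1) ∧ IsAntiToeplitz (σ s) (toIntervalPair.sum s i) p q

namespace MarkedPair

/-- Interchange the two sides. -/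
def swap (E : MarkedPair) : MarkedPair where
  lo s := E.lo s.swap
  hi s := E.hi s.swap
  lo_le s := E.lo_le s.swap
  le_hi s := E.le_hi s.swap
  lo_eq s := E.lo_eq s.swap
  hi_eq s := E.hi_eq s.swap
  σ s := E.σ s.swap
  M s := E.M s.swap
  rel := E.rel
  rel_equiv := E.rel_equiv
  rel_swap s := E.rel_swap s.swap
  σ_σ s := E.σ_σ s.swap
  lo_σ s := E.lo_σ s.swap
  σ_antidiag s := E.σ_antidiag s.swap
  mark_of_lt s := E.mark_of_lt s.swap
  mark_of_gt s := E.mark_of_gt s.swap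
  lt_of_mark s := E.lt_of_mark s.swap
  mark_symm s := E.mark_symm s.swap
  mark_unique s t i j hi hj h := by
    have := E.mark_unique s.swap t.swap i j hi hj h
    exact ⟨by cases s <;> cases t <;> first | rfl | exact absurd this.1 (by simp [Side.swap]), this.2⟩
  mark_end s t := E.mark_end s.swap t.swap
  exists_mark i h1 h2 := by
    obtain ⟨s, hs⟩ := E.exists_mark i (fun s => by cases s; exacts [h1 .below, h1 .above]) h2.symm
    cases s
    exacts [⟨.below, hs⟩, ⟨.above, hs⟩]
  exists_run s := E.exists_run s.swap

variable (E : MarkedPair)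

theorem hi_σ (s : Side) (x : ℤ) : E.hi s (E.σ s x) = E.hi s x := E.hi_eq_of_lo_eq (E.lo_σ s x)

theorem sum_σ (s : Side) (x : ℤ) : E.sum s (E.σ s x) = E.sum s x := E.sum_eq_of_lo_eq (E.lo_σ s x)

theorem lo_le_σ (s : Side) (x : ℤ) : E.lo s x ≤ E.σ s x := E.lo_σ s x ▸ E.lo_le s _

theorem σ_le_hi (s : Side) (x : ℤ) : E.σ s x ≤ E.hi s x := E.hi_σ s x ▸ E.le_hi s _

theorem sum_succ {s : Side} {i : ℤ} (h : i < E.hi s i) : E.sum s (i + 1) = E.sum s i :=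
  E.sum_eq (by have := E.lo_le s i; omega) (by omega)

theorem lt_hi_swap {s : Side} {i : ℤ} (h : i < E.hi s i) :
    E.sum s (E.sum s i - 1 - i) = E.sum s i ∧ E.sum s i - 1 - i < E.hi s i := by
  have h1 := E.lo_le s i
  refine ⟨E.sum_eq ?_ ?_, ?_⟩ <;> simp only [IntervalPair.sum] <;> omega

theorem neg_succ {s : Side} {i : ℤ} (h : i < -E.lo s (-i)) :
    E.lo s (-1 - i) = E.lo s (-i) ∧ E.hi s (-1 - i) = E.hi s (-i) := by
  have := E.le_hi s (-i)
  exact ⟨E.lo_eq s _ _ (by omega) (by omega), E.hi_eq s _ _ (by omega) (by omega)⟩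

theorem neg_succ' {s : Side} {i : ℤ} (h : -1 - i < E.hi s (-1 - i)) :
    E.lo s (-1 - i) = E.lo s (-i) ∧ E.hi s (-1 - i) = E.hi s (-i) := by
  have := E.lo_le s (-1 - i)
  exact ⟨(E.lo_eq s _ _ (by omega) (by omega)).symm, (E.hi_eq s _ _ (by omega) (by omega)).symm⟩

/-- Reflect the line. -/
def reflect : MarkedPair where
  lo s x := - E.hi s (-x)
  hi s x := - E.lo s (-x)
  lo_le s x := by have := E.le_hi s (-x); omega
  le_hi s x := by have := E.lo_le s (-x); omega
  lo_eq s x y h1 h2 := by rw [E.hi_eq s (-x) (-y) (by omega) (by omega)]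
  hi_eq s x y h1 h2 := by rw [E.lo_eq s (-x) (-y) (by omega) (by omega)]
  σ s x := - E.σ s (-x)
  M s i := E.M s (-1 - i)
  rel i j := E.rel (-1 - i) (-1 - j)
  rel_equiv := ⟨fun _ => E.rel_equiv.refl _, fun h => E.rel_equiv.symm h,
    fun h1 h2 => E.rel_equiv.trans h1 h2⟩
  rel_swap s i h := by
    obtain ⟨h1, h2⟩ := E.neg_succ h
    have h3 := E.rel_swap s (-1 - i) (by have := E.le_hi s (-i); omega)
    convert h3 using 1
    simp only [IntervalPair.sum, h1, h2]
    omega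
  σ_σ s x := by simp [E.σ_σ]
  lo_σ s x := by simp [E.hi_σ]
  σ_antidiag s x h := by
    have h1 := E.σ_antidiag s (E.σ s (-x)) (by rw [E.σ_σ]; omega)
    rw [E.σ_σ, E.sum_σ] at h1
    simp only [IntervalPair.sum] at *
    omega
  mark_of_lt s x i h1 h2 := E.mark_of_gt s (-x) (-1 - i) (by simp only [IntervalPair.sum] at *; omega)
    (by omega)
  mark_of_gt s x i h1 h2 := E.mark_of_lt s (-x) (-1 - i) (by omega)
    (by simp only [IntervalPair.sum] at *; omega)
  lt_of_mark s i h := by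
    have h0 := E.lt_of_mark s _ h
    obtain ⟨h1, h2⟩ := E.neg_succ' h0
    have := E.lo_le s (-1 - i)
    omega
  mark_symm s i h := by
    obtain ⟨h1, h2⟩ := E.neg_succ' (E.lt_of_mark s _ h)
    convert E.mark_symm s _ h using 1
    simp only [IntervalPair.sum, h1, h2]
    omega
  mark_unique s t i j hi hj h := by
    obtain ⟨h1, h2⟩ := E.neg_succ' (E.lt_of_mark s _ hi)
    have h3 := E.mark_unique s t _ _ hi hj h
    refine ⟨h3.1, ?_⟩
    have h4 := h3.2
    simp only [IntervalPair.sum, h1, h2] at h4 ⊢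
    omega
  mark_end s t i e hi he h := by
    obtain ⟨h1, h2⟩ := E.neg_succ' (E.lt_of_mark s _ hi)
    simp only [IntervalPair.sum] at h ⊢
    have h5 := E.lo_le t (-e)
    have h6 := E.le_hi t (-e)
    obtain ⟨h3, h4⟩ := E.neg_succ (s := t) (i := e) (by omega)
    have h7 := E.mark_end s t _ _ hi he (by simp only [IntervalPair.sum, h3, h4]; omega)
    simp only [IntervalPair.sum, h1, h2] at h7
    omega
  exists_mark i h1 h2 := by
    have h3 := fun s => E.neg_succ (s := s) (i := i) (h1 s)
    have h4 := fun s => E.le_hi s (-i)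
    refine E.exists_mark (-1 - i) (fun s => ?_) ?_
    · have := h3 s
      have := h4 s
      omega
    · simp only [IntervalPair.sum, (h3 _).1, (h3 _).2] at h2 ⊢
      omega
  exists_run s i hi h := by
    have h0 := E.lt_of_mark s _ hi
    obtain ⟨h1, h2⟩ := E.neg_succ' h0
    have h3 := E.mark_symm s _ hi
    obtain ⟨h4, h5⟩ := E.lt_hi_swap h0
    obtain ⟨p, q, hp0, hp, hq, hc, hm, hm', hT⟩ := E.exists_run s _ h3 (by
      rw [h4]
      simp only [IntervalPair.sum, h1, h2] at h ⊢
      omega)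
    have hP : -E.hi s (-i) + -E.lo s (-i) = - E.sum s (-1 - i) := by
      simp only [IntervalPair.sum, h1, h2]; omega
    rw [h4] at hT hc
    have hlo : E.lo s (E.sum s (-1 - i) - 1 - (-1 - i)) = E.lo s (-1 - i) := by
      have := E.lo_le s (-1 - i)
      apply E.lo_eq <;> simp only [IntervalPair.sum] <;> omega
    rw [hlo] at hp0
    simp only [IntervalPair.sum] at h ⊢
    rw [hP] at h ⊢
    have hP' : E.sum s (-1 - i) = E.lo s (-1 - i) + E.hi s (-1 - i) := rfl
    generalize E.sum s (-1 - i) = P at *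
    -- Reflecting the line interchanges left and right halves, so the run is first mirrored within
    -- its interval by `x ↦ P - 1 - x` and then sent through `x ↦ -1 - x`. Together this is the
    -- shift by `-P`.
    refine ⟨p - P, q - P, by omega, by omega, by omega, by omega, fun j hj1 hj2 => ?_,
      fun h6 => hm' ?_, ?_⟩
    · have h6 := E.mark_symm s _ (hm (j + P) (by omega) (by omega))
      have h7 : E.sum s (j + P) = P := by
        rw [hP']
        apply E.sum_eq <;> omega
      rw [h7] at h6
      convert h6 using 1
      omega
    · have h7 : E.sum s (-1 - (p - P - 1)) = P := by
        rw [hP']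
        apply E.sum_eq <;> omega
      have h8 := E.mark_symm s _ h6
      rw [h7] at h8
      convert h8 using 1
      omega
    · have hmem : ∀ x, x ∈ runSet (-P) (p - P) (q - P) ↔ -x ∈ runSet P p q := fun x => by
        simp only [runSet, Set.mem_ofPred_eq]
        omega
      constructor
      · intro x hx
        rw [hmem] at hx ⊢
        simpa using hT.stable _ hx
      · intro T hT1 hT2 hT3 hT4 x hx
        have := hT.transitive {y | -y ∈ T} (fun y hy => by simpa [hmem] using hT1 hy)
          (by obtain ⟨y, hy⟩ := hT2; exact ⟨-y, by simpa using hy⟩)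
          (fun y hy => by simpa using hT3 (-y) hy)
          (fun y hy => by
            have := hT4 (-y) hy
            simp only [Set.mem_ofPred_eq]
            convert this using 1
            omega) ((hmem x).1 hx)
        simpa using this
      · intro hc' T hT1 hT2 hT3 x hx
        have := hT.cyclic (by omega) {y | -y ∈ T} (fun y hy => by simpa [hmem] using hT1 hy)
          (by obtain ⟨y, hy⟩ := hT2; exact ⟨-y, by simpa using hy⟩)
          (fun y hy => by
            have := hT3 (-y) hy
            simp only [Set.mem_ofPred_eq, neg_neg] at this ⊢
            convert this using 1
            omega) ((hmem x).1 hx)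
        simpa using this

theorem reflect_sum (s : Side) (x : ℤ) : E.reflect.sum s x = - E.sum s (-x) := by
  simp only [IntervalPair.sum, reflect]
  omega

theorem reflect_diff (x : ℤ) : E.reflect.diff x = - E.diff (-x) := by
  simp only [IntervalPair.diff, reflect_sum]
  omega

theorem swap_diff (x : ℤ) : E.swap.diff x = - E.diff x := by
  simp only [IntervalPair.diff, IntervalPair.sum, swap, Side.swap]
  omega

theorem mark_not_both {i : ℤ} (h1 : E.M .above i) (h2 : E.M .below i) : False := by
  have := (E.mark_unique _ _ _ _ h1 h2 (E.rel_equiv.refl i)).1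
  cases this

/-- Two overlapping reflections of intervals with a common right end. -/
theorem spiral {rel : ℤ → ℤ → Prop} (hr : Equivalence rel) {c d δ : ℤ} (hδ : 0 < δ)
    (hcd : c + δ ≤ d) (hA : ∀ i, c ≤ i → i < d → rel i (c + d - 1 - i))
    (hB : ∀ i, c + δ ≤ i → i < d → rel i (c + d + δ - 1 - i)) :
    (∃ i, c < i ∧ i < c + δ ∧ rel c i) ∨
      ∃ e, c ≤ e ∧ e < d ∧ rel c e ∧ (2 * e = c + d - 1 ∨ c + δ ≤ e ∧ 2 * e = c + d + δ - 1) := by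
  -- The product of the two reflections is the translation by `δ`.
  have hstep : ∀ j, c ≤ j → j + δ < d → rel j (j + δ) := fun j h1 h2 => by
    have h3 := hB (c + d - 1 - j) (by omega) (by omega)
    rw [show c + d + δ - 1 - (c + d - 1 - j) = j + δ by omega] at h3
    exact hr.trans (hA j h1 (by omega)) h3
  have hmul : ∀ (k : ℕ) j, c ≤ j → j + k * δ < d → rel j (j + k * δ) := by
    intro k
    induction k with
    | zero => intro j _ _; simpa using hr.refl j
    | succ k ih =>
      intro j h1 h2
      push_cast at h2 ⊢
      have h3 : (k + 1 : ℤ) * δ = k * δ + δ := by ring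
      rw [h3] at h2 ⊢
      have h4 : (0 : ℤ) ≤ k * δ := by positivity
      rw [← add_assoc]
      exact hr.trans (ih j h1 (by omega)) (hstep _ (by omega) (by omega))
  have h1 := hA c le_rfl (by omega)
  rw [show c + d - 1 - c = d - 1 by omega] at h1
  obtain ⟨m, hm⟩ : ∃ m : ℕ, (m : ℤ) = (d - 1 - c) / δ :=
    ⟨((d - 1 - c) / δ).toNat, Int.toNat_of_nonneg (Int.ediv_nonneg (by omega) hδ.le)⟩
  have h2 := Int.emod_add_mul_ediv (d - 1 - c) δ
  have h3 := Int.emod_nonneg (d - 1 - c) hδ.ne'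
  have h4 := Int.emod_lt_of_pos (d - 1 - c) hδ
  rw [← hm, mul_comm] at h2
  have h5 := hmul m (c + (d - 1 - c) % δ) (by omega) (by omega)
  rw [show c + (d - 1 - c) % δ + m * δ = d - 1 by omega] at h5
  have h6 := hr.trans h1 (hr.symm h5)
  -- Translating `d - 1`, the mirror image of `c`, back into the first `δ` places gives a second
  -- point there, unless the remainder is 0. In that case `c, c + δ, …, d - 1` is symmetric, and
  -- according to the parity of the number of steps the first or the second reflection fixes a
  -- member of it.
  by_cases h0 : (d - 1 - c) % δ = 0
  · right
    rw [h0, zero_add] at h2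
    rcases Nat.even_or_odd' m with ⟨j, rfl | rfl⟩
    · push_cast at h2
      have h7 : (0 : ℤ) ≤ j * δ := by positivity
      have h8 : (2 * j : ℤ) * δ = 2 * (j * δ) := by ring
      rw [h8] at h2
      exact ⟨c + j * δ, by omega, by omega, hmul j c le_rfl (by omega), Or.inl (by omega)⟩
    · push_cast at h2
      have h7 : (0 : ℤ) ≤ j * δ := by positivity
      have h8 : (2 * j + 1 : ℤ) * δ = 2 * (j * δ) + δ := by ring
      have h9 : ((j + 1 : ℕ) : ℤ) * δ = j * δ + δ := by push_cast; ring
      rw [h8] at h2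
      have h10 := hmul (j + 1) c le_rfl
      rw [h9] at h10
      exact ⟨c + (j * δ + δ), by omega, by omega, h10 (by omega), Or.inr ⟨by omega, by omega⟩⟩
  · exact Or.inl ⟨_, by omega, by omega, h6⟩

end MarkedPair

end Meander

/-! ### Arrows, and the sign of the reflection difference at sources, sinks and crossings -/

section Meander

open Relation

namespace MarkedPair

variable (E : MarkedPair)

/-- The arrows `x → y` for the roots `ε_x - ε_y` given by the modified involutions. -/
def Arrow (x y : ℤ) : Prop := (x < y ∧ E.σ .above x = y) ∨ (y < x ∧ E.σ .below x = y)

theorem arrow_comm {x y : ℤ} :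
    E.Arrow x y ↔ (x < y ∧ E.σ .above y = x) ∨ (y < x ∧ E.σ .below y = x) := by
  constructor
  · rintro (⟨h, rfl⟩ | ⟨h, rfl⟩)
    · exact Or.inl ⟨h, E.σ_σ _ _⟩
    · exact Or.inr ⟨h, E.σ_σ _ _⟩
  · rintro (⟨h, rfl⟩ | ⟨h, rfl⟩)
    · exact Or.inl ⟨h, E.σ_σ _ _⟩
    · exact Or.inr ⟨h, E.σ_σ _ _⟩

theorem swap_arrow {x y : ℤ} : E.swap.Arrow x y ↔ E.Arrow y x := by
  rw [E.arrow_comm]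
  exact or_comm

theorem exists_out_iff {x : ℤ} : (∃ y, E.Arrow x y) ↔ x < E.σ .above x ∨ E.σ .below x < x := by
  constructor
  · rintro ⟨y, ⟨h, rfl⟩ | ⟨h, rfl⟩⟩
    exacts [Or.inl h, Or.inr h]
  · rintro (h | h)
    exacts [⟨_, Or.inl ⟨h, rfl⟩⟩, ⟨_, Or.inr ⟨h, rfl⟩⟩]

theorem no_out_iff {x : ℤ} : (∀ y, ¬ E.Arrow x y) ↔ E.σ .above x ≤ x ∧ x ≤ E.σ .below x := by
  rw [← not_exists, exists_out_iff]
  omega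

theorem no_in_iff {x : ℤ} : (∀ y, ¬ E.Arrow y x) ↔ x ≤ E.σ .above x ∧ E.σ .below x ≤ x := by
  have h := E.swap.no_out_iff (x := x)
  simp only [swap_arrow] at h
  rw [h, and_comm]
  rfl

/-- If `D ≥ 0`, antidiagonality squeezes both sums to `2 * x`. Then `x` is a common centre that
neither involution fixes, and the half-integer `x` is marked on both sides. -/
theorem diff_neg_of_full_source {x : ℤ} (h1 : x < E.σ .above x) (h2 : E.σ .below x < x) :
    E.diff x < 0 := by
  have h3 := E.σ_antidiag _ _ h1
  have h4 := E.σ_antidiag .below (E.σ .below x) (by rwa [E.σ_σ])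
  rw [E.σ_σ, E.sum_σ] at h4
  rw [IntervalPair.diff]
  by_contra! h
  have h5 := E.mark_of_gt .above x (x - 1) (by omega) (by omega)
  have h6 := E.mark_symm _ _ h5
  have h7 := E.mark_of_lt .below x x le_rfl (by omega)
  have h8 := E.sum_succ (E.lt_of_mark _ _ h5)
  rw [show x - 1 + 1 = x by omega] at h8
  rw [show E.sum .above (x - 1) - 1 - (x - 1) = x by omega] at h6
  exact E.mark_not_both h6 h7

theorem diff_pos_of_full_sink {x : ℤ} (h1 : E.σ .above x < x) (h2 : x < E.σ .below x) :
    0 < E.diff x := by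
  have := E.swap.diff_neg_of_full_source (x := x) h2 h1
  rw [swap_diff] at this
  omega

/-- If `D > 0`, the fixed point lies right of the centre above, and all half-integers between `x`
and its mirror image are marked above. The lower arc from `x - 1` leads to one of them, so by
uniqueness it must be an end (unless `x` is the lower centre and `x - 1` is marked twice). The end
rule then makes the two sums equal. -/
theorem diff_nonpos_of_fixed_above {x : ℤ} (h1 : E.σ .above x = x) (h2 : E.σ .below x < x) :
    E.diff x ≤ 0 := by
  have h4 := E.σ_antidiag .below (E.σ .below x) (by rwa [E.σ_σ])
  rw [E.σ_σ, E.sum_σ] at h4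
  rw [IntervalPair.diff]
  by_contra! h
  have hm : ∀ i, E.sum .above x - x ≤ i → i < x → E.M .above i := fun i hi hi' =>
    E.mark_of_gt .above x i (by omega) hi'
  have h5 := hm (x - 1) (by omega) (by omega)
  have h6 := E.sum_succ (E.lt_of_mark _ _ h5)
  have h7 := E.lo_le_σ .below x
  have h7' := E.le_hi .below x
  have h8 : E.sum .below (x - 1) = E.sum .below x := E.sum_eq (by omega) (by omega)
  have h9 : E.hi .below (x - 1) = E.hi .below x := E.hi_eq _ _ _ (by omega) (by omega)
  rw [show x - 1 + 1 = x by omega] at h6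
  by_cases hQ : E.sum .below x = 2 * x
  · have h10 := E.mark_symm _ _ (E.mark_of_lt .below x x le_rfl (by omega))
    rw [show E.sum .below x - 1 - x = x - 1 by omega] at h10
    exact E.mark_not_both h5 h10
  · have h10 := E.rel_swap .below (x - 1) (by omega)
    rw [h8] at h10
    have h11 := E.mark_unique _ _ _ _ h5 (hm _ (by omega) (by omega)) h10
    have h12 : E.sum .below x = 2 * x - 1 := by omega
    have h13 := E.mark_end _ .below _ _ h5 (E.rel_equiv.refl _) (by omega)
    omega

theorem diff_nonpos_of_fixed_below {x : ℤ} (h1 : E.σ .below x = x) (h2 : x < E.σ .above x) :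
    E.diff x ≤ 0 := by
  have h := E.reflect.swap.diff_nonpos_of_fixed_above (x := -x)
    (by simp [swap, reflect, Side.swap, h1]) (by simp [swap, reflect, Side.swap, h2])
  rw [swap_diff, reflect_diff] at h
  simpa using h

theorem diff_nonpos_of_source {x : ℤ} (h1 : ∀ y, ¬ E.Arrow y x) (h2 : ∃ y, E.Arrow x y) :
    E.diff x ≤ 0 := by
  rw [no_in_iff] at h1
  rw [exists_out_iff] at h2
  rcases h1.1.lt_or_eq with h3 | h3 <;> rcases h1.2.lt_or_eq with h4 | h4
  · exact (E.diff_neg_of_full_source h3 h4).le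
  · exact E.diff_nonpos_of_fixed_below h4 h3
  · exact E.diff_nonpos_of_fixed_above h3.symm h4
  · omega

theorem diff_nonneg_of_sink {x : ℤ} (h1 : ∀ y, ¬ E.Arrow x y) (h2 : ∃ y, E.Arrow y x) :
    0 ≤ E.diff x := by
  have := E.swap.diff_nonpos_of_source (x := x) (by simpa only [swap_arrow]) (by simpa only [swap_arrow])
  rw [swap_diff] at this
  omega

/-- A fixed point marks everything between itself and its mirror image. Wherever the two centres lie
relative to `x` and `y`, one of the half-integers `x`, `y - 1` is marked on both sides. -/
theorem isolated_aux {x y : ℤ} (hxy : x < y) (hc : ∀ s, E.lo s x = E.lo s y)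
    (hx : ∀ s, E.σ s x = x) (hy : ∀ s, E.σ s y = y) (hD : 0 ≤ E.diff x) : False := by
  have hP := E.sum_eq_of_lo_eq (hc .above)
  have hQ := E.sum_eq_of_lo_eq (hc .below)
  rw [IntervalPair.diff] at hD
  have h1 := E.mark_of_lt .above x x le_rfl
  have h2 := E.mark_of_lt .below x x le_rfl
  have h3 := E.mark_of_gt .above y (y - 1)
  have h4 := E.mark_of_gt .below y (y - 1)
  have h5 := E.mark_of_gt .above y x
  rw [hx] at h1 h2
  rw [hy] at h3 h4 h5
  by_cases hA : 2 * x < E.sum .above x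
  · exact E.mark_not_both (h1 (by omega)) (h2 (by omega))
  by_cases hB : E.sum .below x < 2 * y
  · exact E.mark_not_both (h3 (by omega) (by omega)) (h4 (by omega) (by omega))
  · exact E.mark_not_both (h5 (by omega) (by omega)) (h2 (by omega))

theorem isolated_unique {x y : ℤ} (hc : ∀ s, E.lo s x = E.lo s y)
    (hx : ∀ s, E.σ s x = x) (hy : ∀ s, E.σ s y = y) : x = y := by
  have key : ∀ x y, x < y → (∀ s, E.lo s x = E.lo s y) → (∀ s, E.σ s x = x) →
      (∀ s, E.σ s y = y) → False := by
    intro x y hxy hc hx hy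
    rcases le_total 0 (E.diff x) with h | h
    · exact E.isolated_aux hxy hc hx hy h
    · exact E.swap.isolated_aux hxy (fun s => hc _) (fun s => hx _) (fun s => hy _)
        (by rw [swap_diff]; omega)
  rcases lt_trichotomy x y with h | h | h
  · exact (key x y h hc hx hy).elim
  · exact h
  · exact (key y x h (fun s => (hc s).symm) hy hx).elim

/-- If `D v < 0`, the half-integers from `u` up to the upper mirror image of `v` are marked above,
and they reach into the lower interval of `v`. The lower arcs join them to one another or to an end,
against the marking rule. -/
theorem diff_nonneg_of_cross {u v : ℤ} (huv : u < v) (hσ : E.σ .above u = v)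
    (hlo : E.lo .below u ≠ E.lo .below v) : 0 ≤ E.diff v := by
  by_contra! hneg
  have h1 := E.σ_antidiag .above u (by omega)
  have hP : E.sum .above v = E.sum .above u := by rw [← hσ, E.sum_σ]
  have h2 := E.hi_lt_lo huv hlo
  have h3 := E.le_hi .below u
  have h4 := E.lo_le .below v
  have h5 := E.le_hi .below v
  have hQ : E.sum .below v = E.lo .below v + E.hi .below v := rfl
  rw [IntervalPair.diff, hP] at hneg
  have hb : ∀ i, u ≤ i → i ≤ v → E.sum .above i = E.sum .above u := fun i hi1 hi2 => by
    have h6 := E.lo_le .above u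
    have h7 := E.σ_le_hi .above u
    exact E.sum_eq (by omega) (by omega)
  have hm : ∀ i, u ≤ i → i < E.sum .above u - v → E.M .above i := fun i hi1 hi2 =>
    E.mark_of_lt .above u i hi1 (by omega)
  have hbl : ∀ i, E.lo .below v ≤ i → i < E.hi .below v →
      E.rel i (E.sum .below v - 1 - i) := fun i hi1 hi2 => by
    have h6 := E.rel_swap .below i (by rwa [E.hi_eq .below v i hi1 hi2.le])
    rwa [E.sum_eq (s := .below) (x := v) hi1 hi2.le] at h6
  have hend : ∀ i, u ≤ i → i < E.sum .above u - v → ∀ e, E.rel i e →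
      E.lo .below v ≤ e → e ≤ E.hi .below v → 2 * e = E.sum .below v - 1 →
      2 * i = E.sum .above i - 1 := fun i hi1 hi2 e he1 he2 he3 he =>
    E.mark_end _ .below _ e (hm i hi1 hi2) he1 (by rwa [E.sum_eq (s := .below) (x := v) he2 he3])
  -- If `v` is not the right end of its lower interval, the single lower arc through the
  -- half-integer `v` gives the contradiction. Otherwise the lower interval and the upper reflection
  -- form the configuration of `spiral`.
  rcases h5.lt_or_eq with hvd | hvd
  · have h6 := E.mark_symm _ _ (hm (E.sum .above u - v - 1) (by omega) (by omega))
    rw [hb _ (by omega) (by omega)] at h6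
    rw [show E.sum .above u - 1 - (E.sum .above u - v - 1) = v by omega] at h6
    have h7 := hbl v h4 hvd
    have h8 := E.mark_unique _ _ _ _ h6 (hm _ (by omega) (by omega)) h7
    have h9 : E.sum .below v - 1 - v = v := by omega
    have h10 := hend (E.sum .above u - v - 1) (by omega) (by omega) v (by
      have := E.rel_swap .above v (E.lt_of_mark _ _ h6)
      rw [hP, show E.sum .above u - 1 - v = E.sum .above u - v - 1 by omega] at this
      exact E.rel_equiv.symm this) h4 h5 (by omega)
    rw [hb _ (by omega) (by omega)] at h10
    omega
  · have hc := hm (E.lo .below v) (by omega) (by omega)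
    have hsc := hb (E.lo .below v) (by omega) (by omega)
    rcases spiral E.rel_equiv (c := E.lo .below v) (d := E.hi .below v)
      (δ := E.sum .above u - E.sum .below v) (by omega) (by omega)
      (fun i hi1 hi2 => by have := hbl i hi1 hi2; rwa [hQ] at this)
      (fun i hi1 hi2 => by
        have h6 := E.rel_swap .above i (by
          have h7 := E.σ_le_hi .above u
          have h8 := E.lo_le .above u
          rw [E.hi_eq .above u i (by omega) (by omega)]
          omega)
        rw [hb i (by omega) (by omega)] at h6
        rwa [show E.lo .below v + E.hi .below v + (E.sum .above u - E.sum .below v) - 1 - i =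
          E.sum .above u - 1 - i by omega]) with ⟨i, hi1, hi2, hi⟩ | ⟨e, he1, he2, he, hee⟩
    · have h6 := E.mark_unique _ _ _ _ hc (hm i (by omega) (by omega)) hi
      omega
    · rcases hee with hee | ⟨hee1, hee2⟩
      · have := hend _ (by omega) (by omega) e he (by omega) (by omega) (by omega)
        omega
      · have := E.mark_end _ .above _ e hc he (by rw [hb e (by omega) (by omega)]; omega)
        omega

/-- Reflecting the line gives the bound at `u`. Strictness holds because the upper sums agree while
the lower interval of `v` lies to the right of that of `u`. -/
theorem cross_above {u v : ℤ} (huv : u < v) (hσ : E.σ .above u = v)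
    (hlo : E.lo .below u ≠ E.lo .below v) :
    E.diff u ≤ 0 ∧ 0 ≤ E.diff v ∧ E.diff u < E.diff v := by
  refine ⟨?_, E.diff_nonneg_of_cross huv hσ hlo, ?_⟩
  · have h := E.reflect.diff_nonneg_of_cross (u := -v) (v := -u) (by omega)
      (by simp [reflect, ← hσ, E.σ_σ]) (by
        simp only [reflect, neg_neg, ne_eq, neg_inj]
        have h1 := E.hi_lt_lo huv hlo
        have h2 := E.lo_le .below v
        have h3 := E.le_hi .below v
        omega)
    rw [reflect_diff, neg_neg] at h
    omega
  · have h1 := E.sum_lt huv hlo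
    have h2 := E.sum_σ .above u
    rw [hσ] at h2
    simp only [IntervalPair.diff]
    omega

theorem cell_or {u v : ℤ} (h : E.Arrow u v) :
    E.cell u = E.cell v ∨ (E.diff u ≤ 0 ∧ 0 ≤ E.diff v ∧ E.diff u < E.diff v) := by
  rw [E.cell_eq_iff]
  rcases h with ⟨h, hσ⟩ | ⟨h, hσ⟩
  · have h1 := E.lo_σ .above u
    rw [hσ] at h1
    by_cases hlo : E.lo .below u = E.lo .below v
    · exact Or.inl fun s => by cases s; exacts [h1.symm, hlo]
    · exact Or.inr (E.cross_above h hσ hlo)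
  · have h1 := E.lo_σ .below u
    rw [hσ] at h1
    by_cases hlo : E.lo .above u = E.lo .above v
    · exact Or.inl fun s => by cases s; exacts [hlo, h1.symm]
    · have h2 := E.swap.cross_above (u := v) (v := u) h (by
        rw [← hσ]; exact E.σ_σ _ _) (Ne.symm hlo)
      rw [swap_diff, swap_diff] at h2
      exact Or.inr (by omega)

/-- Suppose not, and let `c` be the upper mirror image of `σ⁺ x`. Then the half-integers from `c` to
`x` are marked above and those from `x` to the lower mirror image of `σ⁻ x` are marked below.
Together they fill the first `Q - P` places after `c`, and `spiral` finds two of them, or one of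
them and an end, on one meander. This inequality is what rules out cycles with `D > 0`. -/
theorem σ_above_lt_σ_below {x : ℤ} (h1 : x < E.σ .above x) (h2 : x < E.σ .below x)
    (hc : E.lo .below (E.σ .above x) = E.lo .below x) (hD : 0 < E.diff x) :
    E.σ .above x < E.σ .below x := by
  by_contra! hle
  rw [IntervalPair.diff] at hD
  have ha := E.σ_antidiag _ _ h1
  have hb := E.σ_antidiag _ _ h2
  have hux : E.sum .above x - E.σ .above x ≤ x := by
    by_contra! h
    exact E.mark_not_both (E.mark_of_lt .above x x le_rfl h)
      (E.mark_of_lt .below x x le_rfl (by omega))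
  have hxw : x ≤ E.sum .below x - E.σ .below x := by
    by_contra! h
    exact E.mark_not_both (E.mark_of_gt .above x (x - 1) (by omega) (by omega))
      (E.mark_of_gt .below x (x - 1) (by omega) (by omega))
  have hPd : E.sum .above x = E.lo .above x + E.hi .above x := rfl
  have hQd : E.sum .below x = E.lo .below x + E.hi .below x := rfl
  have hal := E.lo_le .above x
  have hat := E.σ_le_hi .above x
  have hbl := E.lo_le .below x
  have hbt : E.σ .above x ≤ E.hi .below x := by
    rw [← E.hi_eq_of_lo_eq hc]; exact E.le_hi _ _
  have hm1 : ∀ i, E.sum .above x - E.σ .above x ≤ i → i < x → E.M .above i := fun i =>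
    E.mark_of_gt .above x i
  have hm2 : ∀ i, x ≤ i → i < E.sum .below x - E.σ .below x → E.M .below i := fun i =>
    E.mark_of_lt .below x i
  have hsa : ∀ i, E.sum .above x - E.σ .above x ≤ i → i ≤ E.σ .above x →
      E.sum .above i = E.sum .above x ∧ E.hi .above i = E.hi .above x := fun i hi1 hi2 =>
    ⟨E.sum_eq (by omega) (by omega), E.hi_eq _ _ _ (by omega) (by omega)⟩
  have hsb : ∀ i, E.sum .below x - E.σ .above x ≤ i → i ≤ E.σ .above x →
      E.sum .below i = E.sum .below x ∧ E.hi .below i = E.hi .below x := fun i hi1 hi2 =>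
    ⟨E.sum_eq (by omega) (by omega), E.hi_eq _ _ _ (by omega) (by omega)⟩
  rcases spiral E.rel_equiv (c := E.sum .above x - E.σ .above x) (d := E.σ .above x)
    (δ := E.sum .below x - E.sum .above x) (by omega) (by omega)
    (fun i hi1 hi2 => by
      obtain ⟨h3, h4⟩ := hsa i hi1 hi2.le
      have := E.rel_swap .above i (by omega)
      rwa [h3, ← sub_add_cancel (E.sum .above x) (E.σ .above x)] at this)
    (fun i hi1 hi2 => by
      obtain ⟨h3, h4⟩ := hsb i (by omega) hi2.le
      have := E.rel_swap .below i (by omega)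
      rw [h3] at this
      convert this using 1
      omega) with ⟨i, hi1, hi2, hi⟩ | ⟨e, he1, he2, he, hee⟩
  · rcases hux.lt_or_eq with hu | hu
    · have hM := hm1 _ le_rfl hu
      have hs := (hsa _ le_rfl (by omega)).1
      by_cases hix : i < x
      · have := E.mark_unique _ _ _ _ hM (hm1 i (by omega) hix) hi
        omega
      · have := E.mark_unique _ _ _ _ hM (hm2 i (by omega) (by omega)) hi
        exact absurd this.1 (by simp)
    · rw [hu] at hi
      have := E.mark_unique _ _ _ _ (hm2 x le_rfl (by omega)) (hm2 i (by omega) (by omega)) hi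
      omega
  · have hend : ∃ t, 2 * e = E.sum t e - 1 := by
      rcases hee with hee | hee
      · exact ⟨.above, by rw [(hsa e (by omega) (by omega)).1]; omega⟩
      · exact ⟨.below, by rw [(hsb e (by omega) (by omega)).1]; omega⟩
    obtain ⟨t, ht⟩ := hend
    rcases hux.lt_or_eq with hu | hu
    · have hM := hm1 _ le_rfl hu
      have hs := (hsa _ le_rfl (by omega)).1
      have := E.mark_end _ t _ e hM he ht
      omega
    · rw [hu] at he
      have := E.mark_end _ t _ e (hm2 x le_rfl (by omega)) he ht
      omega

end MarkedPair

end Meander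

section Meander

open Relation

/-! ### Cells where the two reflections agree -/

namespace IsAntiToeplitz

variable {σ : ℤ → ℤ} {P p q : ℤ}

theorem reflect_mem {x : ℤ} (hx : x ∈ runSet P p q) : P - x ∈ runSet P p q := by
  simp only [runSet, Set.mem_ofPred_eq] at hx ⊢
  omega

theorem iterate_mem (h : IsAntiToeplitz σ P p q) {x : ℤ} (hx : x ∈ runSet P p q) (k : ℕ) :
    (fun z => P - σ z)^[k] x ∈ runSet P p q := by
  induction k with
  | zero => exact hx
  | succ k ih =>
    rw [Function.iterate_succ_apply']
    exact reflect_mem (h.stable _ ih)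

theorem exists_iterate (h : IsAntiToeplitz σ P p q) (hc : P ≤ 2 * q + 2) {x y : ℤ}
    (hx : x ∈ runSet P p q) (hy : y ∈ runSet P p q) :
    ∃ k : ℕ, (fun z => P - σ z)^[k + 1] x = y := by
  refine h.cyclic hc {y | ∃ k : ℕ, (fun z => P - σ z)^[k + 1] x = y} ?_ ⟨_, 0, rfl⟩ ?_ hy
  · rintro _ ⟨k, rfl⟩
    exact h.iterate_mem hx _
  · rintro _ ⟨k, rfl⟩
    exact ⟨k + 1, by rw [Function.iterate_succ_apply']⟩

/-- The dihedral relation: `σ` conjugates the product of the two involutions to its inverse. -/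
theorem iterate_σ_iterate (hσ : ∀ x, σ (σ x) = x) (x : ℤ) (k : ℕ) :
    (fun z => P - σ z)^[k] (σ ((fun z => P - σ z)^[k] x)) = σ x := by
  induction k with
  | zero => rfl
  | succ k ih =>
    rw [Function.iterate_succ_apply, Function.iterate_succ_apply', hσ]
    simpa using ih

/-- By the dihedral relation `2 * k` steps along the cycle lead from `x` back to `x`, and `k` is
less than the period: two fixed points of `σ` are opposite on the cycle. -/
theorem fixed_eq_iterate (h : IsAntiToeplitz σ P p q) (hσ : ∀ x, σ (σ x) = x)
    (hc : P ≤ 2 * q + 2) {x y : ℤ} (hx : x ∈ runSet P p q) (hy : y ∈ runSet P p q)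
    (hxσ : σ x = x) (hyσ : σ y = y) (hne : x ≠ y) :
    ∃ k : ℕ, (fun z => P - σ z)^[k] x = y ∧
      2 * k = Function.minimalPeriod (fun z => P - σ z) x := by
  obtain ⟨k, hk⟩ := h.exists_iterate hc hx hy
  obtain ⟨l, hl⟩ := h.exists_iterate hc hx hx
  have hm : 0 < Function.minimalPeriod (fun z => P - σ z) x :=
    Function.IsPeriodicPt.minimalPeriod_pos (Nat.succ_pos l) hl
  rw [← Function.iterate_mod_minimalPeriod_eq] at hk
  have hlt := Nat.mod_lt (k + 1) hm
  generalize (k + 1) % Function.minimalPeriod (fun z => P - σ z) x = j at hk hlt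
  refine ⟨j, hk, ?_⟩
  have h1 := iterate_σ_iterate (P := P) hσ x j
  rw [hk, hyσ, ← hk, ← Function.iterate_add_apply, hxσ] at h1
  obtain ⟨a, ha⟩ := Function.IsPeriodicPt.minimalPeriod_dvd (f := fun z => P - σ z) h1
  have hj : j ≠ 0 := by
    rintro rfl
    exact hne hk
  have : a = 1 := by
    rcases a with _ | _ | a
    · omega
    · rfl
    · nlinarith
  subst this
  omega

/-- Both `y` and `z` are opposite to `x` on the cycle. -/
theorem fixed_three (h : IsAntiToeplitz σ P p q) (hσ : ∀ x, σ (σ x) = x)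
    (hc : P ≤ 2 * q + 2) {x y z : ℤ} (hx : x ∈ runSet P p q) (hy : y ∈ runSet P p q)
    (hz : z ∈ runSet P p q) (hxσ : σ x = x) (hyσ : σ y = y) (hzσ : σ z = z) (hxy : x ≠ y)
    (hxz : x ≠ z) : y = z := by
  obtain ⟨k, hk, hk'⟩ := h.fixed_eq_iterate hσ hc hx hy hxσ hyσ hxy
  obtain ⟨l, hl, hl'⟩ := h.fixed_eq_iterate hσ hc hx hz hxσ hzσ hxz
  obtain rfl : k = l := by omega
  exact hk.symm.trans hl

/-- A parity argument: two fixed points of `σ` make the period even, whereas one fixed point of `σ`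
together with the centre, fixed by the reflection, returns `x` to itself after an odd number of
steps. -/
theorem fixed_two (h : IsAntiToeplitz σ P p q) (hσ : ∀ x, σ (σ x) = x)
    (hc : P ≤ 2 * q + 2) {x y e : ℤ} (hx : x ∈ runSet P p q) (hy : y ∈ runSet P p q)
    (he : e ∈ runSet P p q) (hxσ : σ x = x) (hyσ : σ y = y) (heP : 2 * e = P) : x = y := by
  by_contra hne
  obtain ⟨k, -, hk⟩ := h.fixed_eq_iterate hσ hc hx hy hxσ hyσ hne
  obtain ⟨j, hj⟩ := h.exists_iterate hc hx he
  have h1 := iterate_σ_iterate (P := P) hσ x (j + 1)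
  rw [hj, hxσ] at h1
  have h2 : P - σ x = (fun z => P - σ z)^[j + 1] e := by
    have h3 : (fun z => P - σ z) (σ e) = e := by
      simp only [hσ]
      omega
    conv_rhs => rw [← h3, ← Function.iterate_succ_apply, Function.iterate_succ_apply', h1]
  rw [← hj, ← Function.iterate_add_apply] at h2
  obtain ⟨l, hl⟩ : ∃ l, 2 * k = l + 1 := by
    obtain ⟨l, hl⟩ := h.exists_iterate hc hx hx
    have hm : 0 < Function.minimalPeriod (fun z => P - σ z) x :=
      Function.IsPeriodicPt.minimalPeriod_pos (Nat.succ_pos l) hl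
    exact ⟨2 * k - 1, by omega⟩
  have h4 : (fun z => P - σ z)^[l + (j + 1 + (j + 1))] x = x := by
    rw [Function.iterate_add_apply, ← h2]
    have := Function.iterate_minimalPeriod (f := fun z => P - σ z) (x := x)
    rw [← hk, hl, Function.iterate_succ_apply] at this
    exact this
  obtain ⟨a, ha⟩ := Function.IsPeriodicPt.minimalPeriod_dvd (f := fun z => P - σ z) h4
  rw [← hk] at ha
  have : 2 * k * a = 2 * (k * a) := by ring
  omega

end IsAntiToeplitz

namespace MarkedPair

variable (E : MarkedPair)

theorem mark_side {s t : Side} {i : ℤ} (h1 : E.M s i) (h2 : E.M t i) : s = t :=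
  (E.mark_unique _ _ _ _ h1 h2 (E.rel_equiv.refl i)).1

theorem σ_eq_of_unmarked {s : Side} {x : ℤ} (h1 : ¬ E.M s x) (h2 : ¬ E.M s (x - 1)) :
    E.σ s x = E.sum s x - x := by
  by_contra h
  rcases lt_or_gt_of_ne h with h | h
  · exact h1 (E.mark_of_lt s x x le_rfl (by omega))
  · exact h2 (E.mark_of_gt s x (x - 1) (by omega) (by omega))

theorem mark_pred_of_center {s : Side} {x : ℤ} (hx : 2 * x = E.sum s x) :
    E.M s x ↔ E.M s (x - 1) := by
  constructor <;> intro h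
  · have := E.mark_symm s x h
    rwa [show E.sum s x - 1 - x = x - 1 by omega] at this
  · have h1 := E.mark_symm s _ h
    have h2 := E.sum_succ (E.lt_of_mark _ _ h)
    rw [show x - 1 + 1 = x by omega] at h2
    rwa [← h2, show E.sum s x - 1 - (x - 1) = x by omega] at h1

theorem σ_lt_of_lt {s : Side} {x : ℤ} (h : E.σ s x < x) :
    2 * E.σ s x ≤ E.sum s x ∧ E.sum s x ≤ 2 * x := by
  have := E.σ_antidiag s (E.σ s x) (by rwa [E.σ_σ])
  rwa [E.σ_σ, E.sum_σ] at this

/-- Inside the two concentric intervals every half-integer is marked, and on one side only. Take the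
run containing the point of `K`, up to reflection, that is nearest to the centre on the left. On the
unmarked side the involution is the reflection inside the run, so `K` is symmetric there; then the
part of `K` in the run is stable under both the marked involution and the reflection, and
transitivity spreads it over the whole run, beyond the nearest point. -/
theorem no_closed_of_diff_zero {K : Set ℤ} {x₀ : ℤ} (hx₀ : x₀ ∈ K)
    (hcell : ∀ x ∈ K, ∀ s, E.lo s x = E.lo s x₀) (hσ : ∀ x ∈ K, ∀ s, E.σ s x ∈ K)
    (hLR : ∀ x ∈ K, (∀ s, x < E.σ s x) ∨ ∀ s, E.σ s x < x) (hD : E.diff x₀ = 0) : False := by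
  obtain ⟨P, hP⟩ : ∃ P, ∀ s, E.sum s x₀ = P := by
    refine ⟨E.sum .above x₀, fun s => ?_⟩
    rw [IntervalPair.diff] at hD
    cases s <;> omega
  have hPd : ∀ s, E.lo s x₀ + E.hi s x₀ = P := hP
  have hblock : ∀ x ∈ K, ∀ s, E.lo s x₀ ≤ x ∧ x ≤ E.hi s x₀ := fun x hx s => by
    rw [← hcell x hx s, ← E.hi_eq_of_lo_eq (hcell x hx s)]
    exact ⟨E.lo_le _ _, E.le_hi _ _⟩
  have hsum : ∀ x s, E.lo s x₀ ≤ x → x ≤ E.hi s x₀ → E.sum s x = P := fun x s h1 h2 => by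
    rw [← hP s]; exact E.sum_eq h1 h2
  have hsumK : ∀ x ∈ K, ∀ s, E.sum s x = P := fun x hx s =>
    hsum x s (hblock x hx s).1 (hblock x hx s).2
  have hlt : ∀ s, E.lo s x₀ < E.hi s x₀ := fun s => by
    have h1 := E.lo_le_σ s x₀
    have h2 := E.σ_le_hi s x₀
    have h3 := hblock x₀ hx₀ s
    rcases hLR x₀ hx₀ with h | h
    · have := h s; omega
    · have := h s; omega
  have hmark : ∀ i, (∀ s, E.lo s x₀ ≤ i ∧ i < E.hi s x₀) → ∃ s, E.M s i := fun i hi => by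
    refine E.exists_mark i (fun s => ?_) ?_
    · rw [E.hi_eq s x₀ i (hi s).1 (hi s).2.le]
      exact (hi s).2
    · rw [hsum i _ (hi _).1 (hi _).2.le, hsum i _ (hi _).1 (hi _).2.le]
  have hcenter : ∀ x ∈ K, 2 * x ≠ P := by
    intro x hx h2x
    obtain ⟨s, hs⟩ := hmark x fun s => by
      have := hlt s
      have := hPd s
      omega
    have hs' : ¬ E.M s.swap x := fun h => by
      have := E.mark_side hs h
      cases s <;> simp [Side.swap] at this
    have h1 := E.σ_eq_of_unmarked hs' fun h =>
      hs' ((E.mark_pred_of_center (by rw [hsumK x hx]; exact h2x)).2 h)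
    rw [hsumK x hx] at h1
    rcases hLR x hx with h | h <;> have := h s.swap <;> omega
  have hL : ∀ x ∈ K, (∀ s, x < E.σ s x) → 2 * x < P := fun x hx h => by
    have h1 := (E.σ_antidiag .above x (h _)).1
    rw [hsumK x hx] at h1
    have := hcenter x hx
    omega
  have hR : ∀ x ∈ K, (∀ s, E.σ s x < x) → P < 2 * x := fun x hx h => by
    have h1 := (E.σ_lt_of_lt (h .above)).2
    rw [hsumK x hx] at h1
    have := hcenter x hx
    omega
  have hLK : ∀ x ∈ K, 2 * x < P → ∀ s, x < E.σ s x := fun x hx h =>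
    (hLR x hx).resolve_right fun h' => by have := hR x hx h'; omega
  have hRK : ∀ x ∈ K, P < 2 * x → ∀ s, E.σ s x < x := fun x hx h =>
    (hLR x hx).resolve_left fun h' => by have := hL x hx h'; omega
  have hLσ : ∀ x ∈ K, 2 * x < P → ∀ s, P < 2 * E.σ s x := fun x hx h s => by
    refine hR _ (hσ x hx s) ((hLR _ (hσ x hx s)).resolve_left fun h' => ?_)
    have h1 := h' s
    have h2 := hLK x hx h s
    rw [E.σ_σ] at h1
    omega
  have hRσ : ∀ x ∈ K, P < 2 * x → ∀ s, 2 * E.σ s x < P := fun x hx h s => by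
    refine hL _ (hσ x hx s) ((hLR _ (hσ x hx s)).resolve_right fun h' => ?_)
    have h1 := h' s
    have h2 := hRK x hx h s
    rw [E.σ_σ] at h1
    omega
  have hfin : {x : ℤ | 2 * x < P ∧ (x ∈ K ∨ P - x ∈ K)}.Finite := by
    refine (Set.finite_Icc (E.lo .above x₀) (E.hi .above x₀)).subset ?_
    rintro x ⟨-, hx | hx⟩
    · exact hblock x hx _
    · have h1 := hblock _ hx .above
      have h2 := hPd .above
      exact ⟨by omega, by omega⟩
  obtain ⟨t, ⟨ht1, ht2⟩, hmax⟩ : ∃ t, (2 * t < P ∧ (t ∈ K ∨ P - t ∈ K)) ∧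
      ∀ x, (2 * x < P ∧ (x ∈ K ∨ P - x ∈ K)) → x ≤ t := by
    refine Set.exists_max_image _ id hfin ?_
    rcases hLR x₀ hx₀ with h | h
    · exact ⟨x₀, hL _ hx₀ h, Or.inl hx₀⟩
    · exact ⟨P - x₀, by have := hR _ hx₀ h; omega, Or.inr (by simpa using hx₀)⟩
  have htb : ∀ s, E.lo s x₀ ≤ t ∧ t < E.hi s x₀ := fun s => by
    have h2 := hPd s
    have h3 := hlt s
    rcases ht2 with h | h
    · have := hblock _ h s
      omega
    · have := hblock _ h s
      omega
  obtain ⟨s, hs⟩ := hmark t htb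
  have hts : E.sum s t = P := hsum t s (htb s).1 (htb s).2.le
  obtain ⟨p, q, hp0, hpt, htq, hqP, hM, -, hT⟩ := E.exists_run s t hs (by omega)
  rw [hts] at hqP hT
  -- For `p < x ≤ q` both neighbouring half-integers are marked on the side `s`, hence unmarked on
  -- the other. Only the outer point `p` escapes.
  have hunm : ∀ x, p < x → x ≤ q → (∀ s, E.lo s x₀ ≤ x ∧ x ≤ E.hi s x₀) →
      E.σ s.swap x = P - x := by
    intro x hx1 hx2 hxb
    have hne : s ≠ s.swap := by cases s <;> simp [Side.swap]
    have h1 := E.σ_eq_of_unmarked (fun h => hne (E.mark_side (hM x hx1.le hx2) h))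
      (fun h => hne (E.mark_side (hM (x - 1) (by omega) (by omega)) h))
    rwa [hsum x _ (hxb _).1 (hxb _).2] at h1
  set X : Set ℤ := {x | p ≤ x ∧ 2 * x < P ∧ x ∈ K} with hX
  set Y : Set ℤ := {x | p ≤ x ∧ 2 * x < P ∧ P - x ∈ K} with hY
  have hXt : ∀ x ∈ X, x ≤ t := fun x hx => hmax x ⟨hx.2.1, Or.inl hx.2.2⟩
  have hYt : ∀ x ∈ Y, x ≤ t := fun x hx => hmax x ⟨hx.2.1, Or.inr hx.2.2⟩
  have hXr : ∀ x, p ≤ x → x ≤ t → x ∈ runSet P p q := fun x h1 h2 => by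
    simp only [runSet, Set.mem_ofPred_eq]
    omega
  have hXY : ∀ x, x ≠ p → (x ∈ X ↔ x ∈ Y) := by
    intro x hxp
    constructor
    · rintro hx
      have h1 := hunm x (lt_of_le_of_ne hx.1 hxp.symm) (by have := hXt x hx; omega)
        (hblock x hx.2.2)
      exact ⟨hx.1, hx.2.1, by rw [← h1]; exact hσ x hx.2.2 _⟩
    · rintro hx
      have h1 := hunm x (lt_of_le_of_ne hx.1 hxp.symm) (by have := hYt x hx; omega)
        (fun s => by
          have h1 := hblock _ hx.2.2 s
          have h2 := hPd s
          omega)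
      have h2 := hσ _ hx.2.2 s.swap
      rw [← h1, E.σ_σ] at h2
      exact ⟨hx.1, hx.2.1, h2⟩
  have hf : ∀ x ∈ X, P - E.σ s x ∈ Y := fun x hx => by
    have h1 := hT.stable x (hXr x hx.1 (hXt x hx))
    have h2 := hLσ x hx.2.2 hx.2.1 s
    exact ⟨by have := h1.2.1; omega, by omega, by simpa using hσ x hx.2.2 s⟩
  have hg : ∀ x ∈ Y, E.σ s (P - x) ∈ X := fun x hx => by
    have h1 := hT.stable _ (IsAntiToeplitz.reflect_mem (hXr x hx.1 (hYt x hx)))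
    have h2 := hRσ _ hx.2.2 (by have := hx.2.1; omega) s
    exact ⟨h1.1, h2, hσ _ hx.2.2 s⟩
  have hXfin : X.Finite := hfin.subset fun x hx => ⟨hx.2.1, Or.inl hx.2.2⟩
  have hYfin : Y.Finite := hfin.subset fun x hx => ⟨hx.2.1, Or.inr hx.2.2⟩
  -- The possible exception at `p` is removed by counting: `σ s` and the reflection inject `X` into
  -- `Y` and `Y` into `X`.
  have hcard : X.ncard = Y.ncard := by
    apply le_antisymm
    · refine Set.ncard_le_ncard_of_injOn (fun x => P - E.σ s x) hf ?_ hYfin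
      intro a _ b _ hab
      have h1 : E.σ s a = E.σ s b := by simpa using hab
      rw [← E.σ_σ s a, h1, E.σ_σ]
    · refine Set.ncard_le_ncard_of_injOn (fun x => E.σ s (P - x)) hg ?_ hXfin
      intro a _ b _ hab
      have h1 : P - a = P - b := by rw [← E.σ_σ s (P - a)]; simp only [hab, E.σ_σ]
      omega
  have hXYeq : X = Y := by
    by_cases hpX : p ∈ X
    · refine (Set.eq_of_subset_of_ncard_le (fun x hx => ?_) hcard.le hXfin).symm
      by_cases hxp : x = p
      · exact hxp ▸ hpX
      · exact (hXY x hxp).2 hx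
    · refine Set.eq_of_subset_of_ncard_le (fun x hx => ?_) hcard.ge hYfin
      exact (hXY x fun h => hpX (h ▸ hx)).1 hx
  have htX : t ∈ X := by
    rcases ht2 with h | h
    · exact ⟨hpt, ht1, h⟩
    · rw [hXYeq]; exact ⟨hpt, ht1, h⟩
  -- On a central run the cyclic orbit would bring the right-hand point `P - t` into `X`. Otherwise
  -- the dihedral orbit contains `q + 1`, which is nearer to the centre than `t`.
  by_cases hcen : P ≤ 2 * q + 2
  · have h1 := hT.cyclic hcen X (fun x hx => hXr x hx.1 (hXt x hx)) ⟨t, htX⟩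
      (fun x hx => by rw [hXYeq]; exact hf x hx)
      (IsAntiToeplitz.reflect_mem (hXr t hpt le_rfl))
    have := h1.2.1
    omega
  · have h1 := hT.transitive {x | x ∈ X ∨ P - x ∈ X} (fun x hx => by
        rcases hx with hx | hx
        · exact hXr x hx.1 (hXt x hx)
        · have := IsAntiToeplitz.reflect_mem (hXr _ hx.1 (hXt _ hx))
          rwa [sub_sub_cancel] at this) ⟨t, Or.inl htX⟩ (fun x hx => by
        rcases hx with hx | hx
        · right
          rw [hXYeq]
          exact hf x hx
        · left
          rw [hXYeq] at hx
          have := hg _ hx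
          rwa [sub_sub_cancel] at this) (fun x hx => by
        rcases hx with hx | hx
        · right
          rwa [sub_sub_cancel]
        · exact Or.inl hx)
      (show q + 1 ∈ runSet P p q from ⟨by omega, by omega, by omega⟩)
    rcases h1 with h1 | h1
    · have := hXt _ h1
      omega
    · have := hXt _ h1
      omega

end MarkedPair

end Meander

/-! ### Sources in cells with zero difference, acyclicity, and the arc system -/

section Meander

open Relation

namespace MarkedPair

variable (E : MarkedPair)

/-- Pigeonhole: the reflection exchanges the left and right halves of the run set, so an injection
of the left half into the right half cannot avoid `a` and `b`. -/
theorem no_crowded_right_half {σ : ℤ → ℤ} {P p q a b : ℤ} (hT : IsAntiToeplitz σ P p q)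
    (hc : P ≤ 2 * q + 2) (hinj : Function.Injective σ) (hab : a ≠ b) (ha : a ∈ runSet P p q)
    (hb : b ∈ runSet P p q) (ha' : P < 2 * a) (hb' : P < 2 * b)
    (hL : ∀ x ∈ runSet P p q, 2 * x < P → P < 2 * σ x ∧ σ x ≠ a ∧ σ x ≠ b) : False := by
  classical
  have hmem : ∀ x, x ∈ runSet P p q ↔ p ≤ x ∧ x ≤ P - p := fun x => by
    simp only [runSet, Set.mem_ofPred_eq]
    omega
  set L := (Finset.Icc p (P - p)).filter fun x => 2 * x < P with hLd
  set R := (Finset.Icc p (P - p)).filter fun x => P < 2 * x with hRd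
  have hLm : ∀ x, x ∈ L ↔ x ∈ runSet P p q ∧ 2 * x < P := fun x => by
    rw [hmem, hLd, Finset.mem_filter, Finset.mem_Icc]
  have hRm : ∀ x, x ∈ R ↔ x ∈ runSet P p q ∧ P < 2 * x := fun x => by
    rw [hmem, hRd, Finset.mem_filter, Finset.mem_Icc]
  have h1 : L.card ≤ ((R.erase a).erase b).card := by
    refine Finset.card_le_card_of_injOn σ (fun x hx => ?_) (hinj.injOn)
    obtain ⟨hx1, hx2⟩ := (hLm x).1 hx
    obtain ⟨h1, h2, h3⟩ := hL x hx1 hx2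
    simp only [Finset.coe_erase, Set.mem_sdiff, Finset.mem_coe, Set.mem_singleton_iff]
    exact ⟨⟨(hRm _).2 ⟨hT.stable x hx1, h1⟩, h2⟩, h3⟩
  have h2 : R.card ≤ L.card := by
    refine Finset.card_le_card_of_injOn (fun x => P - x) (fun x hx => ?_) fun x _ y _ h => by
      simpa using h
    obtain ⟨hx1, hx2⟩ := (hRm x).1 hx
    exact (hLm _).2 ⟨IsAntiToeplitz.reflect_mem hx1, by simp only; omega⟩
  have haR : a ∈ R := (hRm a).2 ⟨ha, ha'⟩
  have h3 := Finset.card_erase_lt_of_mem haR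
  have h4 := Finset.card_erase_lt_of_mem (Finset.mem_erase.2 ⟨hab.symm, (hRm b).2 ⟨hb, hb'⟩⟩)
  omega

/-- With the half-integer next to the centre marked above, a source off the centre is a fixed point
of `σ⁺` in the right half of the central run. A source at the centre is moved by `σ⁺` to a point of
the right half. Two sources thus give two right-hand points that are not images of left-hand ones.
Left-hand fixed points are excluded because `σ⁺` and the reflection together have at most two fixed
points on an edge. -/
theorem source_unique_aux {x y i : ℤ} (hxy : x ≠ y) (hc : ∀ s, E.lo s x = E.lo s y)
    (hD : E.diff x = 0) (hx : x ≤ E.σ .above x ∧ E.σ .below x ≤ x)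
    (hy : y ≤ E.σ .above y ∧ E.σ .below y ≤ y) (hi0 : E.lo .above x ≤ i)
    (hi1 : i ≤ E.hi .above x)
    (hi : 2 * i + 1 = E.sum .above x ∨ 2 * i + 2 = E.sum .above x) (hM : E.M .above i) :
    False := by
  obtain ⟨P, hP⟩ : ∃ P, P = E.sum .above x := ⟨_, rfl⟩
  rw [← hP] at hi
  have hPx : ∀ s, E.sum s x = P := fun s => by
    rw [IntervalPair.diff] at hD
    cases s <;> omega
  have hPy : ∀ s, E.sum s y = P := fun s => by rw [← E.sum_eq_of_lo_eq (hc s), hPx]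
  have hiP : E.sum .above i = P := by rw [hP]; exact E.sum_eq hi0 hi1
  obtain ⟨p, q, hp0, hpi, hiq, hqP, hm, hm', hT⟩ := E.exists_run .above i hM (by omega)
  rw [hiP] at hqP hT
  -- No left half-integer is closer to the centre than `i`, so the run ends at `i` and is central,
  -- which makes `cyclic` available.
  obtain rfl : i = q := by omega
  have hinj : Function.Injective (E.σ .above) := fun a b h => by
    rw [← E.σ_σ .above a, h, E.σ_σ]
  -- a source off the centre is a fixed point on the right
  have hoff : ∀ z, (∀ s, E.sum s z = P) → z ≤ E.σ .above z → E.σ .below z ≤ z → 2 * z ≠ P →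
      P < 2 * z ∧ E.σ .above z = z ∧ z ∈ runSet P p i := by
    intro z hz h1 h2 h3
    have h4 : E.σ .below z ≠ z := by
      intro h4
      have h5 := E.mark_of_lt .below z i
      have h6 := E.mark_of_gt .below z i
      rw [h4, hz] at h5 h6
      rcases lt_or_gt_of_ne h3 with h | h
      · exact E.mark_not_both hM (h5 (by omega) (by omega))
      · exact E.mark_not_both hM (h6 (by omega) (by omega))
    have h5 := (E.σ_lt_of_lt (lt_of_le_of_ne h2 h4)).2
    rw [hz] at h5
    have h6 : E.σ .above z = z := by
      by_contra h6
      have := E.diff_neg_of_full_source (lt_of_le_of_ne h1 (Ne.symm h6)) (lt_of_le_of_ne h2 h4)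
      rw [IntervalPair.diff, hz, hz] at this
      omega
    refine ⟨by omega, h6, ?_⟩
    have h7 : p ≤ P - z := by
      by_contra! h7
      exact hm' (E.mark_of_gt .above z (p - 1) (by rw [hz, h6]; omega) (by omega))
    exact ⟨by omega, by omega, by omega⟩
  have hcenter : ∀ z, 2 * z = P → z ∈ runSet P p i := fun z hz => ⟨by omega, by omega, by omega⟩
  have hcfix : ∀ z, 2 * z = P → E.σ .above z ≠ z := by
    intro z hz h
    have h1 := hT.cyclic (by omega) {z} (by
      rintro _ rfl; exact hcenter _ hz) ⟨z, rfl⟩ (by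
      rintro _ rfl
      rw [h, Set.mem_singleton_iff]
      omega) (show i ∈ runSet P p i from ⟨by omega, by omega, by omega⟩)
    rw [Set.mem_singleton_iff] at h1
    omega
  have hsr : ∀ z ∈ runSet P p i, E.sum .above z = P := fun z hz => by
    rw [hP] at hz ⊢
    have hlo : E.lo .above i = E.lo .above x := E.lo_eq _ _ _ hi0 hi1
    obtain ⟨h1, h2, -⟩ := hz
    have h3 : E.sum .above x = E.lo .above x + E.hi .above x := rfl
    exact E.sum_eq (by omega) (by omega)
  have hLgen : ∀ z ∈ runSet P p i, 2 * z < P → E.σ .above z ≠ z →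
      z < E.σ .above z ∧ P ≤ 2 * E.σ .above z := by
    intro z hz h1 h2
    rcases lt_or_gt_of_ne h2 with h | h
    · have := (E.σ_lt_of_lt h).2
      rw [hsr z hz] at this
      omega
    · have := (E.σ_antidiag _ _ h).2
      rw [hsr z hz] at this
      exact ⟨h, this⟩
  -- one of the two sources is the centre
  have key : ∀ z w, (∀ s, E.sum s z = P) → z ≤ E.σ .above z → E.σ .below z ≤ z → 2 * z ≠ P →
      2 * w = P → w ≤ E.σ .above w → False := by
    intro z w hz h1 h2 h3 hw h4
    obtain ⟨g1, g2, g3⟩ := hoff z hz h1 h2 h3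
    have hw' : w < E.σ .above w := lt_of_le_of_ne h4 (Ne.symm (hcfix w hw))
    refine no_crowded_right_half (a := z) (b := E.σ .above w) hT (by omega) hinj ?_ g3
      (hT.stable w (hcenter w hw)) g1 (by omega) ?_
    · intro h
      have h5 : z = w := hinj (g2.trans h)
      omega
    · intro v hv hvP
      have h5 : E.σ .above v ≠ v := fun h => by
        have := hT.fixed_two (E.σ_σ .above) (by omega) g3 hv (hcenter w hw) g2 h hw
        omega
      obtain ⟨h6, h7⟩ := hLgen v hv hvP h5
      refine ⟨lt_of_le_of_ne h7 fun h8 => ?_, fun h8 => ?_, fun h8 => ?_⟩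
      · have h9 : E.σ .above v = w := by omega
        have h10 := E.σ_σ .above v
        rw [h9] at h10
        omega
      · have := hinj (h8.trans g2.symm)
        omega
      · have := hinj h8
        omega
  by_cases hxP : 2 * x = P
  · exact key y x hPy hy.1 hy.2 (by omega) hxP hx.1
  by_cases hyP : 2 * y = P
  · exact key x y hPx hx.1 hx.2 hxP hyP hy.1
  obtain ⟨f1, f2, f3⟩ := hoff x hPx hx.1 hx.2 hxP
  obtain ⟨g1, g2, g3⟩ := hoff y hPy hy.1 hy.2 hyP
  refine no_crowded_right_half hT (by omega) hinj hxy f3 g3 f1 g1 fun v hv hvP => ?_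
  have h5 : E.σ .above v ≠ v := fun h => by
    have := hT.fixed_three (E.σ_σ .above) (by omega) hv f3 g3 h f2 g2 (by omega) (by omega)
    exact hxy this
  obtain ⟨h6, h7⟩ := hLgen v hv hvP h5
  refine ⟨lt_of_le_of_ne h7 fun h8 => ?_, fun h8 => ?_, fun h8 => ?_⟩
  · exact hxy (hT.fixed_two (E.σ_σ .above) (by omega) f3 g3 (hcenter (E.σ .above v) h8.symm)
      f2 g2 h8.symm)
  · have := hinj (h8.trans f2.symm)
    omega
  · have := hinj (h8.trans g2.symm)
    omega

/-- Where the reflections agree, the half-integer next to the centre is marked on one of the two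
sides. A mark below is reduced to a mark above by `reflect.swap`, which preserves both the arrows
and the difference. -/
theorem source_unique {x y : ℤ} (hc : ∀ s, E.lo s x = E.lo s y)
    (hD : E.diff x = 0) (hx : x ≤ E.σ .above x ∧ E.σ .below x ≤ x)
    (hy : y ≤ E.σ .above y ∧ E.σ .below y ≤ y) : x = y := by
  by_contra hxy
  have hb : ∀ s, E.lo s x < E.hi s x := fun s => by
    have h1 := E.lo_le s x
    have h2 := E.le_hi s x
    have h3 := E.lo_le s y
    have h4 := E.le_hi s y
    rw [← hc s] at h3
    rw [← E.hi_eq_of_lo_eq (hc s)] at h4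
    omega
  have hP : ∀ s, E.sum s x = E.sum .above x := fun s => by
    rw [IntervalPair.diff] at hD
    cases s <;> omega
  have hPd : ∀ s, E.lo s x + E.hi s x = E.sum .above x := hP
  obtain ⟨i, hi⟩ : ∃ i, 2 * i + 1 = E.sum .above x ∨ 2 * i + 2 = E.sum .above x :=
    ⟨(E.sum .above x - 1) / 2, by omega⟩
  have hib : ∀ s, E.lo s x ≤ i ∧ i < E.hi s x := fun s => by
    have := hb s
    have := hPd s
    omega
  have hsi : ∀ s, E.sum s i = E.sum .above x := fun s => by
    rw [← hP s]; exact E.sum_eq (hib s).1 (hib s).2.le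
  obtain ⟨s, hs⟩ := E.exists_mark i
    (fun s => by rw [E.hi_eq s x i (hib s).1 (hib s).2.le]; exact (hib s).2)
    (by rw [hsi, hsi])
  cases s with
  | above => exact E.source_unique_aux hxy hc hD hx hy (hib _).1 (hib _).2.le hi hs
  | below =>
    have h1 := E.mark_symm _ _ hs
    rw [hsi] at h1
    have h2 := hPd .below
    have h3 := hib .below
    have h4 : E.sum .above x = E.lo .above x + E.hi .above x := rfl
    refine E.reflect.swap.source_unique_aux (x := -x) (y := -y) (i := i - E.sum .above x)
      (by omega) (fun s => ?_) ?_ ?_ ?_ ?_ ?_ ?_ ?_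
    · simp [swap, reflect, E.hi_eq_of_lo_eq (hc _)]
    · rw [swap_diff, reflect_diff]
      simp [hD]
    · simp only [swap, reflect, Side.swap, neg_neg]
      omega
    · simp only [swap, reflect, Side.swap, neg_neg]
      omega
    · simp only [swap, reflect, Side.swap, neg_neg]
      omega
    · simp only [swap, reflect, Side.swap, neg_neg]
      omega
    · simp only [IntervalPair.sum, swap, reflect, Side.swap, neg_neg]
      omega
    · simp only [swap, reflect, Side.swap]
      convert h1 using 1
      omega

theorem diff_le_of_reflTransGen {u v : ℤ} (h : ReflTransGen E.Arrow u v) :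
    E.diff u ≤ E.diff v := by
  induction h with
  | refl => exact le_rfl
  | tail _ h ih =>
    refine ih.trans ?_
    rcases E.cell_or h with h | h
    · have h1 := E.cell_eq_iff.1 h
      simp only [IntervalPair.diff, E.sum_eq_of_lo_eq (h1 _)]
      exact le_rfl
    · exact h.2.2.le

/-- The difference never decreases along arrows and increases between cells, so a cycle stays in one
cell. A vertex on a cycle has an incoming and an outgoing arrow, hence both involutions move it in
the same direction, and the set `K` of such vertices is stable under both. If `D > 0`, going from
the rightmost vertex above and back below leads further to the right; `D = 0` is
`no_closed_of_diff_zero`. -/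
theorem acyclic_aux {x₀ : ℤ} (h0 : TransGen E.Arrow x₀ x₀) (hD : 0 ≤ E.diff x₀) : False := by
  set K : Set ℤ := {x | TransGen E.Arrow x x ∧ ∀ s, E.lo s x = E.lo s x₀} with hK
  have hstep : ∀ x y, TransGen E.Arrow x x → E.Arrow x y → TransGen E.Arrow y y →
      ReflTransGen E.Arrow y x → ∀ s, E.lo s x = E.lo s y := by
    intro x y _ h1 _ h2
    have h3 := E.diff_le_of_reflTransGen h2
    exact E.cell_eq_iff.1 ((E.cell_or h1).resolve_right (by omega))
  have hLR : ∀ x ∈ K, ((∀ s, x < E.σ s x) ∨ ∀ s, E.σ s x < x) ∧ ∀ s, E.σ s x ∈ K := by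
    rintro x ⟨hx, hxc⟩
    obtain ⟨w, hw1, hw2⟩ := TransGen.head'_iff.1 hx
    obtain ⟨v, hv1, hv2⟩ := TransGen.tail'_iff.1 hx
    have hww : TransGen E.Arrow w w := TransGen.tail' hw2 hw1
    have hvv : TransGen E.Arrow v v := TransGen.head' hv2 hv1
    have hwK : w ∈ K := ⟨hww, fun s => by rw [← hstep x w hx hw1 hww hw2 s, hxc]⟩
    have hvK : v ∈ K := ⟨hvv, fun s => by rw [hstep v x hvv hv2 hx hv1 s, hxc]⟩
    rw [E.arrow_comm] at hv2
    rcases hw1 with ⟨h1, rfl⟩ | ⟨h1, rfl⟩ <;> rcases hv2 with ⟨h2, rfl⟩ | ⟨h2, rfl⟩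
    · omega
    · exact ⟨Or.inl fun s => by cases s; exacts [h1, h2], fun s => by cases s; exacts [hwK, hvK]⟩
    · exact ⟨Or.inr fun s => by cases s; exacts [h2, h1], fun s => by cases s; exacts [hvK, hwK]⟩
    · omega
  have hx₀ : x₀ ∈ K := ⟨h0, fun _ => rfl⟩
  rcases hD.lt_or_eq with hD | hD
  · obtain ⟨r, hr, hrR⟩ : ∃ r ∈ K, ∀ s, E.σ s r < r := by
      rcases (hLR x₀ hx₀).1 with h | h
      · refine ⟨_, (hLR x₀ hx₀).2 .above, ?_⟩
        refine ((hLR _ ((hLR x₀ hx₀).2 .above)).1).resolve_left fun h' => ?_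
        have h1 := h' .above
        have h2 := h .above
        rw [E.σ_σ] at h1
        omega
      · exact ⟨x₀, hx₀, h⟩
    have hfin : {r | r ∈ K ∧ ∀ s, E.σ s r < r}.Finite := by
      refine (Set.finite_Icc (E.lo .above x₀) (E.hi .above x₀)).subset ?_
      rintro x ⟨⟨-, hx⟩, -⟩
      rw [← hx, ← E.hi_eq_of_lo_eq (hx _)]
      exact ⟨E.lo_le _ _, E.le_hi _ _⟩
    obtain ⟨r, ⟨hrK, hrR⟩, hmax⟩ : ∃ r, (r ∈ K ∧ ∀ s, E.σ s r < r) ∧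
        ∀ x, (x ∈ K ∧ ∀ s, E.σ s x < x) → x ≤ r :=
      Set.exists_max_image _ id hfin ⟨r, hr, hrR⟩
    have hxK := (hLR r hrK).2 .above
    have hxL : ∀ s, E.σ .above r < E.σ s (E.σ .above r) := by
      refine (hLR _ hxK).1.resolve_right fun h => ?_
      have h1 := h .above
      have h2 := hrR .above
      rw [E.σ_σ] at h1
      omega
    have hyK := (hLR _ hxK).2 .below
    have hyR : ∀ s, E.σ s (E.σ .below (E.σ .above r)) < E.σ .below (E.σ .above r) := by
      refine (hLR _ hyK).1.resolve_left fun h => ?_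
      have h1 := h .below
      have h2 := hxL .below
      rw [E.σ_σ] at h1
      omega
    have h1 := E.σ_above_lt_σ_below (hxL .above) (hxL .below)
      (by rw [E.σ_σ, hrK.2, hxK.2]) (by
        simp only [IntervalPair.diff, E.sum_eq_of_lo_eq (hxK.2 _)] at hD ⊢
        exact hD)
    rw [E.σ_σ] at h1
    have := hmax _ ⟨hyK, hyR⟩
    omega
  · exact E.no_closed_of_diff_zero hx₀ (fun x hx => hx.2) (fun x hx => (hLR x hx).2)
      (fun x hx => (hLR x hx).1) hD.symm

theorem acyclic (x : ℤ) : ¬ TransGen E.Arrow x x := by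
  intro h
  rcases le_total 0 (E.diff x) with hD | hD
  · exact E.acyclic_aux h hD
  · refine E.swap.acyclic_aux (x₀ := x) ?_ (by rw [swap_diff]; omega)
    exact TransGen.lift id (fun a b hab => E.swap_arrow.2 hab) _ _ (transGen_swap.2 h)

theorem full_source_of_two {u v w : ℤ} (h1 : E.Arrow u v) (h2 : E.Arrow u w) (hne : v ≠ w) :
    u < E.σ .above u ∧ E.σ .below u < u := by
  rcases h1 with ⟨h1, rfl⟩ | ⟨h1, rfl⟩ <;> rcases h2 with ⟨h2, rfl⟩ | ⟨h2, rfl⟩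
  · exact absurd rfl hne
  · exact ⟨h1, h2⟩
  · exact ⟨h2, h1⟩
  · exact absurd rfl hne

theorem full_sink_of_two {u v w : ℤ} (h1 : E.Arrow u w) (h2 : E.Arrow v w) (hne : u ≠ v) :
    E.σ .above w < w ∧ w < E.σ .below w :=
  (E.swap.full_source_of_two (E.swap_arrow.2 h1) (E.swap_arrow.2 h2) hne).symm

theorem succ_le {u v w x : ℤ} (h1 : E.Arrow u v) (h2 : E.Arrow u w) (hne : v ≠ w)
    (h3 : E.Arrow u x) : x = v ∨ x = w := by
  rcases h1 with ⟨h1, rfl⟩ | ⟨h1, rfl⟩ <;> rcases h2 with ⟨h2, rfl⟩ | ⟨h2, rfl⟩ <;>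
    rcases h3 with ⟨h3, rfl⟩ | ⟨h3, rfl⟩ <;> simp_all

theorem lt_of_lo_eq {s : Side} {x y u v : ℤ} (hxy : x < y) (h : E.lo s x ≠ E.lo s y)
    (hu : E.lo s u = E.lo s x) (hv : E.lo s v = E.lo s y) : u < v := by
  have h1 := E.hi_lt_lo hxy h
  have h2 := E.le_hi s u
  have h3 := E.lo_le s v
  rw [E.hi_eq_of_lo_eq hu] at h2
  omega

theorem lo_ne_below {x y : ℤ} (h : E.lo .above x = E.lo .above y) (hc : E.cell x ≠ E.cell y) :
    E.lo .below x ≠ E.lo .below y := fun h' =>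
  hc (E.cell_eq_iff.2 fun s => by cases s; exacts [h, h'])

theorem lo_ne_above {x y : ℤ} (h : E.lo .below x = E.lo .below y) (hc : E.cell x ≠ E.cell y) :
    E.lo .above x ≠ E.lo .above y := fun h' =>
  hc (E.cell_eq_iff.2 fun s => by cases s; exacts [h', h])

/-- The arrows of a marked pair form an arc system. -/
theorem isArcSystem : IsArcSystem E.Arrow E.Off E.diff E.cell where
  acyclic := E.acyclic
  cell_or _ _ h := E.cell_or h
  D_cell u v h := by
    have h1 := E.cell_eq_iff.1 h
    simp only [IntervalPair.diff, E.sum_eq_of_lo_eq (h1 _)]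
  succ_two u v w h1 h2 h3 := by
    have := E.full_source_of_two h1 h2 h3
    exact ⟨E.no_in_iff.2 ⟨this.1.le, this.2.le⟩, E.diff_neg_of_full_source this.1 this.2⟩
  succ_le _ _ _ _ := E.succ_le
  pred_two u v w h1 h2 h3 := by
    have := E.full_sink_of_two h1 h2 h3
    exact ⟨E.no_out_iff.2 ⟨this.1.le, this.2.le⟩, E.diff_pos_of_full_sink this.1 this.2⟩
  pred_le _ _ _ _ h1 h2 h3 h4 :=
    E.swap.succ_le (E.swap_arrow.2 h1) (E.swap_arrow.2 h2) h3 (E.swap_arrow.2 h4)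
  source_D u v h1 h2 := E.diff_nonpos_of_source h2 ⟨v, h1⟩
  sink_D u v h1 h2 := E.diff_nonneg_of_sink h2 ⟨u, h1⟩
  ok_D _ _ h1 h2 := E.off_of_diff_le h1 h2
  -- The two successors of `x` lie on different sides of it. Each shares one interval with `x` and
  -- has left the other, so this order persists for all points of their cells.
  ok_succ x s t u v h1 h2 hne hs ht hu hv := by
    have hu' := E.cell_eq_iff.1 hu
    have hv' := E.cell_eq_iff.1 hv
    rcases h1 with ⟨h1, rfl⟩ | ⟨h1, rfl⟩ <;> rcases h2 with ⟨h2, rfl⟩ | ⟨h2, rfl⟩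
    · exact absurd rfl hne
    · have h3 := E.lo_ne_below (E.lo_σ .above x) hs
      have h4 := (hv' .below).trans (E.lo_σ .below x)
      exact Or.inr ⟨E.lt_of_lo_eq h1 h3.symm h4 (hu' .below), by rwa [hu', h4]⟩
    · have h3 := E.lo_ne_above (E.lo_σ .below x) hs
      have h4 := (hv' .above).trans (E.lo_σ .above x)
      exact Or.inl ⟨E.lt_of_lo_eq h1 h3 (hu' .above) h4, by rwa [hu', h4]⟩
    · exact absurd rfl hne
  ok_pred z s t u v h1 h2 hne hs ht hu hv := by
    rw [arrow_comm] at h1 h2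
    have hu' := E.cell_eq_iff.1 hu
    have hv' := E.cell_eq_iff.1 hv
    rcases h1 with ⟨h1, rfl⟩ | ⟨h1, rfl⟩ <;> rcases h2 with ⟨h2, rfl⟩ | ⟨h2, rfl⟩
    · exact absurd rfl hne
    · have h3 := E.lo_ne_below (E.lo_σ .above z) hs
      have h4 := (hv' .below).trans (E.lo_σ .below z)
      have h5 := E.lo_ne_above (E.lo_σ .below z) ht
      have h6 := (hu' .above).trans (E.lo_σ .above z)
      exact Or.inl ⟨E.lt_of_lo_eq h1 h3 (hu' .below) h4, by rw [h6, hv']; exact h5.symm⟩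
    · have h3 := E.lo_ne_below (E.lo_σ .above z) ht
      have h4 := (hu' .below).trans (E.lo_σ .below z)
      exact Or.inr ⟨E.lt_of_lo_eq h2 h3 (hv' .below) h4, by rw [h4, hv']; exact h3.symm⟩
    · exact absurd rfl hne
  cell_pred z s t h1 h2 hne hs ht h := by
    rw [arrow_comm] at h1 h2
    have h' := E.cell_eq_iff.1 h
    rcases h1 with ⟨h1, rfl⟩ | ⟨h1, rfl⟩ <;> rcases h2 with ⟨h2, rfl⟩ | ⟨h2, rfl⟩
    · exact absurd rfl hne
    · exact E.lo_ne_below (E.lo_σ .above z) hs ((h' _).trans (E.lo_σ _ _))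
    · exact E.lo_ne_above (E.lo_σ .below z) hs ((h' _).trans (E.lo_σ _ _))
    · exact absurd rfl hne
  -- In a square the arcs would alternate between above and below, and the four inequalities would
  -- close up to a cycle.
  no_square u v w x h1 h2 h3 h4 hne := by
    by_contra hwx
    rw [arrow_comm] at h2 h4
    rcases h1 with ⟨h1, rfl⟩ | ⟨h1, rfl⟩ <;> rcases h3 with ⟨h3, rfl⟩ | ⟨h3, rfl⟩
    · exact hwx rfl
    · rcases h2 with ⟨h2, rfl⟩ | ⟨h2, h2'⟩
      · exact hne (E.σ_σ _ _).symm
      · rcases h4 with ⟨h4, h4'⟩ | ⟨h4, rfl⟩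
        · omega
        · exact hne (E.σ_σ _ _).symm
    · rcases h2 with ⟨h2, h2'⟩ | ⟨h2, rfl⟩
      · rcases h4 with ⟨h4, rfl⟩ | ⟨h4, h4'⟩
        · exact hne (E.σ_σ _ _).symm
        · omega
      · exact hne (E.σ_σ _ _).symm
    · exact hwx rfl
  zero_unique u v h1 h2 h3 h4 :=
    E.source_unique (E.cell_eq_iff.1 h2) h1 (E.no_in_iff.1 h3) (E.no_in_iff.1 h4)
  isolated_unique u v h1 h2 h3 h4 h5 := by
    rw [no_in_iff] at h2 h4
    rw [no_out_iff] at h3 h5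
    exact E.isolated_unique (E.cell_eq_iff.1 h1) (fun s => by cases s <;> omega)
      (fun s => by cases s <;> omega)

end MarkedPair

end Meander

/-! ### Interval partitions in integer coordinates -/

section Blocks

variable {n : ℕ}

/-- The first point of the interval of `x`. -/
def blockLo (c : Composition n) (x : Fin n) : ℤ := c.sizeUpTo (c.index x)

/-- The last point of the interval of `x`. -/
def blockHi (c : Composition n) (x : Fin n) : ℤ := c.sizeUpTo (c.index x + 1) - 1

/-- The reversal of the interval of `x` is `y ↦ blockSum c x - y`. -/
def blockSum (c : Composition n) (x : Fin n) : ℤ := blockLo c x + blockHi c x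

variable (c : Composition n)

theorem blockLo_le (x : Fin n) : blockLo c x ≤ x := by
  have := c.sizeUpTo_index_le x
  simp only [blockLo]
  omega

theorem le_blockHi (x : Fin n) : (x : ℤ) ≤ blockHi c x := by
  have h : (x : ℕ) < c.sizeUpTo (c.index x + 1) := c.lt_sizeUpTo_index_succ x
  simp only [blockHi]
  omega

theorem blockLo_nonneg (x : Fin n) : 0 ≤ blockLo c x := by
  simp only [blockLo]
  omega

theorem blockHi_lt (x : Fin n) : blockHi c x < n := by
  have := c.sizeUpTo_le (c.index x + 1)
  simp only [blockHi]
  omega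

theorem index_eq_of_mem {x y : Fin n} (h1 : blockLo c x ≤ y) (h2 : (y : ℤ) ≤ blockHi c x) :
    c.index y = c.index x := by
  refine (c.mem_range_embedding_iff'.1 (c.mem_range_embedding_iff.2 ⟨?_, ?_⟩)).symm
  · simp only [blockLo] at h1
    omega
  · simp only [blockHi, Nat.succ_eq_add_one] at *
    omega

theorem exists_fin_of_mem {x : Fin n} {y : ℤ} (h1 : blockLo c x ≤ y) (h2 : y ≤ blockHi c x) :
    ∃ z : Fin n, (z : ℤ) = y := by
  have h3 := blockLo_nonneg c x
  have h4 := blockHi_lt c x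
  exact ⟨⟨y.toNat, by omega⟩, by simp; omega⟩

theorem blockLo_congr {x y : Fin n} (h : c.index x = c.index y) : blockLo c x = blockLo c y := by
  rw [blockLo, blockLo, h]

theorem blockHi_congr {x y : Fin n} (h : c.index x = c.index y) : blockHi c x = blockHi c y := by
  rw [blockHi, blockHi, h]

theorem blockSum_congr {x y : Fin n} (h : c.index x = c.index y) :
    blockSum c x = blockSum c y := by
  rw [blockSum, blockSum, blockLo_congr c h, blockHi_congr c h]

theorem index_eq_of_blockLo_eq {x y : Fin n} (h : blockLo c x = blockLo c y) :
    c.index x = c.index y := by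
  rcases le_total x y with hxy | hxy
  · exact index_eq_of_mem c (by rw [← h]; exact blockLo_le c x)
      ((show (x : ℤ) ≤ y by exact_mod_cast hxy).trans (le_blockHi c y))
  · exact (index_eq_of_mem c (by rw [h]; exact blockLo_le c y)
      ((show (y : ℤ) ≤ x by exact_mod_cast hxy).trans (le_blockHi c x))).symm

theorem kappa_val (x : Fin n) : ((kappa c x : Fin n) : ℤ) = blockSum c x - x := by
  have h1 : kappa c x = c.embedding (c.index x) (Fin.rev (c.invEmbedding x)) := rfl
  have h2 := congrArg Fin.val (c.embedding_comp_inv x)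
  rw [c.coe_embedding] at h2
  have h3 := c.sizeUpTo_succ' (c.index x)
  rw [h1, c.coe_embedding, Fin.val_rev]
  have h4 := (c.invEmbedding x).2
  simp only [blockSum, blockLo, blockHi] at *
  omega

theorem kappa_index (x : Fin n) : c.index (kappa c x) = c.index x := by
  have h1 := blockLo_le c x
  have h2 := le_blockHi c x
  apply index_eq_of_mem <;> rw [kappa_val, blockSum] <;> omega

theorem kappa_kappa (x : Fin n) : kappa c (kappa c x) = x := by
  apply Fin.ext
  have h1 := kappa_val c (kappa c x)
  rw [blockSum_congr c (kappa_index c x), kappa_val c x] at h1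
  omega

/-- On half-integers named by their left neighbour, reversal is `i ↦ blockSum c i - 1 - i`; the
inequality says that `i + 1` still belongs to the interval of `i`. -/
theorem dynkinSwap_iff {i j : Fin n} :
    DynkinSwap c i j ↔ (i : ℤ) < blockHi c i ∧ (j : ℤ) = blockSum c i - 1 - i := by
  have h1 := kappa_val c i
  have h2 := blockLo_le c i
  have h3 := le_blockHi c i
  constructor
  · rintro ⟨h4, h5⟩
    have h6 := blockLo_le c j
    rw [← blockLo_congr c h4] at h6
    rw [blockSum] at *
    omega
  · rintro ⟨h4, h5⟩
    refine ⟨(index_eq_of_mem c ?_ ?_).symm, ?_⟩ <;> rw [blockSum] at * <;> omega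

theorem dynkinSwap_symm {i j : Fin n} (h : DynkinSwap c i j) : DynkinSwap c j i := by
  have h0 := h.1
  rw [dynkinSwap_iff] at h ⊢
  have h2 := blockLo_le c i
  rw [← blockSum_congr c h0, ← blockHi_congr c h0]
  rw [blockSum] at *
  omega

end Blocks

/-! ### Runs of marked points and their extended components -/

section Runs

variable {n : ℕ}

theorem exists_isMarkedRun {m : Set (Fin n)} {i : Fin n} (hi : i ∈ m) :
    ∃ p q, IsMarkedRun m p q ∧ p ≤ i ∧ i ≤ q := by
  classical
  obtain ⟨p, ⟨hp1, hp2⟩, hp3⟩ := Set.exists_min_image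
    {p : Fin n | p ≤ i ∧ ∀ j, p ≤ j → j ≤ i → j ∈ m} id (Set.toFinite _)
    ⟨i, le_rfl, fun j h1 h2 => by rwa [le_antisymm h2 h1]⟩
  obtain ⟨q, ⟨hq1, hq2⟩, hq3⟩ := Set.exists_max_image
    {q : Fin n | i ≤ q ∧ ∀ j, i ≤ j → j ≤ q → j ∈ m} id (Set.toFinite _)
    ⟨i, le_rfl, fun j h1 h2 => by rwa [le_antisymm h2 h1]⟩
  refine ⟨p, q, ⟨hp1.trans hq1, fun t h1 h2 => ?_, fun t ht htm => ?_, fun t ht htm => ?_⟩, hp1, hq1⟩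
  · rcases le_total t i with h | h
    · exact hp2 t h1 h
    · exact hq2 t h h2
  · have := hp3 t ⟨by simp only [Fin.le_def] at *; omega, fun j h1 h2 => by
      by_cases hj : p ≤ j
      · exact hp2 j hj h2
      · have : j = t := Fin.ext (by simp only [Fin.le_def] at *; omega)
        rwa [this]⟩
    simp only [id, Fin.le_def] at this
    omega
  · have := hq3 t ⟨by simp only [Fin.le_def] at *; omega, fun j h1 h2 => by
      by_cases hj : j ≤ q
      · exact hq2 j h1 hj
      · have : j = t := Fin.ext (by simp only [Fin.le_def] at *; omega)
        rwa [this]⟩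
    simp only [id, Fin.le_def] at this
    omega

variable (c : Composition n)

/-- Every point of the set is the left end-point of an arc. -/
def IsLeftSet (m : Set (Fin n)) : Prop :=
  ∀ i ∈ m, (i : ℤ) < blockHi c i ∧ 2 * (i : ℤ) + 1 ≤ blockSum c i

variable {c} {m : Set (Fin n)} (hm : IsLeftSet c m)
include hm

/-- Each point of the set has its right neighbour in the same interval, so a run cannot leave its
interval. -/
theorem IsLeftSet.index_run {p t : Fin n} (hpt : p ≤ t)
    (h : ∀ j, p ≤ j → j ≤ t → j ∈ m) : c.index t = c.index p := by
  have key : ∀ k : ℕ, ∀ t : Fin n, (t : ℕ) = p + k → (∀ j, p ≤ j → j < t → j ∈ m) →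
      c.index t = c.index p := by
    intro k
    induction k with
    | zero => intro t ht _; congr 1; exact Fin.ext (by omega)
    | succ k ih =>
      intro t ht h
      let t' : Fin n := ⟨p + k, by omega⟩
      have h1 : (t' : ℕ) = p + k := rfl
      have h2 := ih t' h1 fun j hj1 hj2 => h j hj1 (by
        rw [Fin.lt_def] at hj2 ⊢; omega)
      have h3 := (hm t' (h t' (by rw [Fin.le_def]; omega) (by rw [Fin.lt_def]; omega))).1
      rw [← h2]
      have h4 := blockLo_le c t'
      exact index_eq_of_mem c (by omega) (by omega)
  refine key (t - p) t (by rw [Fin.le_def] at hpt; omega) fun j hj1 hj2 => h j hj1 hj2.le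

variable {p q : Fin n} (hr : IsMarkedRun m p q)
include hr

theorem IsLeftSet.run_index {t : Fin n} (h1 : p ≤ t) (h2 : t ≤ q) : c.index t = c.index p :=
  hm.index_run h1 fun j hj1 hj2 => hr.2.1 j hj1 (hj2.trans h2)

theorem IsLeftSet.run_bounds : blockLo c p ≤ p ∧ (p : ℤ) ≤ q ∧ 2 * (q : ℤ) + 1 ≤ blockSum c p ∧
    (q : ℤ) < blockHi c p := by
  have h1 := hm.run_index hr hr.1 le_rfl
  have h2 := hm q (hr.2.1 q hr.1 le_rfl)
  rw [blockSum_congr c h1, blockHi_congr c h1] at h2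
  exact ⟨blockLo_le c p, by exact_mod_cast hr.1, h2.2, h2.1⟩

theorem IsLeftSet.kappa_q : ((kappa c q : Fin n) : ℤ) = blockSum c p - q := by
  rw [kappa_val, blockSum_congr c (hm.run_index hr hr.1 le_rfl)]

theorem IsLeftSet.mem_leftHalf {x : Fin n} : x ∈ leftHalf c p q ↔
    (p : ℤ) ≤ x ∧ ((x : ℤ) ≤ q ∨ (x : ℤ) = q + 1 ∧ 2 * (q : ℤ) + 1 < blockSum c p) := by
  have h1 := hm.kappa_q hr
  obtain ⟨-, -, h2, -⟩ := hm.run_bounds hr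
  simp only [leftHalf, Set.mem_ofPred_eq, Fin.le_def, ne_eq, Fin.ext_iff]
  omega

theorem IsLeftSet.leftHalf_index {x : Fin n} (hx : x ∈ leftHalf c p q) :
    c.index x = c.index p := by
  rw [hm.mem_leftHalf hr] at hx
  obtain ⟨h1, h2, h3, h4⟩ := hm.run_bounds hr
  exact index_eq_of_mem c (by omega) (by omega)

theorem IsLeftSet.mem_rightHalf {x : Fin n} : x ∈ rightHalf c p q ↔
    (x : ℤ) ≤ blockSum c p - p ∧ (blockSum c p - q ≤ (x : ℤ) ∨
      (x : ℤ) = blockSum c p - (q + 1) ∧ 2 * (q : ℤ) + 1 < blockSum c p) := by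
  obtain ⟨h1, h2, h3, h4⟩ := hm.run_bounds hr
  have hP : blockSum c p = blockLo c p + blockHi c p := rfl
  constructor
  · rintro ⟨y, hy, rfl⟩
    rw [kappa_val, blockSum_congr c (hm.leftHalf_index hr hy)]
    rw [hm.mem_leftHalf hr] at hy
    omega
  · intro hx
    have hxi : c.index x = c.index p := index_eq_of_mem c (by omega) (by omega)
    refine ⟨kappa c x, ?_, kappa_kappa c x⟩
    rw [hm.mem_leftHalf hr, kappa_val, blockSum_congr c hxi]
    omega

/-- The case distinction in `leftHalf` disappears in the union: when `q` and `q + 1` are the two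
middle points, `q + 1` belongs to the mirror image of the run anyway. -/
theorem IsLeftSet.mem_extendedComponent {x : Fin n} :
    x ∈ extendedComponent c p q ↔ (x : ℤ) ∈ runSet (blockSum c p) p q := by
  obtain ⟨h1, h2, h3, h4⟩ := hm.run_bounds hr
  rw [extendedComponent, Set.mem_union, hm.mem_leftHalf hr, hm.mem_rightHalf hr]
  simp only [runSet, Set.mem_ofPred_eq]
  omega

theorem IsLeftSet.extendedComponent_index {x : Fin n} (hx : x ∈ extendedComponent c p q) :
    c.index x = c.index p := by
  rcases hx with hx | ⟨y, hy, rfl⟩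
  · exact hm.leftHalf_index hr hx
  · rw [kappa_index, hm.leftHalf_index hr hy]

theorem IsLeftSet.isCentralRun_iff : IsCentralRun c q ↔ blockSum c p ≤ 2 * q + 2 := by
  have h1 := hm.kappa_q hr
  rw [IsCentralRun]
  omega

end Runs

/-! ### Orbits of two involutions on a finite set -/

section Dihedral

variable {n : ℕ} {κ σ : Equiv.Perm (Fin n)}

/-- On a finite set the non-negative powers of the product already give the whole orbit, so closure
under forward steps is enough. -/
theorem mem_of_isEdge {O T : Set (Fin n)} (hO : IsEdge κ σ O) {y z : Fin n} (hyO : y ∈ O)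
    (hy : y ∈ T) (hT : ∀ x ∈ T, κ (σ x) ∈ T) (hz : z ∈ O) : z ∈ T := by
  obtain ⟨-, x, rfl⟩ := hO
  rw [← MulAction.orbit_eq_iff.2 hyO] at hz
  obtain ⟨⟨g, hg⟩, rfl⟩ := hz
  obtain ⟨k, rfl⟩ := mem_powers_iff_mem_zpowers.2 hg
  change ((κ * σ) ^ k) y ∈ T
  induction k with
  | zero => simpa using hy
  | succ k ih =>
    rw [pow_succ']
    exact hT _ (ih (mem_powers_iff_mem_zpowers.1 ⟨k, rfl⟩))

variable (hκ : ∀ x, κ (κ x) = x) (hσ : ∀ x, σ (σ x) = x)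
include hκ hσ

theorem mem_of_isMeander {O T : Set (Fin n)} (hO : IsMeander κ σ O) {y z : Fin n} (hyO : y ∈ O)
    (hy : y ∈ T) (hTκ : ∀ x ∈ T, κ x ∈ T) (hTσ : ∀ x ∈ T, σ x ∈ T) (hz : z ∈ O) : z ∈ T := by
  obtain ⟨x, rfl⟩ := hO
  rw [← MulAction.orbit_eq_iff.2 hyO] at hz
  obtain ⟨⟨g, hg⟩, rfl⟩ := hz
  have key : ∀ z, z ∈ T ↔ g z ∈ T := by
    induction hg using Subgroup.closure_induction with
    | mem x hx =>
      intro z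
      rcases hx with rfl | rfl
      · exact ⟨hTκ z, fun h => by simpa [hκ] using hTκ _ h⟩
      · exact ⟨hTσ z, fun h => by simpa [hσ] using hTσ _ h⟩
    | one => simp
    | mul a b _ _ ha hb => intro z; rw [hb z, ha (b z)]; rfl
    | inv a _ ha => intro z; rw [ha (a⁻¹ z)]; simp
  exact (key y).1 hy

/-- If `σ` fixes `x`, it sends `(κ * σ) ^ k` applied to `x` to the same with exponent `-k`. The
orbit of the product is then stable under both involutions and is the whole meander, which would be
an edge. -/
theorem IsLoop.ne_of_mem {O : Set (Fin n)} (hO : IsLoop κ σ O) {x : Fin n} (hx : x ∈ O) :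
    σ x ≠ x := by
  intro hfix
  refine hO.2 ⟨hO.1, x, ?_⟩
  have hinv : ∀ (k : ℤ), σ (((κ * σ) ^ k) x) = ((κ * σ) ^ (-k)) x := by
    intro k
    have h2 : σ⁻¹ = σ := inv_eq_of_mul_eq_one_left (by ext z; simp [hσ])
    have h3 : κ⁻¹ = κ := inv_eq_of_mul_eq_one_left (by ext z; simp [hκ])
    have h1 : σ * (κ * σ) ^ k * σ⁻¹ = (κ * σ) ^ (-k) := by
      rw [← conj_zpow, zpow_neg, ← inv_zpow, mul_inv_rev, ← mul_assoc, mul_inv_cancel_right, h2, h3]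
    rw [h2] at h1
    rw [← h1, Equiv.Perm.mul_apply, Equiv.Perm.mul_apply, hfix]
  have hmem : ∀ k : ℤ, ((κ * σ) ^ k) x ∈ MulAction.orbit (Subgroup.zpowers (κ * σ)) x :=
    fun k => ⟨⟨(κ * σ) ^ k, k, rfl⟩, rfl⟩
  have hex : ∀ z ∈ MulAction.orbit (Subgroup.zpowers (κ * σ)) x, ∃ k : ℤ, z = ((κ * σ) ^ k) x := by
    rintro _ ⟨⟨_, k, rfl⟩, rfl⟩
    exact ⟨k, rfl⟩
  ext z
  constructor
  · intro hz
    refine mem_of_isMeander hκ hσ hO.1 hx (hmem 0) ?_ ?_ hz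
    · intro w hw
      obtain ⟨k, rfl⟩ := hex w hw
      have h1 := hmem (1 + -k)
      rwa [zpow_add, zpow_one, Equiv.Perm.mul_apply, ← hinv, Equiv.Perm.mul_apply, hσ] at h1
    · intro w hw
      obtain ⟨k, rfl⟩ := hex w hw
      rw [hinv]
      exact hmem _
  · intro hz
    obtain ⟨x₀, hx₀⟩ := hO.1
    rw [hx₀] at hx ⊢
    rw [← MulAction.orbit_eq_iff.2 hx]
    obtain ⟨k, rfl⟩ := hex z hz
    refine ⟨⟨(κ * σ) ^ k, Subgroup.zpow_mem _ (Subgroup.mul_mem _ ?_ ?_) k⟩, rfl⟩ <;>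
      exact Subgroup.subset_closure (by simp)

end Dihedral

/-! ### Modified involutions in integer coordinates -/

section Modified

variable {n : ℕ}

/-- The half-integer `i` is the left or right end of an arc whose left end is in `m`. -/
def IsMarkedHalf (c : Composition n) (m : Set (Fin n)) (i : ℤ) : Prop :=
  ∃ j ∈ m, i = j ∨ i = blockSum c j - 1 - j

variable {c : Composition n} {m : Set (Fin n)} {σ : Equiv.Perm (Fin n)}

theorem IsLeftSet.isMarkedHalf_left (hm : IsLeftSet c m) {i : Fin n}
    (h : IsMarkedHalf c m i) (hi : 2 * (i : ℤ) + 1 ≤ blockSum c i) : i ∈ m := by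
  obtain ⟨j, hj, h | h⟩ := h
  · rwa [show i = j from Fin.ext (by omega)]
  · obtain ⟨h1, h2⟩ := hm j hj
    have h3 := blockLo_le c j
    have h4 : blockSum c i = blockSum c j :=
      blockSum_congr c (index_eq_of_mem c (by rw [blockSum] at *; omega)
        (by rw [blockSum] at *; omega))
    rwa [show i = j from Fin.ext (by omega)]

theorem IsLeftSet.isMarkedHalf_of_run (hm : IsLeftSet c m) {p q : Fin n}
    (hr : IsMarkedRun m p q) {i : ℤ} (h : (p ≤ i ∧ i ≤ q) ∨
      (blockSum c p - 1 - q ≤ i ∧ i ≤ blockSum c p - 1 - p)) : IsMarkedHalf c m i := by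
  obtain ⟨h1, h2, h3, h4⟩ := hm.run_bounds hr
  have key : ∀ j : ℤ, (p : ℤ) ≤ j → j ≤ q → ∃ k : Fin n, (k : ℤ) = j ∧ k ∈ m ∧
      blockSum c k = blockSum c p := by
    intro j hj1 hj2
    obtain ⟨k, rfl⟩ := exists_fin_of_mem c (x := p) (y := j) (by omega) (by omega)
    have h5 : p ≤ k := by rw [Fin.le_def]; omega
    have h6 : k ≤ q := by rw [Fin.le_def]; omega
    exact ⟨k, rfl, hr.2.1 k h5 h6, blockSum_congr c (hm.run_index hr h5 h6)⟩
  rcases h with ⟨h5, h6⟩ | ⟨h5, h6⟩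
  · obtain ⟨k, hk1, hk2, -⟩ := key i h5 h6
    exact ⟨k, hk2, Or.inl hk1.symm⟩
  · obtain ⟨k, hk1, hk2, hk3⟩ := key (blockSum c p - 1 - i) (by omega) (by omega)
    exact ⟨k, hk2, Or.inr (by omega)⟩

variable (hm : IsLeftSet c m) (h : IsModifiedInvolution c m σ)
include hm h

theorem IsModifiedInvolution.index_eq (x : Fin n) : c.index (σ x) = c.index x := by
  by_cases hx : ∀ p q, IsMarkedRun m p q → x ∉ extendedComponent c p q
  · rw [h.unmarked x hx, kappa_index]
  · push Not at hx
    obtain ⟨p, q, hr, hx⟩ := hx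
    rw [hm.extendedComponent_index hr hx, hm.extendedComponent_index hr (h.stable p q hr x hx)]

theorem IsModifiedInvolution.antidiag {x : Fin n} (hx : (x : ℤ) < σ x) :
    2 * (x : ℤ) ≤ blockSum c x ∧ blockSum c x ≤ 2 * (σ x : ℤ) := by
  by_cases hun : ∀ p q, IsMarkedRun m p q → x ∉ extendedComponent c p q
  · rw [h.unmarked x hun, kappa_val] at hx ⊢
    omega
  · push Not at hun
    obtain ⟨p, q, hr, hxc⟩ := hun
    obtain ⟨h1, h2, h3, h4⟩ := hm.run_bounds hr
    rw [blockSum_congr c (hm.extendedComponent_index hr hxc)]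
    have h5 := h.antidiagonal p q hr x hxc (fun h => by rw [h] at hx; omega)
    rw [hm.mem_leftHalf hr, hm.mem_rightHalf hr, hm.mem_leftHalf hr, hm.mem_rightHalf hr] at h5
    omega

/-- If `x` is moved inside an extended component, antidiagonality puts `x` and the mirror image of
`σ x` in the same half, so the half-integers between them belong to the run or to its mirror image.
A fixed point in such a component forces the run to be central, because loops have none; then the
run and its mirror image leave no gap. -/
theorem IsModifiedInvolution.isMarkedHalf {x : Fin n} {i : ℤ}
    (hi : ((x : ℤ) ≤ i ∧ i < blockSum c x - σ x) ∨ (blockSum c x - σ x ≤ i ∧ i < x)) :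
    IsMarkedHalf c m i := by
  by_cases hun : ∀ p q, IsMarkedRun m p q → x ∉ extendedComponent c p q
  · rw [h.unmarked x hun, kappa_val] at hi
    omega
  · push Not at hun
    obtain ⟨p, q, hr, hxc⟩ := hun
    obtain ⟨h1, h2, h3, h4⟩ := hm.run_bounds hr
    rw [blockSum_congr c (hm.extendedComponent_index hr hxc)] at hi
    refine hm.isMarkedHalf_of_run hr ?_
    by_cases hfix : σ x = x
    · have hcen : IsCentralRun c q := by
        by_contra hcen
        exact IsLoop.ne_of_mem (kappa_kappa c) h.involutive (h.loop p q hr hcen) hxc hfix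
      rw [hm.isCentralRun_iff hr] at hcen
      rw [hfix] at hi
      rw [hm.mem_extendedComponent hr] at hxc
      obtain ⟨h5, h6, -⟩ := hxc
      omega
    · have h5 := h.antidiagonal p q hr x hxc hfix
      rw [hm.mem_leftHalf hr, hm.mem_rightHalf hr, hm.mem_leftHalf hr, hm.mem_rightHalf hr] at h5
      omega

/-- A map of the integers that extends `σ` is anti-Toeplitz on each run. -/
theorem IsModifiedInvolution.isAntiToeplitz {p q : Fin n} (hr : IsMarkedRun m p q) {τ : ℤ → ℤ}
    (hτ : ∀ x : Fin n, τ x = σ x) : IsAntiToeplitz τ (blockSum c p) p q := by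
  obtain ⟨h1, h2, h3, h4⟩ := hm.run_bounds hr
  have hP : blockSum c p = blockLo c p + blockHi c p := rfl
  have hfin : ∀ x ∈ runSet (blockSum c p) p q, ∃ y : Fin n, (y : ℤ) = x ∧
      y ∈ extendedComponent c p q := by
    intro x hx
    obtain ⟨y, rfl⟩ := exists_fin_of_mem c (x := p) (y := x)
      (by have := hx.1; omega) (by have := hx.2.1; omega)
    exact ⟨y, rfl, (hm.mem_extendedComponent hr).2 hx⟩
  have hκ : ∀ y ∈ extendedComponent c p q, ((kappa c y : Fin n) : ℤ) = blockSum c p - y :=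
    fun y hy => by rw [kappa_val, blockSum_congr c (hm.extendedComponent_index hr hy)]
  have hmeander : IsMeander (kappa c) σ (extendedComponent c p q) := by
    by_cases hcen : IsCentralRun c q
    · exact (h.edge p q hr hcen).1
    · exact (h.loop p q hr hcen).1
  constructor
  · intro x hx
    obtain ⟨y, rfl, hy⟩ := hfin x hx
    rw [hτ, ← hm.mem_extendedComponent hr]
    exact h.stable p q hr y hy
  · intro T hT hne hTτ hTκ z hz
    obtain ⟨x, hx⟩ := hne
    obtain ⟨y, rfl, hy⟩ := hfin x (hT hx)
    obtain ⟨z, rfl, hz'⟩ := hfin z hz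
    refine mem_of_isMeander (T := {w : Fin n | (w : ℤ) ∈ T}) (kappa_kappa c) h.involutive hmeander
      hy hx (fun w hw => ?_) (fun w hw => ?_) hz'
    · change ((kappa c w : Fin n) : ℤ) ∈ T
      rw [hκ w ((hm.mem_extendedComponent hr).2 (hT hw))]
      exact hTκ _ hw
    · change ((σ w : Fin n) : ℤ) ∈ T
      rw [← hτ]
      exact hTτ _ hw
  · intro hcen T hT hne hTc z hz
    obtain ⟨x, hx⟩ := hne
    obtain ⟨y, rfl, hy⟩ := hfin x (hT hx)
    obtain ⟨z, rfl, hz'⟩ := hfin z hz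
    refine mem_of_isEdge (T := {w : Fin n | (w : ℤ) ∈ T})
      (h.edge p q hr ((hm.isCentralRun_iff hr).2 hcen)) hy hx (fun w hw => ?_) hz'
    change ((kappa c (σ w) : Fin n) : ℤ) ∈ T
    rw [hκ _ (h.stable p q hr w ((hm.mem_extendedComponent hr).2 (hT hw))), ← hτ]
    exact hTc _ hw

end Modified

/-! ### The marked pair attached to the choices of the construction -/

section Pair

variable {n : ℕ}

/-- Extend a function on `Fin n` by the identity. -/
noncomputable def extendFin (f : Fin n → ℤ) : ℤ → ℤ := Function.extend (fun x : Fin n => (x : ℤ)) f id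

theorem extendFin_coe (f : Fin n → ℤ) (x : Fin n) : extendFin f x = f x :=
  Function.Injective.extend_apply (fun a b h => Fin.ext (by simpa using h)) f id x

theorem extendFin_of_not {f : Fin n → ℤ} {x : ℤ} (h : ¬ ∃ y : Fin n, (y : ℤ) = x) :
    extendFin f x = x :=
  Function.extend_apply' f id x h

/-- The intervals of the double partition; all other integers are intervals of their own. -/
noncomputable def DoublePartition.intervals (D : DoublePartition n) : IntervalPair where
  lo s := extendFin (blockLo (D.part s))
  hi s := extendFin (blockHi (D.part s))
  lo_le s x := by
    by_cases hx : ∃ y : Fin n, (y : ℤ) = x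
    · obtain ⟨y, rfl⟩ := hx
      rw [extendFin_coe]
      exact blockLo_le _ y
    · rw [extendFin_of_not hx]
  le_hi s x := by
    by_cases hx : ∃ y : Fin n, (y : ℤ) = x
    · obtain ⟨y, rfl⟩ := hx
      rw [extendFin_coe]
      exact le_blockHi _ y
    · rw [extendFin_of_not hx]
  lo_eq s x y h1 h2 := by
    by_cases hx : ∃ y : Fin n, (y : ℤ) = x
    · obtain ⟨x, rfl⟩ := hx
      rw [extendFin_coe] at h1 h2
      obtain ⟨y, rfl⟩ := exists_fin_of_mem _ h1 h2
      rw [extendFin_coe, extendFin_coe, blockLo_congr _ (index_eq_of_mem _ h1 h2)]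
    · rw [extendFin_of_not hx] at h1 h2
      rw [le_antisymm h2 h1]
  hi_eq s x y h1 h2 := by
    by_cases hx : ∃ y : Fin n, (y : ℤ) = x
    · obtain ⟨x, rfl⟩ := hx
      rw [extendFin_coe] at h1 h2
      obtain ⟨y, rfl⟩ := exists_fin_of_mem _ h1 h2
      rw [extendFin_coe, extendFin_coe, blockHi_congr _ (index_eq_of_mem _ h1 h2)]
    · rw [extendFin_of_not hx] at h1 h2
      rw [le_antisymm h2 h1]

variable {D : DoublePartition n}

theorem lo_coe (s : Side) (x : Fin n) : D.intervals.lo s x = blockLo (D.part s) x :=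
  extendFin_coe _ x

theorem hi_coe (s : Side) (x : Fin n) : D.intervals.hi s x = blockHi (D.part s) x :=
  extendFin_coe _ x

theorem sum_coe (s : Side) (x : Fin n) : D.intervals.sum s x = blockSum (D.part s) x := by
  rw [IntervalPair.sum, lo_coe, hi_coe, blockSum]

theorem lo_of_not {s : Side} {x : ℤ} (h : ¬ ∃ y : Fin n, (y : ℤ) = x) : D.intervals.lo s x = x :=
  extendFin_of_not h

theorem hi_of_not {s : Side} {x : ℤ} (h : ¬ ∃ y : Fin n, (y : ℤ) = x) : D.intervals.hi s x = x :=
  extendFin_of_not h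

theorem exists_fin_of_lt_hi {s : Side} {x : ℤ} (h : x < D.intervals.hi s x) :
    ∃ y : Fin n, (y : ℤ) = x := by
  by_contra hx
  rw [hi_of_not hx] at h
  omega

theorem isLeftSet_markedPoints (𝓜 : Set (HalfArc D)) (s : Side) :
    IsLeftSet (D.part s) (markedPoints 𝓜 s) := by
  rintro _ ⟨a, -, rfl, rfl⟩
  obtain ⟨h1, h2⟩ := (dynkinSwap_iff _).1 a.swap
  have h3 : (a.left : ℕ) ≤ a.right := a.le
  exact ⟨h1, by omega⟩

/-- Two half-integers lie on one meander. -/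
def SameMeanderInt (D : DoublePartition n) (i j : ℤ) : Prop :=
  i = j ∨ ∃ a b : Fin n, (a : ℤ) = i ∧ (b : ℤ) = j ∧ SameMeander D a b

theorem sameMeander_equivalence (D : DoublePartition n) : Equivalence (SameMeander D) :=
  Relation.EqvGen.is_equivalence _

theorem sameMeanderInt_equivalence (D : DoublePartition n) : Equivalence (SameMeanderInt D) where
  refl _ := Or.inl rfl
  symm := by
    rintro _ _ (rfl | ⟨a, b, rfl, rfl, h⟩)
    · exact Or.inl rfl
    · exact Or.inr ⟨b, a, rfl, rfl, (sameMeander_equivalence D).symm h⟩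
  trans := by
    rintro _ _ _ (rfl | ⟨a, b, rfl, rfl, h⟩) (rfl | ⟨a', b', h', rfl, h''⟩)
    · exact Or.inl rfl
    · exact Or.inr ⟨a', b', h', rfl, h''⟩
    · exact Or.inr ⟨a, b, rfl, rfl, h⟩
    · obtain rfl : a' = b := Fin.ext (by simpa using h')
      exact Or.inr ⟨a, b', rfl, rfl, (sameMeander_equivalence D).trans h h''⟩

theorem sameMeanderInt_coe {a b : Fin n} (h : SameMeanderInt D a b) : SameMeander D a b := by
  rcases h with h | ⟨a', b', h1, h2, h⟩
  · obtain rfl : a = b := Fin.ext (by simpa using h)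
    exact (sameMeander_equivalence D).refl _
  · obtain rfl : a' = a := Fin.ext (by simpa using h1)
    obtain rfl : b' = b := Fin.ext (by simpa using h2)
    exact h

theorem HalfArc.right_val (a : HalfArc D) :
    (a.right : ℤ) = blockSum (D.part a.side) a.left - 1 - a.left :=
  ((dynkinSwap_iff _).1 a.swap).2

theorem exists_arc_of_isMarkedHalf {𝓜 : Set (HalfArc D)} {s : Side} {i : ℤ}
    (h : IsMarkedHalf (D.part s) (markedPoints 𝓜 s) i) :
    ∃ a ∈ 𝓜, a.side = s ∧ (i = a.left ∨ i = a.right) := by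
  obtain ⟨_, ⟨a, ha, rfl, rfl⟩, h⟩ := h
  rw [← a.right_val] at h
  exact ⟨a, ha, rfl, h⟩

theorem isMarkedHalf_of_arc {𝓜 : Set (HalfArc D)} {a : HalfArc D} (ha : a ∈ 𝓜) {i : ℤ}
    (h : i = a.left ∨ i = a.right) :
    IsMarkedHalf (D.part a.side) (markedPoints 𝓜 a.side) i := by
  rw [a.right_val] at h
  exact ⟨a.left, ⟨a, ha, rfl, rfl⟩, h⟩

theorem HalfArc.sameMeander (a : HalfArc D) {i : Fin n} (h : (i : ℤ) = a.left ∨ (i : ℤ) = a.right) :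
    SameMeander D i a.left := by
  rcases h with h | h
  · obtain rfl : i = a.left := Fin.ext (by simpa using h)
    exact (sameMeander_equivalence D).refl _
  · obtain rfl : i = a.right := Fin.ext (by simpa using h)
    exact (sameMeander_equivalence D).symm (.rel _ _ ⟨a.side, a.swap⟩)

theorem HalfArc.left_lt (a : HalfArc D) : (a.left : ℕ) + 1 < n := by
  have h1 := ((dynkinSwap_iff _).1 a.swap).1
  have h2 := blockHi_lt (D.part a.side) a.left
  omega

theorem HalfArc.index_eq (a : HalfArc D) :
    (D.part a.side).index a.left = (D.part a.side).index a.right := a.swap.1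

theorem IsMarking.arc_unique {𝓜 : Set (HalfArc D)} (h𝓜 : IsMarking D 𝓜) {a b : HalfArc D}
    (ha : a ∈ 𝓜) (hb : b ∈ 𝓜) (h : SameMeander D a.left b.left) : a = b := by
  obtain ⟨x, -, -, h2, -⟩ := h𝓜 a.left a.left_lt
  rw [h2 a ha ((sameMeander_equivalence D).refl _), h2 b hb h]

theorem IsMarking.isEnd {𝓜 : Set (HalfArc D)} (h𝓜 : IsMarking D 𝓜) {a b : HalfArc D}
    (ha : a ∈ 𝓜) (hb : b.IsEnd) (h : SameMeander D a.left b.left) : a.IsEnd := by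
  obtain ⟨x, -, -, h2, h3⟩ := h𝓜 a.left a.left_lt
  rw [h2 a ha ((sameMeander_equivalence D).refl _)]
  exact h3 ⟨b, h, hb⟩

/-- Where the two reflections agree, a half-integer meander consists of one arc above and the
same arc below. -/
theorem eq_of_sameMeander {i j : Fin n} {P : ℤ} (hP : ∀ s, blockSum (D.part s) i = P)
    (hi : ∀ s, (i : ℤ) < blockHi (D.part s) i)
    (h : SameMeander D i j) : (j : ℤ) = i ∨ (j : ℤ) = P - 1 - i := by
  have hstep : ∀ s (a b : Fin n), DynkinSwap (D.part s) a b → ((a : ℤ) = i ∨ (a : ℤ) = P - 1 - i) →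
      ((b : ℤ) = i ∨ (b : ℤ) = P - 1 - i) := by
    intro s a b hab ha
    obtain ⟨h1, h2⟩ := (dynkinSwap_iff _).1 hab
    rcases ha with ha | ha
    · obtain rfl : a = i := Fin.ext (by simpa using ha)
      rw [hP] at h2
      exact Or.inr h2
    · have h3 := blockLo_le (D.part s) i
      have h4 := hi s
      have h5 := hP s
      rw [blockSum] at h5
      rw [blockSum_congr _ (index_eq_of_mem (D.part s) (x := i) (y := a) (by omega) (by omega)),
        hP] at h2
      omega
  have key : ∀ a b : Fin n, SameMeander D a b →
      (((a : ℤ) = i ∨ (a : ℤ) = P - 1 - i) ↔ ((b : ℤ) = i ∨ (b : ℤ) = P - 1 - i)) := by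
    intro a b hab
    induction hab with
    | rel a b h =>
      obtain ⟨s, h⟩ := h
      exact ⟨hstep s a b h, hstep s b a (dynkinSwap_symm _ h)⟩
    | refl a => exact Iff.rfl
    | symm a b _ ih => exact ih.symm
    | trans a b c _ _ ih1 ih2 => exact ih1.trans ih2
  exact (key i j h).1 (Or.inl rfl)

/-- The marked pair on the integers given by the choices of the construction. -/
noncomputable def ModifiedPair.toMarkedPair (A : ModifiedPair D) : MarkedPair where
  toIntervalPair := D.intervals
  σ s := extendFin fun x => (A.σ s x : ℤ)
  M s := IsMarkedHalf (D.part s) (markedPoints A.marks s)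
  rel := SameMeanderInt D
  rel_equiv := sameMeanderInt_equivalence D
  rel_swap s i hi := by
    obtain ⟨i, rfl⟩ := exists_fin_of_lt_hi hi
    rw [sum_coe]
    rw [hi_coe] at hi
    have h1 := blockLo_le (D.part s) i
    obtain ⟨j, hj⟩ := exists_fin_of_mem (D.part s) (x := i) (y := blockSum (D.part s) i - 1 - i)
      (by rw [blockSum]; omega) (by rw [blockSum]; omega)
    exact Or.inr ⟨i, j, rfl, hj, .rel _ _ ⟨s, (dynkinSwap_iff _).2 ⟨hi, hj⟩⟩⟩
  σ_σ s x := by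
    by_cases hx : ∃ y : Fin n, (y : ℤ) = x
    · obtain ⟨y, rfl⟩ := hx
      rw [extendFin_coe, extendFin_coe, (A.isModified s).involutive]
    · rw [extendFin_of_not hx, extendFin_of_not hx]
  lo_σ s x := by
    by_cases hx : ∃ y : Fin n, (y : ℤ) = x
    · obtain ⟨y, rfl⟩ := hx
      rw [extendFin_coe, lo_coe, lo_coe]
      exact blockLo_congr _ ((A.isModified s).index_eq (isLeftSet_markedPoints _ s) y)
    · rw [extendFin_of_not hx]
  σ_antidiag s x h := by
    by_cases hx : ∃ y : Fin n, (y : ℤ) = x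
    · obtain ⟨y, rfl⟩ := hx
      rw [extendFin_coe] at h ⊢
      rw [sum_coe]
      exact (A.isModified s).antidiag (isLeftSet_markedPoints _ s) h
    · rw [extendFin_of_not hx] at h
      omega
  mark_of_lt s x i h1 h2 := by
    by_cases hx : ∃ y : Fin n, (y : ℤ) = x
    · obtain ⟨y, rfl⟩ := hx
      rw [extendFin_coe, sum_coe] at h2
      exact (A.isModified s).isMarkedHalf (isLeftSet_markedPoints _ s) (Or.inl ⟨h1, h2⟩)
    · rw [extendFin_of_not hx, IntervalPair.sum, lo_of_not hx, hi_of_not hx] at h2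
      omega
  mark_of_gt s x i h1 h2 := by
    by_cases hx : ∃ y : Fin n, (y : ℤ) = x
    · obtain ⟨y, rfl⟩ := hx
      rw [extendFin_coe, sum_coe] at h1
      exact (A.isModified s).isMarkedHalf (isLeftSet_markedPoints _ s) (Or.inr ⟨h1, h2⟩)
    · rw [extendFin_of_not hx, IntervalPair.sum, lo_of_not hx, hi_of_not hx] at h1
      omega
  lt_of_mark s i h := by
    obtain ⟨a, ha, rfl, rfl | rfl⟩ := exists_arc_of_isMarkedHalf h
    · rw [hi_coe]
      exact ((dynkinSwap_iff _).1 a.swap).1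
    · rw [hi_coe]
      exact ((dynkinSwap_iff _).1 (dynkinSwap_symm _ a.swap)).1
  mark_symm s i h := by
    obtain ⟨a, ha, rfl, rfl | rfl⟩ := exists_arc_of_isMarkedHalf h
    · rw [sum_coe, ← a.right_val]
      exact isMarkedHalf_of_arc ha (Or.inr rfl)
    · rw [sum_coe, ← ((dynkinSwap_iff _).1 (dynkinSwap_symm _ a.swap)).2]
      exact isMarkedHalf_of_arc ha (Or.inl rfl)
  mark_unique s t i j hMi hMj hij := by
    obtain ⟨a, ha, rfl, hi⟩ := exists_arc_of_isMarkedHalf hMi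
    obtain ⟨b, hb, rfl, hj⟩ := exists_arc_of_isMarkedHalf hMj
    obtain ⟨i, rfl⟩ : ∃ y : Fin n, (y : ℤ) = i := by
      rcases hi with rfl | rfl
      exacts [⟨_, rfl⟩, ⟨_, rfl⟩]
    obtain ⟨j, rfl⟩ : ∃ y : Fin n, (y : ℤ) = j := by
      rcases hj with rfl | rfl
      exacts [⟨_, rfl⟩, ⟨_, rfl⟩]
    have h := sameMeander_equivalence D
    obtain rfl := A.isMarking.arc_unique ha hb (h.trans (h.symm (a.sameMeander hi))
      (h.trans (sameMeanderInt_coe hij) (b.sameMeander hj)))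
    refine ⟨rfl, ?_⟩
    have h1 := a.right_val
    rw [sum_coe]
    have h2 : blockSum (D.part a.side) i = blockSum (D.part a.side) a.left := by
      rcases hi with hi | hi
      · rw [show i = a.left from Fin.ext (by simpa using hi)]
      · rw [show i = a.right from Fin.ext (by simpa using hi), blockSum_congr _ a.index_eq]
    omega
  mark_end s t i e hMi hie he := by
    obtain ⟨a, ha, rfl, hi⟩ := exists_arc_of_isMarkedHalf hMi
    obtain ⟨i, rfl⟩ : ∃ y : Fin n, (y : ℤ) = i := by
      rcases hi with rfl | rfl
      exacts [⟨_, rfl⟩, ⟨_, rfl⟩]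
    obtain ⟨e, rfl⟩ : ∃ y : Fin n, (y : ℤ) = e := by
      by_contra hx
      rw [IntervalPair.sum, lo_of_not hx, hi_of_not hx] at he
      omega
    rw [sum_coe] at he ⊢
    -- A fixed half-integer is an end, so the marking rule forces the marked arc on its meander to
    -- be an end as well.
    have h1 : DynkinSwap (D.part t) e e := by
      have h2 := blockLo_le (D.part t) e
      have h3 := le_blockHi (D.part t) e
      rw [dynkinSwap_iff]
      rw [blockSum] at *
      omega
    have h := sameMeander_equivalence D
    have h2 : a.left = a.right := A.isMarking.isEnd (b := ⟨t, e, e, le_rfl, h1⟩) ha rfl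
      (h.trans (h.symm (a.sameMeander hi)) (sameMeanderInt_coe hie))
    have h3 := a.right_val
    rw [← h2] at hi h3
    rw [show i = a.left from Fin.ext (by simpa using hi)]
    omega
  exists_mark i h1 h2 := by
    obtain ⟨i, rfl⟩ := exists_fin_of_lt_hi (h1 .above)
    rw [sum_coe, sum_coe] at h2
    have h3 : ∀ s, blockSum (D.part s) i = blockSum (D.part .above) i := fun s => by
      cases s; exacts [rfl, h2.symm]
    have h4 : ∀ s, (i : ℤ) < blockHi (D.part s) i := fun s => by
      rw [← hi_coe]; exact h1 s
    obtain ⟨a, ha, h5, -⟩ := A.isMarking i (by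
      have := h4 .above
      have := blockHi_lt (D.part .above) i
      omega)
    refine ⟨a.side, isMarkedHalf_of_arc ha ?_⟩
    have h6 := a.right_val
    -- The meander consists of `i` and its mirror image only, so its marked arc passes through `i`.
    rcases eq_of_sameMeander h3 h4 h5 with h7 | h7
    · exact Or.inl h7.symm
    · right
      have h8 := blockLo_le (D.part a.side) i
      have h9 := h4 a.side
      have h10 := h3 a.side
      rw [h6, blockSum_congr _ (index_eq_of_mem (D.part a.side) (x := i) (y := a.left)
        (by rw [blockSum] at h10; omega) (by rw [blockSum] at h10; omega))]
      omega
  exists_run s i hi h := by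
    obtain ⟨i, rfl⟩ : ∃ y : Fin n, (y : ℤ) = i := by
      obtain ⟨a, ha, rfl, rfl | rfl⟩ := exists_arc_of_isMarkedHalf hi
      exacts [⟨_, rfl⟩, ⟨_, rfl⟩]
    have hm := isLeftSet_markedPoints A.marks s
    rw [sum_coe] at h ⊢
    have hi' := hm.isMarkedHalf_left hi h
    obtain ⟨p, q, hr, hp, hq⟩ := exists_isMarkedRun hi'
    obtain ⟨h1, h2, h3, h4⟩ := hm.run_bounds hr
    have hidx := hm.run_index hr hp hq
    rw [blockSum_congr _ hidx, lo_coe, blockLo_congr _ hidx]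
    refine ⟨p, q, h1, by exact_mod_cast hp, by exact_mod_cast hq, h3, fun j hj1 hj2 =>
      hm.isMarkedHalf_of_run hr (Or.inl ⟨hj1, hj2⟩), fun hp' => ?_,
      (A.isModified s).isAntiToeplitz hm hr fun x => extendFin_coe _ x⟩
    -- A marked half-integer `p - 1` would be the left end of a marked arc in the same interval,
    -- contradicting that the run starts at `p`.
    obtain ⟨t, ht⟩ : ∃ y : Fin n, (y : ℤ) = p - 1 := by
      obtain ⟨a, ha, rfl, h | h⟩ := exists_arc_of_isMarkedHalf hp'
      exacts [⟨_, h.symm⟩, ⟨_, h.symm⟩]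
    rw [← ht] at hp'
    have h5 : (t : ℤ) < blockHi (D.part s) t := by
      obtain ⟨a, ha, rfl, h | h⟩ := exists_arc_of_isMarkedHalf hp'
      · rw [show t = a.left from Fin.ext (by simpa using h)]
        exact ((dynkinSwap_iff _).1 a.swap).1
      · rw [show t = a.right from Fin.ext (by simpa using h)]
        exact ((dynkinSwap_iff _).1 (dynkinSwap_symm _ a.swap)).1
    have h6 := blockLo_le (D.part s) t
    have h7 : (D.part s).index p = (D.part s).index t :=
      index_eq_of_mem _ (by omega) (by omega)
    refine hr.2.2.1 t (by omega) (hm.isMarkedHalf_left hp' ?_)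
    rw [← blockSum_congr _ h7]
    omega

end Pair

/-! ### From the linear order of the points to the regular nilpotent form -/

section Assembly

attribute [local instance 100] LieRing.ofAssociativeRing

open Relation

/-- The list construction needs a finite vertex set, but the arc system lives on the integers. A
subset closed under arrows in both directions keeps its sources and sinks, and so inherits all the
properties. -/
theorem IsArcSystem.comap {V W γ : Type*} {S Ok : W → W → Prop} {D : W → ℤ} {cell : W → γ}
    (H : IsArcSystem S Ok D cell) (f : V → W) (hf : Function.Injective f)
    (hin : ∀ a y, S y (f a) → ∃ b, f b = y) (hout : ∀ a y, S (f a) y → ∃ b, f b = y) :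
    IsArcSystem (fun a b => S (f a) (f b)) (fun a b => Ok (f a) (f b)) (fun a => D (f a))
      fun a => cell (f a) := by
  have hin' : ∀ a, (∀ b, ¬ S (f b) (f a)) → ∀ y, ¬ S y (f a) := fun a h y hy => by
    obtain ⟨b, rfl⟩ := hin a y hy
    exact h b hy
  have hout' : ∀ a, (∀ b, ¬ S (f a) (f b)) → ∀ y, ¬ S (f a) y := fun a h y hy => by
    obtain ⟨b, rfl⟩ := hout a y hy
    exact h b hy
  exact
  { acyclic := fun v h => H.acyclic (f v) (TransGen.lift f (fun _ _ h => h) _ _ h)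
    cell_or := fun u v => H.cell_or _ _
    D_cell := fun u v => H.D_cell _ _
    succ_two := fun u v w h1 h2 h3 =>
      (H.succ_two _ _ _ h1 h2 (hf.ne h3)).imp_left fun h x => h _
    succ_le := fun u v w x h1 h2 h3 h4 =>
      (H.succ_le _ _ _ _ h1 h2 (hf.ne h3) h4).imp (@hf _ _) (@hf _ _)
    pred_two := fun u v w h1 h2 h3 =>
      (H.pred_two _ _ _ h1 h2 (hf.ne h3)).imp_left fun h x => h _
    pred_le := fun u v w x h1 h2 h3 h4 =>
      (H.pred_le _ _ _ _ h1 h2 (hf.ne h3) h4).imp (@hf _ _) (@hf _ _)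
    source_D := fun u v h1 h2 => H.source_D _ _ h1 (hin' _ h2)
    sink_D := fun u v h1 h2 => H.sink_D _ _ h1 (hout' _ h2)
    ok_D := fun u v => H.ok_D _ _
    ok_succ := fun x s t u v h1 h2 h3 => H.ok_succ _ _ _ _ _ h1 h2 (hf.ne h3)
    ok_pred := fun x s t u v h1 h2 h3 => H.ok_pred _ _ _ _ _ h1 h2 (hf.ne h3)
    cell_pred := fun z s t h1 h2 h3 => H.cell_pred _ _ _ h1 h2 (hf.ne h3)
    no_square := fun u v w x h1 h2 h3 h4 h5 => hf (H.no_square _ _ _ _ h1 h2 h3 h4 (hf.ne h5))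
    zero_unique := fun u v h1 h2 h3 h4 => hf (H.zero_unique _ _ h1 h2 (hin' _ h3) (hin' _ h4))
    isolated_unique := fun u v h1 h2 h3 h4 h5 =>
      hf (H.isolated_unique _ _ h1 (hin' _ h2) (hout' _ h3) (hin' _ h4) (hout' _ h5)) }

theorem GoodList.lt_of_arrow {V : Type*} {S Ok : V → V → Prop} {l : List V}
    (h : GoodList S Ok l) {i j : ℕ} (hi : i < l.length) (hj : j < l.length) (hS : S l[i] l[j]) :
    i < j := by
  induction h with
  | nil => simp at hi
  | @snoc l v hl hv hp _ ih =>
    simp only [List.length_append, List.length_singleton] at hi hj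
    by_cases hjl : j < l.length
    · rw [List.getElem_append_left hjl] at hS
      by_cases hil : i < l.length
      · rw [List.getElem_append_left hil] at hS
        exact ih hil hjl hS
      · rw [List.getElem_append_right (by omega)] at hS
        exact absurd (hl.mem_of_pred (List.getElem_mem hjl) (by simpa using hS)) hv
    · by_cases hil : i < l.length
      · omega
      · rw [List.getElem_append_right (by omega), List.getElem_append_right (by omega)] at hS
        exact absurd (hp v (by simpa using hS)) hv

theorem GoodList.succ {V : Type*} {S Ok : V → V → Prop} {l : List V}
    (h : GoodList S Ok l) {i : ℕ} (hi : i + 1 < l.length) :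
    S l[i] l[i + 1] ∨ Ok l[i] l[i + 1] := by
  induction h with
  | nil => simp at hi
  | @snoc l v hl hv hp hlast ih =>
    simp only [List.length_append, List.length_singleton] at hi
    have hil : i < l.length := by omega
    rw [List.getElem_append_left hil]
    by_cases hjl : i + 1 < l.length
    · rw [List.getElem_append_left hjl]
      exact ih hjl
    · rw [List.getElem_append_right (by omega)]
      have := hlast l[i] (by
        rw [Option.mem_def, List.getLast?_eq_getElem?, List.getElem?_eq_some_iff]
        exact ⟨by omega, by congr 1; omega⟩)
      simpa using this

variable {n : ℕ} {D : DoublePartition n}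

/-- The root `ε_a - ε_b` belongs to the set `S`. -/
def ModifiedPair.Arrow (A : ModifiedPair D) (a b : Fin n) : Prop :=
  (a < b ∧ A.σ .above a = b) ∨ (b < a ∧ A.σ .below a = b)

/-- The matrix unit `E_{ab}` is orthogonal to the biparabolic subalgebra. -/
def DoublePartition.Off (D : DoublePartition n) (a b : Fin n) : Prop :=
  (a < b ∧ D.pos.index a ≠ D.pos.index b) ∨ (b < a ∧ D.neg.index a ≠ D.neg.index b)

theorem ModifiedPair.toMarkedPair_σ (A : ModifiedPair D) (s : Side) (a : Fin n) :
    A.toMarkedPair.σ s a = (A.σ s a : ℕ) :=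
  extendFin_coe (fun x => ((A.σ s x : ℕ) : ℤ)) a

theorem ModifiedPair.mem_roots (A : ModifiedPair D) {α : Root n} :
    α ∈ A.roots ↔ A.Arrow α.1.1 α.1.2 := by
  rw [ModifiedPair.roots, Finset.mem_filter, and_iff_right (Finset.mem_univ _)]
  rfl

theorem ModifiedPair.arrow_iff (A : ModifiedPair D) {a b : Fin n} :
    A.toMarkedPair.Arrow a b ↔ A.Arrow a b := by
  simp only [MarkedPair.Arrow, ModifiedPair.Arrow, A.toMarkedPair_σ, Fin.lt_def, Fin.ext_iff, Nat.cast_inj,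
    Nat.cast_lt]

theorem off_iff {a b : Fin n} : D.intervals.Off a b ↔ D.Off a b := by
  have h : ∀ s, D.intervals.lo s a ≠ D.intervals.lo s b ↔
      (D.part s).index a ≠ (D.part s).index b := fun s => by
    rw [lo_coe, lo_coe]
    exact not_congr ⟨index_eq_of_blockLo_eq _, blockLo_congr _⟩
  simp only [IntervalPair.Off, DoublePartition.Off, h, Fin.lt_def, Nat.cast_lt]
  rfl

/-- The points can be ordered such that the roots in `S` are positive and the other simple roots of
this order are orthogonal to the biparabolic subalgebra. -/
theorem ModifiedPair.exists_order (A : ModifiedPair D) :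
    ∃ e : Fin n ≃ Fin n, (∀ i j, A.Arrow (e i) (e j) → i < j) ∧
      ∀ i j : Fin n, (j : ℕ) = i + 1 → A.Arrow (e i) (e j) ∨ D.Off (e i) (e j) := by
  have H := A.toMarkedPair.isArcSystem.comap (fun a : Fin n => (a : ℤ))
    (fun a b h => Fin.ext (by simpa using h)) ?_ ?_
  · obtain ⟨l, hl, hmem⟩ := H.exists_goodList
    have hlen : l.length = n := by
      have h1 : l.toFinset = Finset.univ := Finset.eq_univ_of_forall fun v => by simpa using hmem v
      have h2 := List.toFinset_card_of_nodup hl.nodup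
      rw [h1, Finset.card_univ, Fintype.card_fin] at h2
      exact h2.symm
    let e : Fin n → Fin n := fun i => l[(i : ℕ)]'(by rw [hlen]; exact i.2)
    have he : Function.Injective e := fun i j hij =>
      Fin.ext ((hl.nodup.getElem_inj_iff).1 hij)
    refine ⟨Equiv.ofBijective e (Finite.injective_iff_bijective.1 he), fun i j h => ?_,
      fun i j hij => ?_⟩
    · rw [← A.arrow_iff] at h
      exact hl.lt_of_arrow (by rw [hlen]; exact i.2) (by rw [hlen]; exact j.2) h
    · rw [← A.arrow_iff, ← off_iff]
      have h := hl.succ (i := i) (by have := j.2; omega)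
      simp only [Equiv.ofBijective_apply, e, hij]
      exact h
  · rintro a y hy
    rw [MarkedPair.arrow_comm] at hy
    rcases hy with ⟨-, rfl⟩ | ⟨-, rfl⟩
    · exact ⟨A.σ .above a, (A.toMarkedPair_σ _ a).symm⟩
    · exact ⟨A.σ .below a, (A.toMarkedPair_σ _ a).symm⟩
  · rintro a y (⟨-, rfl⟩ | ⟨-, rfl⟩)
    · exact ⟨A.σ .above a, (A.toMarkedPair_σ _ a).symm⟩
    · exact ⟨A.σ .below a, (A.toMarkedPair_σ _ a).symm⟩

variable {k : Type*} [Field k]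

theorem sum_roots_apply (A : ModifiedPair D) (u : Root n → kˣ) (a b : Fin n) :
    (∑ α ∈ A.roots, single α.1.1 α.1.2 α.2 (u α : k) : sl (Fin n) k).val a b =
      ∑ α ∈ A.roots, if α.1 = (a, b) then (u α : k) else 0 := by
  have h := map_sum (sl (Fin n) k).toSubmodule.subtype
    (fun α : Root n => single α.1.1 α.1.2 α.2 (u α : k)) A.roots
  refine (congrFun (congrFun h a) b).trans ?_
  rw [Matrix.sum_apply]
  refine Finset.sum_congr rfl fun α _ => ?_
  change (single α.1.1 α.1.2 α.2 (u α : k)).val a b = _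
  rw [LieAlgebra.SpecialLinear.val_single, Matrix.single_apply]
  simp only [Prod.ext_iff]

theorem sum_roots_eq_zero (A : ModifiedPair D) (u : Root n → kˣ) {a b : Fin n}
    (h : ¬ A.Arrow a b) :
    (∑ α ∈ A.roots, single α.1.1 α.1.2 α.2 (u α : k) : sl (Fin n) k).val a b = 0 := by
  rw [sum_roots_apply]
  refine Finset.sum_eq_zero fun α hα => if_neg fun h' => h ?_
  rwa [A.mem_roots, h'] at hα

theorem sum_roots_ne_zero (A : ModifiedPair D) (u : Root n → kˣ) {a b : Fin n}
    (h : A.Arrow a b) :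
    (∑ α ∈ A.roots, single α.1.1 α.1.2 α.2 (u α : k) : sl (Fin n) k).val a b ≠ 0 := by
  have hab : a ≠ b := by
    rcases h with h | h
    · exact h.1.ne
    · exact h.1.ne'
  rw [sum_roots_apply, Finset.sum_eq_single ⟨(a, b), hab⟩]
  · simp
  · intro β _ hβ
    exact if_neg fun h' => hβ (Subtype.ext h')
  · intro hnot
    exact absurd (A.mem_roots.2 h) hnot

/-- Matrix units in positions off the support vanish on the biparabolic subalgebra. -/
theorem restrictForm_killingForm_eq_zero {N : sl (Fin n) k}
    (hN : ∀ a b, N.val a b ≠ 0 → D.Off a b) :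
    restrictForm k D (killingForm k (sl (Fin n) k) N) = 0 := by
  ext x
  change killingForm k (sl (Fin n) k) N x.1.1 = 0
  rw [killingForm_sl, Matrix.trace]
  refine mul_eq_zero_of_right _ (Finset.sum_eq_zero fun a _ => ?_)
  rw [Matrix.diag_apply, Matrix.mul_apply]
  refine Finset.sum_eq_zero fun b _ => ?_
  by_cases h : N.val a b = 0
  · rw [h, zero_mul]
  · refine mul_eq_zero_of_right _ ?_
    -- In the trace form the entry `(a, b)` of `N` meets the entry `(b, a)` of `x`, which is zero
    -- exactly by the support conditions that `Off` negates.
    obtain ⟨h1, h2⟩ := x.1.2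
    rcases hN a b h with ⟨h3, h4⟩ | ⟨h3, h4⟩
    · exact h2 b a fun h5 => h5.elim (fun h => absurd h h3.not_ge) fun h => h4 h.symm
    · exact h1 b a fun h5 => h5.elim (fun h => absurd h h3.not_ge) fun h => h4 h.symm

/-- Put a 1 at every pair of neighbours in the order that carries no root of `S`. This fills the
superdiagonal, and such positions are orthogonal to the biparabolic subalgebra, so the restriction
remains `η`. -/
theorem ModifiedPair.exists_regular_nilpotent [CharZero k] (hn : 0 < n) (A : ModifiedPair D)
    (u : Root n → kˣ) :
    ∃ y : Module.Dual k (sl (Fin n) k),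
      IsRegularForm k y ∧ IsNilpotentForm k y ∧ restrictForm k D y = A.eta u := by
  classical
  obtain ⟨e, he1, he2⟩ := A.exists_order
  let N' : Matrix (Fin n) (Fin n) k := fun a b =>
    if ((e.symm b : Fin n) : ℕ) = e.symm a + 1 ∧ ¬ A.Arrow a b then 1 else 0
  have htr : N'.trace = 0 := Finset.sum_eq_zero fun a _ => if_neg fun h => by omega
  let N : sl (Fin n) k := ⟨N', htr⟩
  have hN : ∀ a b, N.val a b = if ((e.symm b : Fin n) : ℕ) = e.symm a + 1 ∧ ¬ A.Arrow a b
    then 1 else 0 := fun _ _ => rfl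
  have hadd : ∀ X : sl (Fin n) k, ∀ a b, (X + N).val a b = X.val a b + N.val a b := fun _ _ _ => rfl
  have h := isRegularForm_isNilpotentForm_killingForm hn
    ((∑ α ∈ A.roots, single α.1.1 α.1.2 α.2 (u α : k)) + N) e ?_ ?_
  · refine ⟨_, h.1, h.2, ?_⟩
    have h0 : restrictForm k D (killingForm k (sl (Fin n) k) N) = 0 := by
      refine restrictForm_killingForm_eq_zero fun a b hab => ?_
      rw [hN] at hab
      have h1 : ((e.symm b : Fin n) : ℕ) = e.symm a + 1 ∧ ¬ A.Arrow a b := by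
        by_contra h1
        exact hab (if_neg h1)
      have h2 := he2 _ _ h1.1
      rw [e.apply_symm_apply, e.apply_symm_apply] at h2
      exact h2.resolve_left h1.2
    rw [ModifiedPair.eta, map_add]
    have h1 : ∀ y z, restrictForm k D (y + z) = restrictForm k D y + restrictForm k D z :=
      fun _ _ => rfl
    rw [h1, h0, add_zero]
  · intro i j hij
    rw [hadd, sum_roots_eq_zero A u fun h => absurd (he1 i j h) hij.not_gt, zero_add, hN]
    refine if_neg fun h => ?_
    have h1 := h.1
    rw [e.symm_apply_apply, e.symm_apply_apply] at h1
    rw [Fin.le_def] at hij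
    omega
  · intro i j hij
    rw [hadd]
    by_cases hA : A.Arrow (e i) (e j)
    · rw [hN, if_neg fun h => h.2 hA, add_zero]
      exact sum_roots_ne_zero A u hA
    · rw [sum_roots_eq_zero A u hA, zero_add, hN, if_pos ⟨by simpa using hij, hA⟩]
      exact one_ne_zero

end Assembly

end Biparabolic

theorem theorem9p1 {k : Type*} [Field k] [IsAlgClosed k] [CharZero k] {n : ℕ} (hn : 1 < n)
    (D : Biparabolic.DoublePartition n) :
    (∀ (P : Biparabolic.ModifiedPair D) (u : Biparabolic.Root n → kˣ),
      ∃ y : Module.Dual k (LieAlgebra.SpecialLinear.sl (Fin n) k),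
        Biparabolic.IsRegularForm k y ∧ Biparabolic.IsNilpotentForm k y ∧
          Biparabolic.restrictForm k D y = P.eta u) ∧
    (∀ h η, (h, η) ∈ Biparabolic.constructedAdaptedPairs k D →
      ∃ y : Module.Dual k (LieAlgebra.SpecialLinear.sl (Fin n) k),
        Biparabolic.IsRegularForm k y ∧ Biparabolic.IsNilpotentForm k y ∧
          Biparabolic.restrictForm k D y = η) := by
  have key : ∀ (P : Biparabolic.ModifiedPair D) (u : Biparabolic.Root n → kˣ),
      ∃ y : Module.Dual k (LieAlgebra.SpecialLinear.sl (Fin n) k),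
        Biparabolic.IsRegularForm k y ∧ Biparabolic.IsNilpotentForm k y ∧
          Biparabolic.restrictForm k D y = P.eta u := fun P u =>
    P.exists_regular_nilpotent (by omega) u
  refine ⟨key, ?_⟩
  rintro h η ⟨-, -, P, u, rfl⟩
  exact key P u
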